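/- A stochastic automaton (SA) $\mathcal S=(Q,C,A,\rightarrow,\kappa,F)$ consists of finite sets $Q$ of locations, $C$ of clocks and $A$ of actions, a set of edges $\rightarrow\ \subseteq Q\times A\times 2^C\times Q$, a map $\kappa:Q\to 2^C$ and a probability distribution $F(c)$ on $\mathbb R_{\ge 0}$ for each clock $c$. Its states are the pairs $(q,\xi)\in Q\times\mathbb R^C$. In state $(q,\xi)$ the automaton idles for the least time $t\ge 0$ after which some edge $(q,a,X,q')$ is enabled, i.e. $\xi(c)-t\le 0$ for all $c\in X$; for each edge $(q,a,X,q')$ that is then enabled, the label $(a,t)\in A\times\mathbb R_{\ge 0}$ has an available successor distribution: location $q'$, clocks $c\notin\kappa(q')$ with value $\xi(c)-t$, clocks $c\in\kappa(q')$ sampled independently from $F(c)$. If no edge leaves $q$, the automaton halts. Let $\tau_{\ell}(s)$ be the set of distributions available in state $s$ under label $\ell$. For a measurable set $B$ of labels, write $s\xrightarrow{B}\mu$ if for some $\ell\in B$ the distribution $\mu$ is a (generalised) convex combination of $\tau_\ell(s)$, i.e. $\mu=\int\mu'\,\nu(d\mu')$ for a measure $\nu$ on distributions with $\nu(\tau_\ell(s))=1$;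 let $S_B$ be the set of states $s$ that have such a $\mu$. For distributions $\mu,\mu'$ over states write $\mu\xrightarrow{B}\mu'$ if $\mu(S_B)>0$ and $\mu'=\frac{1}{\mu(S_B)}\int_{S_B}\nu_s\,\mu(ds)$ for some measurable choice of $\nu_s$ with $s\xrightarrow{B}\nu_s$ for all $s\in S_B$. A symmetric relation $R$ between distributions over states is a bisimulation if $\mu\,R\,\nu$ implies, for each measurable set $B$ of labels, that $\mu(S_B)=\nu(S_B)$ and that for each $\mu\xrightarrow{B}\mu'$ there is $\nu\xrightarrow{B}\nu'$ with $\mu'\,R\,\nu'$; and $\mu\sim\nu$ if some bisimulation relates them. For locations, $q_1\sim q_2$ means $\mu_1\sim\mu_2$, where $\mu_i$ is the distribution with location $q_i$, clocks $c\notin\kappa(q_i)$ equal to $0$, and clocks $c\in\kappa(q_i)$ sampled independently from $F(c)$. The SA is deterministic if, when it is started in any location, the probability that two distinct edges become enabled at the same time is zero: for every $q$ and every distribution reachable from the initial distribution of $q$ by transitions $\xrightarrow{B}$, the set of states in which two distinct edges are enabled after the idling time has measure zero. **Theorem.** There are an algorithm, a polynomial $b$ and a constant $k$ such that, for every deterministic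 stochastic automaton $\mathcal S$ all of whose clocks are exponentially distributed with positive rational rates (given explicitly in binary) and for all locations $q_1,q_2$ of $\mathcal S$, the algorithm on input $(\mathcal S,q_1,q_2)$ halts after at most $b(|\mathcal S|)\cdot 2^{k|C|}$ steps and decides whether $q_1\sim q_2$, where $|\mathcal S|$ is the size of the encoding of $\mathcal S$. In particular, the running time is polynomial in $|\mathcal S|$ and exponential in $|C|$. Steps are counted at logarithmic cost: operations on pointers cost one step, and arithmetical operations on integers are charged as the schoolbook bit algorithms. -/

import Mathlib

open MeasureTheory ProbabilityTheory
open scoped ENNReal NNReal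

noncomputable section

namespace DistBisim

/-! ### Probability measures form a measurable space with measurable points -/

/-- A countably generated σ-algebra is generated by a countable π-system. -/
theorem exists_countable_piSystem (S : Type*) [mS : MeasurableSpace S]
    [MeasurableSpace.CountablyGenerated S] :
    ∃ G : Set (Set S), G.Countable ∧ IsPiSystem G ∧ mS = MeasurableSpace.generateFrom G := by
  classical
  let g := MeasurableSpace.countableGeneratingSet S
  have hgc : g.Countable := MeasurableSpace.countable_countableGeneratingSet
  have hgen : MeasurableSpace.generateFrom g = mS :=
    MeasurableSpace.generateFrom_countableGeneratingSet
  have : Countable g := hgc.to_subtype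
  let I : Finset g → Set S := fun t => ⋂ i ∈ t, (i : Set S)
  refine ⟨Set.range I, Set.countable_range I, ?_, ?_⟩
  · rintro _ ⟨t, rfl⟩ _ ⟨u, rfl⟩ -
    refine ⟨t ∪ u, ?_⟩
    ext x
    simp only [I, Set.mem_iInter, Set.mem_inter_iff, Finset.mem_union]
    constructor
    · intro h
      exact ⟨fun i hi => h i (Or.inl hi), fun i hi => h i (Or.inr hi)⟩
    · rintro ⟨h1, h2⟩ i (hi | hi)
      · exact h1 i hi
      · exact h2 i hi
  · apply le_antisymm
    · rw [← hgen]
      refine MeasurableSpace.generateFrom_le fun s hs => ?_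
      refine MeasurableSpace.measurableSet_generateFrom ⟨{⟨s, hs⟩}, ?_⟩
      exact Finset.set_biInter_singleton (⟨s, hs⟩ : g) fun i => (i : Set S)
    · refine MeasurableSpace.generateFrom_le ?_
      rintro _ ⟨t, rfl⟩
      refine Finset.measurableSet_biInter t fun i _ => ?_
      have hi : MeasurableSet[MeasurableSpace.generateFrom g] (i : Set S) :=
        MeasurableSpace.measurableSet_generateFrom i.2
      rwa [hgen] at hi

instance measurableSingletonClass_probabilityMeasure (S : Type*) [MeasurableSpace S]
    [MeasurableSpace.CountablyGenerated S] : MeasurableSingletonClass (ProbabilityMeasure S) where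
  measurableSet_singleton μ := by
    obtain ⟨G, hGc, hGpi, hGgen⟩ := exists_countable_piSystem S
    have hGm : ∀ X ∈ G, MeasurableSet X := fun X hX => by
      rw [hGgen]; exact MeasurableSpace.measurableSet_generateFrom hX
    have : ({μ} : Set (ProbabilityMeasure S)) =
        ⋂ X ∈ G, {ν : ProbabilityMeasure S | (ν : Measure S) X = (μ : Measure S) X} := by
      ext ν
      simp only [Set.mem_singleton_iff, Set.mem_iInter, Set.mem_ofPred_eq]
      constructor
      · rintro rfl X _
        rfl
      · intro h
        have hνμ : (ν : Measure S) = (μ : Measure S) :=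
          ext_of_generate_finite G hGgen hGpi h (by simp)
        exact Subtype.ext hνμ
    rw [this]
    refine MeasurableSet.biInter hGc fun X hX => ?_
    exact ((Measure.measurable_coe (hGm X hX)).comp measurable_subtype_coe)
      (measurableSet_singleton _)

/-! ### Non-deterministic labelled Markov processes and distribution bisimulation -/

/-- A non-deterministic labelled Markov process with states `S` and labels `L`. Sets of probability
measures are measurable with respect to the Giry σ-algebra. -/
structure NLMP (S L : Type*) [MeasurableSpace S] [MeasurableSpace L] where
  /-- the set of probability measures available in a state under a label -/
  τ : L → S → Set (ProbabilityMeasure S)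
  measurableSet_τ : ∀ a s, MeasurableSet (τ a s)
  measurableSet_graph : ∀ s, MeasurableSet {p : L × ProbabilityMeasure S | p.2 ∈ τ p.1 s}
  measurableSet_hit : ∀ (A : Set L) (Y : Set (ProbabilityMeasure S)),
    MeasurableSet A → MeasurableSet Y → MeasurableSet {s | ∃ a ∈ A, (τ a s ∩ Y).Nonempty}

/-- `μ` is a (generalised) convex combination of the measures in `M`: it is the barycentre of a
measure that is concentrated on `M`. -/
def IsConvexComb {S : Type*} [MeasurableSpace S] (M : Set (ProbabilityMeasure S))
    (μ : ProbabilityMeasure S) : Prop :=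
  ∃ ν : Measure (ProbabilityMeasure S), ν M = 1 ∧
    ∀ X : Set S, MeasurableSet X →
      (μ : Measure S) X = ∫⁻ μ' : ProbabilityMeasure S, (μ' : Measure S) X ∂ν

namespace NLMP

variable {S L : Type*} [MeasurableSpace S] [MeasurableSpace L] (P : NLMP S L)

/-- `s ⟶ μ` under some label of `A`. -/
def Trans (A : Set L) (s : S) (μ : ProbabilityMeasure S) : Prop :=
  ∃ a ∈ A, IsConvexComb (P.τ a s) μ

/-- The states that do not halt under `A`. -/
def live (A : Set L) : Set S :=
  {s | ∃ μ, P.Trans A s μ}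

/-- The lifted transition `μ ⟶ ν` under `A`: restrict `μ` to the states that are live under `A`,
let each of them move measurably along one of its transitions, and normalise. There is no such
transition when the live states have measure zero. -/
def LiftTrans (A : Set L) (μ ν : ProbabilityMeasure S) : Prop :=
  (μ : Measure S) (P.live A) ≠ 0 ∧
  ∃ f : S → ProbabilityMeasure S, Measurable f ∧ (∀ s ∈ P.live A, P.Trans A s (f s)) ∧
    ∀ X : Set S, MeasurableSet X →
      (ν : Measure S) X =
        ((μ : Measure S) (P.live A))⁻¹ * ∫⁻ s in P.live A, (f s : Measure S) X ∂(μ : Measure S)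

/-- Probabilistic bisimulations, as relations between distributions over states. -/
structure IsBisimulation (R : ProbabilityMeasure S → ProbabilityMeasure S → Prop) : Prop where
  symm : ∀ μ ν, R μ ν → R ν μ
  mass : ∀ μ ν, R μ ν → ∀ A : Set L, MeasurableSet A →
    (μ : Measure S) (P.live A) = (ν : Measure S) (P.live A)
  step : ∀ μ ν, R μ ν → ∀ A : Set L, MeasurableSet A →
    ∀ μ', P.LiftTrans A μ μ' → ∃ ν', P.LiftTrans A ν ν' ∧ R μ' ν'

/-- Bisimilarity of distributions. -/
def Bisimilar (μ ν : ProbabilityMeasure S) : Prop :=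
  ∃ R, P.IsBisimulation R ∧ R μ ν

/-- The distributions that can be reached from `μ₀` by lifted transitions. -/
inductive Reachable (μ₀ : ProbabilityMeasure S) : ProbabilityMeasure S → Prop
  | init : Reachable μ₀ μ₀
  | step {μ ν : ProbabilityMeasure S} (A : Set L) (hA : MeasurableSet A) :
      Reachable μ₀ μ → P.LiftTrans A μ ν → Reachable μ₀ ν

end NLMP

/-! ### Stochastic automata -/

/-- Edges of a stochastic automaton with locations `Q`, clocks `C` and actions `A`: source, action,
set of clocks that have to run out, target. -/
abbrev Edge (Q C A : Type*) := Q × A × Finset C × Q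

namespace Edge
variable {Q C A : Type*}
/-- the location that the edge leaves -/
def src (e : Edge Q C A) : Q := e.1
/-- the action of the edge -/
def act (e : Edge Q C A) : A := e.2.1
/-- the clocks that have to run out before the edge becomes enabled -/
def guard (e : Edge Q C A) : Finset C := e.2.2.1
/-- the location that the edge enters -/
def tgt (e : Edge Q C A) : Q := e.2.2.2
end Edge

/-- Stochastic automata. -/
structure StochAutomaton (Q C A : Type*) where
  /-- the edges -/
  edges : Set (Edge Q C A)
  /-- the clocks that are set when a location is entered -/
  κ : Q → Finset C
  /-- the distribution of each clock -/
  F : C → ProbabilityMeasure ℝ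
  F_nonneg : ∀ c, (F c : Measure ℝ) (Set.Iio 0) = 0

namespace StochAutomaton

variable {Q C A : Type*} (M : StochAutomaton Q C A)

/-- The time after which all clocks of `X` have a value `≤ 0`: the least `t ≥ 0` such that
`ξ c - t ≤ 0` for all `c ∈ X`. -/
def enablingTime (X : Finset C) (ξ : C → ℝ) : ℝ≥0 :=
  X.sup fun c => (ξ c).toNNReal

theorem isLeast_enablingTime (X : Finset C) (ξ : C → ℝ) :
    IsLeast {t : ℝ≥0 | ∀ c ∈ X, ξ c - t ≤ 0} (enablingTime X ξ) := by
  constructor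
  · intro c hc
    have h : (ξ c).toNNReal ≤ enablingTime X ξ :=
      Finset.le_sup (f := fun c => (ξ c).toNNReal) hc
    rw [Real.toNNReal_le_iff_le_coe] at h
    linarith
  · intro t ht
    refine Finset.sup_le fun c hc => ?_
    rw [Real.toNNReal_le_iff_le_coe]
    linarith [ht c hc]

/-- In the state `s` (a location and the values of the clocks), the automaton idles for time `t`,
after which the edge `e` is enabled: `t` is the first time at which an edge that leaves the
location of `s` becomes enabled, and `e` is such an edge. -/
def Fires (e : Edge Q C A) (s : Q × (C → ℝ)) (t : ℝ≥0) : Prop :=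
  e ∈ M.edges ∧ e.src = s.1 ∧ enablingTime e.guard s.2 = t ∧
    ∀ e' ∈ M.edges, e'.src = s.1 → t ≤ enablingTime e'.guard s.2

theorem measurable_enablingTime (X : Finset C) :
    Measurable (enablingTime X : (C → ℝ) → ℝ≥0) := by
  classical
  induction X using Finset.induction_on with
  | empty =>
    have : (enablingTime ∅ : (C → ℝ) → ℝ≥0) = fun _ => 0 := by
      funext ξ; simp [enablingTime]
    rw [this]
    exact measurable_const
  | insert c X _ ih =>
    have : (enablingTime (insert c X) : (C → ℝ) → ℝ≥0) =
        fun ξ => (ξ c).toNNReal ⊔ enablingTime X ξ := by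
      funext ξ; simp [enablingTime]
    rw [this]
    exact (measurable_pi_apply c).real_toNNReal.sup ih

variable [Fintype C] [MeasurableSpace Q]

open Classical in
/-- The distribution of the state on entering location `q` when the clocks have the values `ξ`: the
clocks of `κ q` are sampled independently, all others keep their values. -/
def enter (q : Q) (ξ : C → ℝ) : ProbabilityMeasure (Q × (C → ℝ)) :=
  ⟨(Measure.dirac q).prod
      (Measure.pi fun c => if c ∈ M.κ q then (M.F c : Measure ℝ) else Measure.dirac (ξ c)), by
    have : ∀ c, IsProbabilityMeasure
        (if c ∈ M.κ q then (M.F c : Measure ℝ) else Measure.dirac (ξ c)) := by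
      intro c; split_ifs <;> infer_instance
    infer_instance⟩

/-- The distribution that corresponds to starting in location `q`: the clocks of `κ q` are sampled
independently, all others are `0`. -/
def initial (q : Q) : ProbabilityMeasure (Q × (C → ℝ)) :=
  M.enter q 0

theorem measurable_enter (q : Q) : Measurable (M.enter q) := by
  classical
  refine Measurable.subtype_mk ?_
  have hp : ∀ ξ : C → ℝ, ∀ c, IsProbabilityMeasure
      (if c ∈ M.κ q then (M.F c : Measure ℝ) else Measure.dirac (ξ c)) := by
    intro ξ c; split_ifs <;> infer_instance
  refine Measurable.measure_of_isPiSystem_of_isProbabilityMeasure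
    generateFrom_prod.symm isPiSystem_prod ?_
  rintro _ ⟨U, hU, V, hV, rfl⟩
  replace hV : MeasurableSet V := hV
  simp only [Measure.prod_prod]
  refine Measurable.const_mul ?_ _
  have : Measurable fun ξ : C → ℝ =>
      Measure.pi fun c => if c ∈ M.κ q then (M.F c : Measure ℝ) else Measure.dirac (ξ c) := by
    refine Measurable.measure_of_isPiSystem_of_isProbabilityMeasure
      generateFrom_pi.symm isPiSystem_pi ?_
    rintro _ ⟨B, hB, rfl⟩
    simp only [Measure.pi_pi]
    refine Finset.measurable_prod _ fun c _ => ?_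
    have hBc : MeasurableSet (B c) := hB c (Set.mem_univ c)
    by_cases hc : c ∈ M.κ q
    · simp only [hc, if_true]
      exact measurable_const
    · simp only [hc, if_false]
      exact (Measure.measurable_coe hBc).comp
        (Measure.measurable_dirac.comp (measurable_pi_apply c))
  exact (Measure.measurable_coe hV).comp this

/-- The measures available in state `s` under the label `(a, t)`: one for each `a`-edge that is
enabled after idling for time `t`. Taking it decreases all clocks by `t` and enters its target. -/
def trans (l : A × ℝ≥0) (s : Q × (C → ℝ)) : Set (ProbabilityMeasure (Q × (C → ℝ))) :=
  {μ | ∃ e : Edge Q C A, e.act = l.1 ∧ M.Fires e s l.2 ∧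
    μ = M.enter e.tgt fun c => s.2 c - l.2}

variable [MeasurableSingletonClass Q] [Finite Q] [Finite A] [MeasurableSpace A]
  [MeasurableSingletonClass A]

/-- The semantics of a stochastic automaton. The states are the pairs of a location and a clock
valuation, the labels the pairs of an action and an idling time. -/
def nlmp : NLMP (Q × (C → ℝ)) (A × ℝ≥0) where
  τ := M.trans
  measurableSet_τ l s := by
    refine Set.Finite.measurableSet ?_
    refine (Set.finite_range fun e : Edge Q C A =>
      M.enter e.tgt fun c => s.2 c - l.2).subset ?_
    rintro μ ⟨e, -, -, rfl⟩
    exact ⟨e, rfl⟩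
  measurableSet_graph s := by
    refine Set.Finite.measurableSet ?_
    refine (Set.finite_range fun e : Edge Q C A =>
      ((e.act, enablingTime e.guard s.2),
        M.enter e.tgt fun c => s.2 c - enablingTime e.guard s.2)).subset ?_
    rintro ⟨⟨a, t⟩, μ⟩ ⟨e, h1, ⟨-, -, h3, -⟩, h4⟩
    simp only at h1 h3 h4
    subst h1 h3 h4
    exact ⟨e, rfl⟩
  measurableSet_hit B Y hB hY := by
    have key : {s | ∃ a ∈ B, (M.trans a s ∩ Y).Nonempty} =
        ⋃ e : Edge Q C A, {s | e ∈ M.edges} ∩ {s | e.src = s.1} ∩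
          (⋂ e' : Edge Q C A, {s | e' ∈ M.edges → e'.src = s.1 →
            enablingTime e.guard s.2 ≤ enablingTime e'.guard s.2}) ∩
          {s | (e.act, enablingTime e.guard s.2) ∈ B} ∩
          {s | (M.enter e.tgt fun c => s.2 c - enablingTime e.guard s.2) ∈ Y} := by
      ext s
      simp only [Set.mem_ofPred_eq, Set.mem_iUnion, Set.mem_inter_iff, Set.mem_iInter]
      constructor
      · rintro ⟨⟨a, t⟩, hB, _, ⟨e, h1, ⟨h2, h3, h4, h5⟩, rfl⟩, hY⟩
        simp only at h1 h4 h5 hY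
        subst h1 h4
        exact ⟨e, ⟨⟨⟨h2, h3⟩, h5⟩, hB⟩, hY⟩
      · rintro ⟨e, ⟨⟨⟨h2, h3⟩, h5⟩, hB⟩, hY⟩
        exact ⟨(e.act, enablingTime e.guard s.2), hB, _, ⟨e, rfl, ⟨h2, h3, rfl, h5⟩, rfl⟩, hY⟩
    rw [key]
    have hE : ∀ X : Finset C, Measurable fun s : Q × (C → ℝ) => enablingTime X s.2 :=
      fun X => (measurable_enablingTime X).comp measurable_snd
    have hsrc : ∀ q : Q, MeasurableSet {s : Q × (C → ℝ) | q = s.1} := fun q => by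
      have : {s : Q × (C → ℝ) | q = s.1} = Prod.fst ⁻¹' {q} := by
        ext s; simp [eq_comm]
      rw [this]
      exact measurable_fst (measurableSet_singleton q)
    refine MeasurableSet.iUnion fun e => ((((MeasurableSet.const _).inter (hsrc _)).inter
      (MeasurableSet.iInter fun e' => ?_)).inter ?_).inter ?_
    · have : {s : Q × (C → ℝ) | e' ∈ M.edges → e'.src = s.1 →
          enablingTime e.guard s.2 ≤ enablingTime e'.guard s.2} =
          {s | e' ∈ M.edges}ᶜ ∪ ({s | e'.src = s.1}ᶜ ∪
            {s | enablingTime e.guard s.2 ≤ enablingTime e'.guard s.2}) := by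
        ext s
        simp only [Set.mem_ofPred_eq, Set.mem_union, Set.mem_compl_iff]
        tauto
      rw [this]
      exact (MeasurableSet.const _).compl.union
        ((hsrc _).compl.union (measurableSet_le (hE _) (hE _)))
    · exact (measurable_const.prodMk (hE e.guard)) hB
    · refine ((M.measurable_enter e.tgt).comp ?_) hY
      refine measurable_pi_lambda _ fun c => ?_
      exact ((measurable_pi_apply c).comp measurable_snd).sub
        (measurable_coe_nnreal_real.comp (hE e.guard))

/-- A stochastic automaton is deterministic if, when it is started in any location, the probability
that two edges become enabled at the same time is zero. -/
def Deterministic : Prop :=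
  ∀ q μ, M.nlmp.Reachable (M.initial q) μ →
    (μ : Measure (Q × (C → ℝ)))
      {s | ∃ e e' : Edge Q C A, e ≠ e' ∧ ∃ t, M.Fires e s t ∧ M.Fires e' s t} = 0

/-- Bisimilarity of locations. -/
def BisimilarLoc (q₁ q₂ : Q) : Prop :=
  M.nlmp.Bisimilar (M.initial q₁) (M.initial q₂)

end StochAutomaton

/-! ### Programs and their running time

The data are finite binary trees with integers, written in binary, at the leaves. A program is
charged one step for each operation on pointers (forming a pair, projecting, copying, testing for
`0`, composing), and each arithmetical operation is charged as the schoolbook algorithm on the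
binary digits of its arguments (logarithmic cost). The lengths of computations are thus polynomially
related to those of multitape Turing machines. -/

/-- Data: binary trees of integers. -/
inductive Val : Type
  | num (n : ℤ) : Val
  | pair (a b : Val) : Val

namespace Val

/-- The number of binary digits of an integer. -/
def bits (n : ℤ) : ℕ := n.natAbs.size

/-- The size of a tree: the number of its nodes plus the number of binary digits in its leaves. -/
def size : Val → ℕ
  | num n => 1 + bits n
  | pair a b => 1 + a.size + b.size

/-- Lists as trees. -/
def ofList : List Val → Val
  | [] => num 0
  | a :: l => pair a (ofList l)

/-- Natural numbers as trees. -/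
def ofNat (n : ℕ) : Val := num n

open Classical in
/-- Truth values as trees: `1` for true and `0` for false. -/
def ofProp (p : Prop) : Val := if p then num 1 else num 0

/-- The first projection; a leaf is sent to `0`. -/
def fst : Val → Val
  | num _ => num 0
  | pair a _ => a

/-- The second projection; a leaf is sent to `0`. -/
def snd : Val → Val
  | num _ => num 0
  | pair _ b => b

end Val

/-- Arithmetical operations. -/
inductive ArithOp : Type
  | add | sub | mul | div | le

namespace ArithOp

/-- The value of an operation; division rounds, and `le` is `1` for true and `0` for false. -/
def value : ArithOp → ℤ → ℤ → ℤ
  | add, m, n => m + n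
  | sub, m, n => m - n
  | mul, m, n => m * n
  | div, m, n => m / n
  | le, m, n => if m ≤ n then 1 else 0

/-- The number of bit operations charged. -/
def cost : ArithOp → ℤ → ℤ → ℕ
  | add, m, n => 1 + Val.bits m + Val.bits n
  | sub, m, n => 1 + Val.bits m + Val.bits n
  | le, m, n => 1 + Val.bits m + Val.bits n
  | mul, m, n => (1 + Val.bits m) * (1 + Val.bits n)
  | div, m, n => (1 + Val.bits m) * (1 + Val.bits n)

end ArithOp

/-- Programs; each computes a partial function from trees to trees. -/
inductive Prog : Type
  | id : Prog
  | zero : Prog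
  | one : Prog
  | fst : Prog
  | snd : Prog
  | arith (op : ArithOp) : Prog
  | pair (f g : Prog) : Prog
  | comp (g f : Prog) : Prog
  | ite (c f g : Prog) : Prog
  | loop (c f : Prog) : Prog

/-- `p.Runs x y t`: on input `x` the program `p` halts with output `y` after exactly `t` steps. -/
inductive Prog.Runs : Prog → Val → Val → ℕ → Prop
  | id (x : Val) : Runs .id x x 1
  | zero (x : Val) : Runs .zero x (.num 0) 1
  | one (x : Val) : Runs .one x (.num 1) 1
  | fst (x : Val) : Runs .fst x x.fst 1
  | snd (x : Val) : Runs .snd x x.snd 1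
  | arith (op : ArithOp) (m n : ℤ) :
      Runs (.arith op) (.pair (.num m) (.num n)) (.num (op.value m n)) (op.cost m n)
  | pair {f g : Prog} {x y z : Val} {s t : ℕ} :
      Runs f x y s → Runs g x z t → Runs (.pair f g) x (.pair y z) (1 + s + t)
  | comp {g f : Prog} {x y z : Val} {s t : ℕ} :
      Runs f x y s → Runs g y z t → Runs (.comp g f) x z (1 + s + t)
  | ite_true {c f g : Prog} {x b y : Val} {s t : ℕ} :
      Runs c x b s → b ≠ .num 0 → Runs f x y t → Runs (.ite c f g) x y (1 + s + t)
  | ite_false {c f g : Prog} {x y : Val} {s t : ℕ} :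
      Runs c x (.num 0) s → Runs g x y t → Runs (.ite c f g) x y (1 + s + t)
  | loop_stop {c f : Prog} {x : Val} {s : ℕ} :
      Runs c x (.num 0) s → Runs (.loop c f) x x (1 + s)
  | loop_step {c f : Prog} {x b y z : Val} {s t u : ℕ} :
      Runs c x b s → b ≠ .num 0 → Runs f x y t → Runs (.loop c f) y z u →
        Runs (.loop c f) x z (1 + s + t + u)

/-! ### Finite presentations of stochastic automata over exponential distributions -/

/-- A finite stochastic automaton all of whose clocks are exponentially distributed, with positive
rational rates; locations, clocks and actions are numbered. -/
structure ExpAutomaton where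
  /-- the number of locations -/
  nQ : ℕ
  /-- the number of clocks -/
  nC : ℕ
  /-- the number of actions -/
  nA : ℕ
  /-- a list of the edges -/
  edges : List (Edge (Fin nQ) (Fin nC) (Fin nA))
  /-- the clocks that are set when a location is entered -/
  κ : Fin nQ → Finset (Fin nC)
  /-- the rates of the clocks -/
  rate : Fin nC → ℚ
  rate_pos : ∀ c, 0 < rate c

namespace ExpAutomaton

variable (M : ExpAutomaton)

/-- The stochastic automaton that is presented. -/
def toStochAutomaton : StochAutomaton (Fin M.nQ) (Fin M.nC) (Fin M.nA) where
  edges := {e | e ∈ M.edges}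
  κ := M.κ
  F c := ⟨expMeasure (M.rate c : ℝ),
    isProbabilityMeasure_expMeasure (by exact_mod_cast M.rate_pos c)⟩
  F_nonneg c := by
    change expMeasure (M.rate c : ℝ) (Set.Iio 0) = 0
    rw [expMeasure, gammaMeasure, withDensity_apply _ measurableSet_Iio]
    exact lintegral_gammaPDF_of_nonpos le_rfl

/-- A set of clocks as the list of its indicator values. -/
def encodeClocks {k : ℕ} (X : Finset (Fin k)) : Val :=
  Val.ofList (List.ofFn fun c : Fin k => Val.ofProp (c ∈ X))

/-- An edge as the list of its source, action, clocks and target. -/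
def encodeEdge (e : Edge (Fin M.nQ) (Fin M.nC) (Fin M.nA)) : Val :=
  Val.ofList [Val.ofNat e.src, Val.ofNat e.act, encodeClocks e.guard, Val.ofNat e.tgt]

/-- A rational number as the pair of its numerator and denominator. -/
def encodeRat (r : ℚ) : Val :=
  Val.pair (Val.num r.num) (Val.ofNat r.den)

/-- The automaton as a tree. -/
def encode : Val :=
  Val.ofList
    [Val.ofNat M.nQ, Val.ofNat M.nC, Val.ofNat M.nA,
      Val.ofList (M.edges.map M.encodeEdge),
      Val.ofList (List.ofFn fun q => encodeClocks (M.κ q)),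
      Val.ofList (List.ofFn fun c => encodeRat (M.rate c))]

/-- The size of the automaton. -/
def size : ℕ := M.encode.size

/-- The input that consists of the automaton and two of its locations. -/
def encodeInput (q₁ q₂ : Fin M.nQ) : Val :=
  Val.ofList [M.encode, Val.ofNat q₁, Val.ofNat q₂]

end ExpAutomaton

end DistBisim

end

/-! The first reduction removes nondeterminism. In a deterministic automaton, almost every state
that occurs has at most one edge to take, so a lifted transition under `B` is forced up to null
sets: it conditions the distribution on moving under `B`. Hence two locations are bisimilar if and
only if they give the same probability to every finite sequence of measurable sets of labels
(`bisimilarLoc_iff`). Bisimilar distributions agree by induction on the sequence, and agreement is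
itself a bisimulation.

The second reduction makes the state space finite. Exponential clocks have no memory, and it is
irrelevant how long ago a clock has expired, so the future depends only on the configuration `(q,
K)`, where `K` is the set of running clocks. If no edge is enabled in `(q, K)`, each `c ∈ K` expires
at its rate, which leads to `(q, K.erase c)`; otherwise an edge is taken at once. Let `G` be the
generator of this expiry process, stopped where an edge is enabled, and `J_a` the 0-1 matrix of the
moves with action `a`. For a function with vector of expectations `φ`, let `L(z)` be its expectation
after the next transition, restricted to action `a` and discounted by `exp (-z t)`. Then `z L = G L
+ z J_a φ` (`laplace_resolvent`), formally `L = Σ z^(-k) G^k J_a φ`. A finite measure on the time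
axis is determined by its Laplace transform at large integers (`ext_of_laplace`), so a row vector
`x` annihilates the distributions of the transition time if and only if `x G^k J_a φ = 0` for all
`k` (`dot_laplace_eq_zero`, `dot_gen_pow_eq_zero`). By induction on words, agreement on all
sequences of label sets becomes agreement of the entries at `s₁` and `s₂` of `w 1`, for all words
`w` in the matrices `G` and `J_a` (`expect_wordProb_eq_iff`).

This is the equivalence problem for weighted automata. Let `W` be the sum of the tensor squares of
the letters and `c` the tensor square of the difference of the point masses at `s₁` and `s₂`. Then
`c · W^n 1` is the sum of the squared differences over the words of length `n`, so all words agree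
if and only if these numbers vanish, and by Cayley-Hamilton the exponents below the dimension
suffice (`wordVec_eq_iff`). Multiplying the rates by their denominators makes everything integral.
The dimension is the square of `|Q| 2^|C|` and the bit lengths of the iterates grow at most linearly
in `n`, so the computation is polynomial in the size of the input plus `2^|C|`
(`polyTimeIn_decision`). -/

namespace DistBisim

/-! ### Polynomial bounds -/

/-- `h` is bounded by a polynomial in `σ`. -/
def PolyBdd {α : Type*} (σ h : α → ℕ) : Prop := ∃ k : ℕ, ∀ a, h a ≤ (σ a + 2) ^ k

namespace PolyBdd
variable {α β : Type*} {σ g h : α → ℕ}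

theorem mono (hg : PolyBdd σ g) (hle : ∀ a, h a ≤ g a) : PolyBdd σ h :=
  hg.imp fun _ hk a => (hle a).trans (hk a)

theorem const (n : ℕ) : PolyBdd σ fun _ => n :=
  ⟨n, fun a => (Nat.lt_two_pow_self.le).trans (Nat.pow_le_pow_left (by omega) n)⟩

theorem self : PolyBdd σ σ := ⟨1, fun a => by simp⟩

theorem mul (hg : PolyBdd σ g) (hh : PolyBdd σ h) : PolyBdd σ fun a => g a * h a := by
  obtain ⟨k, hk⟩ := hg
  obtain ⟨l, hl⟩ := hh
  exact ⟨k + l, fun a => by rw [pow_add]; exact Nat.mul_le_mul (hk a) (hl a)⟩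

theorem add (hg : PolyBdd σ g) (hh : PolyBdd σ h) : PolyBdd σ fun a => g a + h a := by
  obtain ⟨k, hk⟩ := hg
  obtain ⟨l, hl⟩ := hh
  refine ⟨k + l + 1, fun a => ?_⟩
  have h1 : (σ a + 2) ^ k ≤ (σ a + 2) ^ (k + l) := Nat.pow_le_pow_right (by omega) (by omega)
  have h2 : (σ a + 2) ^ l ≤ (σ a + 2) ^ (k + l) := Nat.pow_le_pow_right (by omega) (by omega)
  -- The base is at least `2`, so a sum costs one more power; this is why the bound needs no
  -- coefficients.
  have h3 : 2 * (σ a + 2) ^ (k + l) ≤ (σ a + 2) ^ (k + l + 1) := by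
    rw [pow_succ, mul_comm]
    exact Nat.mul_le_mul_left _ (by omega)
  have := hk a
  have := hl a
  dsimp only
  omega

theorem pow (hg : PolyBdd σ g) (n : ℕ) : PolyBdd σ fun a => g a ^ n := by
  obtain ⟨k, hk⟩ := hg
  exact ⟨k * n, fun a => by rw [pow_mul]; exact Nat.pow_le_pow_left (hk a) n⟩

theorem trans {ρ : α → ℕ} (hg : PolyBdd ρ g) (hρ : PolyBdd σ ρ) : PolyBdd σ g := by
  obtain ⟨k, hk⟩ := hg
  exact ((hρ.add (const 2)).pow k).mono hk

theorem comp {ρ g' : β → ℕ} (hg : PolyBdd ρ g') (f : α → β) :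
    PolyBdd (fun a => ρ (f a)) fun a => g' (f a) :=
  hg.imp fun _ hk a => hk (f a)

end PolyBdd

theorem Prog.Runs.loop_exit {c f : Prog} {x : Val} {t : ℕ} (h : c.Runs x (.num 0) t) :
    (Prog.loop c f).Runs x x (1 + t) := by
  constructor
  exact h

/-! ### Data types and their encodings -/

/-- Types whose elements are encoded as trees. -/
class Enc (α : Type) where
  /-- the encoding -/
  enc : α → Val

open Enc (enc)

/-- These encodings agree with `Val.ofList` and `Val.ofProp`. In particular `false` and the empty
list are both `num 0`, the only tree that `ite` and `loop` treat as false. -/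
instance : Enc ℤ := ⟨Val.num⟩
instance : Enc Bool := ⟨fun b => Val.num (if b then 1 else 0)⟩
instance {α β : Type} [Enc α] [Enc β] : Enc (α × β) := ⟨fun x => Val.pair (enc x.1) (enc x.2)⟩
instance {α : Type} [Enc α] : Enc (List α) := ⟨fun l => Val.ofList (l.map enc)⟩

/-- The size of the encoding. -/
def esize {α : Type} [Enc α] (a : α) : ℕ := (enc a).size

section Size
variable {α β : Type} [Enc α] [Enc β]

@[simp] theorem esize_prod (x : α × β) : esize x = 1 + esize x.1 + esize x.2 := rfl
@[simp] theorem esize_nil : esize ([] : List α) = 1 := rfl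
@[simp] theorem esize_cons (a : α) (l : List α) : esize (a :: l) = 1 + esize a + esize l := rfl
@[simp] theorem esize_int (n : ℤ) : esize n = 1 + Val.bits n := rfl
theorem esize_bool (b : Bool) : esize b ≤ 2 := by cases b <;> decide

theorem esize_eq_sum (l : List α) : esize l = 1 + (l.map fun a => 1 + esize a).sum := by
  induction l with
  | nil => rfl
  | cons a l ih => simp [ih]; omega

theorem length_lt_esize (l : List α) : l.length < esize l := by
  induction l with
  | nil => simp
  | cons a l ih => simp; omega

theorem esize_le_of_mem {a : α} {l : List α} (h : a ∈ l) : esize a ≤ esize l := by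
  induction l with
  | nil => simp at h
  | cons b l ih =>
    rcases List.mem_cons.1 h with rfl | h
    · simp; omega
    · have := ih h
      simp; omega

theorem esize_le_length_mul {l : List α} {B : ℕ} (h : ∀ a ∈ l, esize a ≤ B) :
    esize l ≤ 1 + l.length * (1 + B) := by
  induction l with
  | nil => simp
  | cons b l ih =>
    have h1 := ih fun a ha => h a (List.mem_cons_of_mem _ ha)
    have h2 := h b List.mem_cons_self
    simp only [esize_cons, List.length_cons, Nat.add_mul, one_mul]
    omega

theorem esize_append (l m : List α) : esize (l ++ m) + 1 = esize l + esize m := by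
  induction l with
  | nil => simp; omega
  | cons a l ih => simp; omega

theorem esize_reverse (l : List α) : esize l.reverse = esize l := by
  rw [esize_eq_sum, esize_eq_sum, List.map_reverse, List.sum_reverse]

theorem esize_of_sublist {l m : List α} (h : l.Sublist m) : esize l ≤ esize m := by
  induction h with
  | slnil => exact le_rfl
  | cons a _ ih => simp; omega
  | cons_cons a _ ih => simp; omega

end Size

theorem bits_add (m n : ℤ) : Val.bits (m + n) ≤ Val.bits m + Val.bits n + 1 := by
  have h1 : m.natAbs < 2 ^ Val.bits m := Nat.lt_size_self _
  have h2 : n.natAbs < 2 ^ Val.bits n := Nat.lt_size_self _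
  refine Nat.size_le.2 ((Int.natAbs_add_le m n).trans_lt ?_)
  have h3 : 2 ^ Val.bits m ≤ 2 ^ (Val.bits m + Val.bits n) :=
    Nat.pow_le_pow_right (by omega) (by omega)
  have h4 : 2 ^ Val.bits n ≤ 2 ^ (Val.bits m + Val.bits n) :=
    Nat.pow_le_pow_right (by omega) (by omega)
  rw [pow_succ]
  omega

theorem bits_neg (n : ℤ) : Val.bits (-n) = Val.bits n := by simp [Val.bits]

theorem bits_sub (m n : ℤ) : Val.bits (m - n) ≤ Val.bits m + Val.bits n + 1 := by
  rw [sub_eq_add_neg, ← bits_neg n]; exact bits_add m (-n)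

theorem bits_mul (m n : ℤ) : Val.bits (m * n) ≤ Val.bits m + Val.bits n := by
  refine Nat.size_le.2 ?_
  rw [Int.natAbs_mul, pow_add]
  exact Nat.mul_lt_mul'' (Nat.lt_size_self _) (Nat.lt_size_self _)

theorem bits_le_of_natAbs_le {m n : ℤ} (h : m.natAbs ≤ n.natAbs) : Val.bits m ≤ Val.bits n :=
  Nat.size_le_size h

theorem bits_div (m n : ℤ) : Val.bits (m / n) ≤ Val.bits m + 1 := by
  have h : (m / n).natAbs ≤ m.natAbs := by
    exact Int.natAbs_ediv_le_natAbs m n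
  exact (bits_le_of_natAbs_le h).trans (by omega)

/-! ### Functions that are computable in polynomial time -/

/-- `f` is computed by a program whose running time is polynomial in `σ`, with values of size
polynomial in `σ`. -/
def PolyTimeIn {α β : Type} [Enc α] [Enc β] (σ : α → ℕ) (f : α → β) : Prop :=
  ∃ p : Prog, ∃ T : α → ℕ, PolyBdd σ T ∧ PolyBdd σ (fun a => esize (f a)) ∧
    ∀ a, ∃ t ≤ T a, p.Runs (enc a) (enc (f a)) t

/-- `f` is computable in polynomial time. -/
@[fun_prop]
def PolyTime {α β : Type} [Enc α] [Enc β] (f : α → β) : Prop := PolyTimeIn esize f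

theorem Prog.exists_runs_const (v : Val) : ∃ p : Prog, ∃ t, ∀ x, p.Runs x v t := by
  induction v with
  | num n =>
    induction n using Int.induction_on with
    | zero => exact ⟨.zero, 1, .zero⟩
    | succ n ih =>
      obtain ⟨p, t, h⟩ := ih
      exact ⟨.comp (.arith .add) (.pair p .one), _, fun x =>
        .comp (.pair (h x) (.one x)) (.arith .add n 1)⟩
    | pred n ih =>
      obtain ⟨p, t, h⟩ := ih
      exact ⟨.comp (.arith .sub) (.pair p .one), _, fun x =>
        .comp (.pair (h x) (.one x)) (.arith .sub (-n) 1)⟩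
  | pair a b iha ihb =>
    obtain ⟨p, s, hp⟩ := iha
    obtain ⟨q, t, hq⟩ := ihb
    exact ⟨.pair p q, _, fun x => .pair (hp x) (hq x)⟩

namespace PolyTimeIn
variable {α β γ δ : Type} [Enc α] [Enc β] [Enc γ] [Enc δ] {σ : α → ℕ}

theorem const (b : β) : PolyTimeIn σ fun _ : α => b := by
  obtain ⟨p, t, h⟩ := Prog.exists_runs_const (enc b)
  exact ⟨p, fun _ => t, .const t, .const _, fun a => ⟨t, le_rfl, h _⟩⟩

/-- The bound on the size of the output in `PolyTimeIn` serves this lemma: the second program is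
charged in terms of the size of the intermediate value. -/
theorem comp {g : β → γ} {f : α → β} (hg : PolyTime g) (hf : PolyTimeIn σ f) :
    PolyTimeIn σ fun a => g (f a) := by
  obtain ⟨p, T, hT, hS, h⟩ := hf
  obtain ⟨p', T', hT', hS', h'⟩ := hg
  refine ⟨.comp p' p, fun a => 1 + T a + T' (f a), ((PolyBdd.const 1).add hT).add
    ((hT'.comp f).trans hS), (hS'.comp f).trans hS, fun a => ?_⟩
  obtain ⟨t, ht, hr⟩ := h a
  obtain ⟨t', ht', hr'⟩ := h' (f a)
  exact ⟨1 + t + t', by dsimp only; omega, .comp hr hr'⟩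

theorem pair {f : α → β} {g : α → γ} (hf : PolyTimeIn σ f) (hg : PolyTimeIn σ g) :
    PolyTimeIn σ fun a => (f a, g a) := by
  obtain ⟨p, T, hT, hS, h⟩ := hf
  obtain ⟨p', T', hT', hS', h'⟩ := hg
  refine ⟨.pair p p', fun a => 1 + T a + T' a, ((PolyBdd.const 1).add hT).add hT',
    ((PolyBdd.const 1).add hS).add hS', fun a => ?_⟩
  obtain ⟨t, ht, hr⟩ := h a
  obtain ⟨t', ht', hr'⟩ := h' a
  exact ⟨1 + t + t', by dsimp only; omega, .pair hr hr'⟩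

theorem ite {c : α → Bool} {f g : α → β} (hc : PolyTimeIn σ c) (hf : PolyTimeIn σ f)
    (hg : PolyTimeIn σ g) : PolyTimeIn σ fun a => if c a then f a else g a := by
  obtain ⟨p₀, T₀, hT₀, -, h₀⟩ := hc
  obtain ⟨p, T, hT, hS, h⟩ := hf
  obtain ⟨p', T', hT', hS', h'⟩ := hg
  refine ⟨.ite p₀ p p', fun a => 1 + T₀ a + (T a + T' a),
    ((PolyBdd.const 1).add hT₀).add (hT.add hT'), (hS.add hS').mono fun a => ?_, fun a => ?_⟩
  · dsimp only
    split_ifs <;> omega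
  · obtain ⟨t₀, ht₀, hr₀⟩ := h₀ a
    obtain ⟨t, ht, hr⟩ := h a
    obtain ⟨t', ht', hr'⟩ := h' a
    cases hb : c a with
    | true =>
      rw [hb] at hr₀
      exact ⟨1 + t₀ + t, by dsimp only; omega, .ite_true hr₀ (by simp [enc]) (by simpa [hb] using hr)⟩
    | false =>
      rw [hb] at hr₀
      exact ⟨1 + t₀ + t', by dsimp only; omega, .ite_false hr₀ (by simpa [hb] using hr')⟩

/-- The program that folds a list. -/
def foldlProg (l i s : Prog) : Prog :=
  .comp (.comp .snd .snd) (.comp (.loop (.comp .fst .snd)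
    (.pair .fst (.pair (.comp .snd (.comp .fst .snd))
      (.comp s (.pair .fst (.pair (.comp .snd .snd) (.comp .fst (.comp .fst .snd))))))))
    (.pair .id (.pair l i)))

/-- The loop carries the parameter `c`, the rest of the list and the accumulator. The bound `τ` is
required only along the prefixes of `l`, because nothing is known about accumulators that do not
occur. The summand `50` pays for the pointer operations of a round. -/
theorem runs_foldl_loop {s : Prog} {c : Val} {f : β → γ → β} {τ : ℕ} (l : List γ) (b : β)
    (h : ∀ l₁ x l₂, l = l₁ ++ x :: l₂ →
      ∃ t ≤ τ, s.Runs (.pair c (.pair (enc (l₁.foldl f b)) (enc x)))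
        (enc (f (l₁.foldl f b) x)) t) :
    ∃ t ≤ (l.length + 1) * (τ + 50), (Prog.loop (.comp .fst .snd)
      (.pair .fst (.pair (.comp .snd (.comp .fst .snd))
      (.comp s (.pair .fst (.pair (.comp .snd .snd) (.comp .fst (.comp .fst .snd)))))))).Runs
      (.pair c (.pair (enc l) (enc b))) (.pair c (.pair (.num 0) (enc (l.foldl f b)))) t := by
  induction l generalizing b with
  | nil =>
    have h0 : (Prog.comp .fst .snd).Runs (.pair c (.pair (enc ([] : List γ)) (enc b))) (.num 0)
      (1 + 1 + 1) := .comp (.snd _) (.fst _)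
    exact ⟨_, by simp only [List.length_nil]; omega, .loop_exit h0⟩
  | cons x l ih =>
    obtain ⟨t, ht, hr⟩ := h [] x l rfl
    obtain ⟨u, hu, hru⟩ := ih (f b x) fun l₁ y l₂ e => by
      simpa using h (x :: l₁) y l₂ (by simp [e])
    refine ⟨_, ?_, .loop_step (.comp (.snd _) (.fst _)) (by simp [enc, Val.ofList, Val.fst, Val.snd])
      (.pair (.fst _) (.pair (.comp (.comp (.snd _) (.fst _)) (.snd _))
        (.comp (.pair (.fst _) (.pair (.comp (.snd _) (.snd _))
          (.comp (.comp (.snd _) (.fst _)) (.fst _)))) hr))) hru⟩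
    simp only [List.length_cons]
    rw [Nat.add_mul (l.length + 1), one_mul]
    omega

/-- Iterating a polynomial-time step may let the accumulator explode, so a polynomial bound `S` on
all partial folds has to be supplied by the user. -/
theorem foldl {l : α → List γ} {i : α → β} {f : α → β → γ → β} (hσ : PolyBdd σ esize)
    (hl : PolyTimeIn σ l) (hi : PolyTimeIn σ i)
    (hf : PolyTime fun x : α × β × γ => f x.1 x.2.1 x.2.2)
    {S : α → ℕ} (hS : PolyBdd σ S)
    (hb : ∀ a l₁ l₂, l a = l₁ ++ l₂ → esize (l₁.foldl (f a) (i a)) ≤ S a) :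
    PolyTimeIn σ fun a => (l a).foldl (f a) (i a) := by
  obtain ⟨pl, Tl, hTl, hSl, hl⟩ := hl
  obtain ⟨pi, Ti, hTi, -, hi⟩ := hi
  obtain ⟨p, T, ⟨k, hT⟩, -, h⟩ := hf
  have hτ : PolyBdd σ fun a => (2 + esize a + S a + esize (l a) + 2) ^ k :=
    (((((PolyBdd.const 2).add hσ).add hS).add hSl).add (.const 2)).pow k
  refine ⟨foldlProg pl pi p, fun a => 20 + Tl a + Ti a + esize (l a) *
    ((2 + esize a + S a + esize (l a) + 2) ^ k + 50),
    (((PolyBdd.const 20).add hTl).add hTi).add (hSl.mul (hτ.add (.const 50))),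
    hS.mono fun a => hb a (l a) [] (by simp), fun a => ?_⟩
  obtain ⟨tl, htl, hrl⟩ := hl a
  obtain ⟨ti, hti, hri⟩ := hi a
  obtain ⟨u, hu, hru⟩ := runs_foldl_loop (s := p) (c := enc a) (f := f a)
      (τ := (2 + esize a + S a + esize (l a) + 2) ^ k) (l a) (i a)
    fun l₁ x l₂ e => by
      obtain ⟨t, ht, hr⟩ := h (a, l₁.foldl (f a) (i a), x)
      refine ⟨t, ht.trans ((hT _).trans (Nat.pow_le_pow_left ?_ k)), hr⟩
      have h1 := hb a l₁ (x :: l₂) e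
      have h2 : esize x ≤ esize (l a) := esize_le_of_mem (by simp [e])
      simp only [esize_prod]
      omega
  refine ⟨_, ?_, .comp (.comp (.pair (.id _) (.pair hrl hri)) hru) (.comp (.snd _) (.snd _))⟩
  have h1 : ((l a).length + 1) * ((2 + esize a + S a + esize (l a) + 2) ^ k + 50) ≤
      esize (l a) * ((2 + esize a + S a + esize (l a) + 2) ^ k + 50) :=
    Nat.mul_le_mul_right _ (length_lt_esize (l a))
  dsimp only
  omega

end PolyTimeIn

namespace PolyTime
variable {α β γ δ : Type} [Enc α] [Enc β] [Enc γ] [Enc δ]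

@[fun_prop]
theorem id : PolyTime fun a : α => a :=
  ⟨.id, fun _ => 1, .const 1, .self, fun _ => ⟨1, le_rfl, .id _⟩⟩

@[fun_prop]
theorem const (b : β) : PolyTime fun _ : α => b := PolyTimeIn.const b

@[fun_prop]
theorem comp {g : β → γ} {f : α → β} (hg : PolyTime g) (hf : PolyTime f) :
    PolyTime fun a => g (f a) := PolyTimeIn.comp hg hf

@[fun_prop]
theorem pair {f : α → β} {g : α → γ} (hf : PolyTime f) (hg : PolyTime g) :
    PolyTime fun a => (f a, g a) := PolyTimeIn.pair hf hg

@[fun_prop]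
theorem fst {f : α → β × γ} (hf : PolyTime f) : PolyTime fun a => (f a).1 :=
  comp (g := Prod.fst) ⟨.fst, fun _ => 1, .const 1, PolyBdd.self.mono fun a => by simp; omega,
    fun _ => ⟨1, le_rfl, .fst _⟩⟩ hf

@[fun_prop]
theorem snd {f : α → β × γ} (hf : PolyTime f) : PolyTime fun a => (f a).2 :=
  comp (g := Prod.snd) ⟨.snd, fun _ => 1, .const 1, PolyBdd.self.mono fun a => by simp,
    fun a => ⟨1, le_rfl, .snd _⟩⟩ hf

@[fun_prop]
theorem ite {c : α → Bool} {f g : α → β} (hc : PolyTime c) (hf : PolyTime f)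
    (hg : PolyTime g) : PolyTime fun a => if c a then f a else g a := PolyTimeIn.ite hc hf hg

@[fun_prop]
theorem cons {f : α → β} {g : α → List β} (hf : PolyTime f) (hg : PolyTime g) :
    PolyTime fun a => f a :: g a :=
  comp (g := fun x : β × List β => x.1 :: x.2) ⟨.id, fun _ => 1, .const 1, .self,
    fun _ => ⟨1, le_rfl, .id _⟩⟩ (hf.pair hg)

theorem arith (op : ArithOp) (h : PolyBdd (esize (α := ℤ × ℤ)) fun x =>
    Val.bits (op.value x.1 x.2)) : PolyTime fun x : ℤ × ℤ => op.value x.1 x.2 := by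
  refine ⟨.arith op, fun x => op.cost x.1 x.2, ?_, (PolyBdd.const 1).add h,
    fun x => ⟨_, le_rfl, .arith op _ _⟩⟩
  refine (PolyBdd.self.mul PolyBdd.self).mono fun x => ?_
  simp only [esize_prod, esize_int]
  cases op <;> simp only [ArithOp.cost] <;> nlinarith [Nat.zero_le (Val.bits x.1), Nat.zero_le (Val.bits x.2)]

@[fun_prop]
theorem add {f g : α → ℤ} (hf : PolyTime f) (hg : PolyTime g) : PolyTime fun a => f a + g a :=
  comp (arith .add (PolyBdd.self.mono fun x => by
    have := bits_add x.1 x.2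
    simp only [ArithOp.value, esize_prod, esize_int]; omega)) (hf.pair hg)

@[fun_prop]
theorem sub {f g : α → ℤ} (hf : PolyTime f) (hg : PolyTime g) : PolyTime fun a => f a - g a :=
  comp (arith .sub (PolyBdd.self.mono fun x => by
    have := bits_sub x.1 x.2
    simp only [ArithOp.value, esize_prod, esize_int]; omega)) (hf.pair hg)

@[fun_prop]
theorem mul {f g : α → ℤ} (hf : PolyTime f) (hg : PolyTime g) : PolyTime fun a => f a * g a :=
  comp (arith .mul (PolyBdd.self.mono fun x => by
    have := bits_mul x.1 x.2
    simp only [ArithOp.value, esize_prod, esize_int]; omega)) (hf.pair hg)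

@[fun_prop]
theorem div {f g : α → ℤ} (hf : PolyTime f) (hg : PolyTime g) : PolyTime fun a => f a / g a :=
  comp (arith .div (PolyBdd.self.mono fun x => by
    have := bits_div x.1 x.2
    simp only [ArithOp.value, esize_prod, esize_int]; omega)) (hf.pair hg)

@[fun_prop]
theorem neg {f : α → ℤ} (hf : PolyTime f) : PolyTime fun a => -f a := by
  simpa using (const (0 : ℤ)).sub hf

@[fun_prop]
theorem decide_le {f g : α → ℤ} (hf : PolyTime f) (hg : PolyTime g) :
    PolyTime fun a => decide (f a ≤ g a) := by
  have h : PolyTime fun x : ℤ × ℤ => decide (x.1 ≤ x.2) := by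
    obtain ⟨p, T, hT, hS, h⟩ := arith .le ((PolyBdd.const 1).mono fun x => by
      simp only [ArithOp.value]; split_ifs <;> decide)
    have he : ∀ x : ℤ × ℤ, enc (decide (x.1 ≤ x.2)) = enc (ArithOp.le.value x.1 x.2) := fun x => by
      simp [enc, ArithOp.value]
    refine ⟨p, T, hT, (PolyBdd.const 2).mono fun x => esize_bool _, fun x => ?_⟩
    rw [he]
    exact h x
  exact comp h (hf.pair hg)

@[fun_prop]
theorem not {f : α → Bool} (hf : PolyTime f) : PolyTime fun a => !f a := by
  have : (fun a => !f a) = fun a => if f a then false else true := by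
    funext a; cases f a <;> rfl
  rw [this]; fun_prop

@[fun_prop]
theorem and {f g : α → Bool} (hf : PolyTime f) (hg : PolyTime g) : PolyTime fun a => f a && g a := by
  have : (fun a => f a && g a) = fun a => if f a then g a else false := by
    funext a; cases f a <;> rfl
  rw [this]; fun_prop

@[fun_prop]
theorem or {f g : α → Bool} (hf : PolyTime f) (hg : PolyTime g) : PolyTime fun a => f a || g a := by
  have : (fun a => f a || g a) = fun a => if f a then true else g a := by
    funext a; cases f a <;> rfl
  rw [this]; fun_prop

@[fun_prop]
theorem decide_eq {f g : α → ℤ} (hf : PolyTime f) (hg : PolyTime g) :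
    PolyTime fun a => decide (f a = g a) := by
  have : (fun a => decide (f a = g a)) = fun a => decide (f a ≤ g a) && decide (g a ≤ f a) := by
    funext a
    rw [← Bool.decide_and]
    exact decide_eq_decide.2 le_antisymm_iff
  rw [this]; fun_prop

@[fun_prop]
theorem isEmpty {f : α → List β} (hf : PolyTime f) : PolyTime fun a => (f a).isEmpty := by
  have h : PolyTime fun l : List β => l.isEmpty := by
    refine ⟨.ite .id .zero .one, fun _ => 3, .const 3,
      (PolyBdd.const 2).mono fun x => esize_bool _, fun l => ?_⟩
    cases l with
    | nil => exact ⟨3, le_rfl, .ite_false (.id _) (.one _)⟩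
    | cons a l => exact ⟨3, le_rfl, .ite_true (.id _) (by simp [enc, Val.ofList]) (.zero _)⟩
  exact comp h hf

@[fun_prop]
theorem tail {f : α → List β} (hf : PolyTime f) : PolyTime fun a => (f a).tail := by
  refine comp (g := List.tail) ⟨.snd, fun _ => 1, .const 1,
    PolyBdd.self.mono fun l => esize_of_sublist l.tail_sublist, fun l => ⟨1, le_rfl, ?_⟩⟩ hf
  cases l with
  | nil => exact .snd _
  | cons a l => exact .snd _

@[fun_prop]
theorem headD {f : α → List β} (hf : PolyTime f) (d : β) : PolyTime fun a => (f a).headD d := by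
  obtain ⟨p, t, h⟩ := Prog.exists_runs_const (enc d)
  refine comp (g := fun l : List β => l.headD d) ⟨.ite .id .fst p, fun _ => 3 + t, .const _,
    ((PolyBdd.const (esize d)).add PolyBdd.self).mono fun l => ?_, fun l => ?_⟩ hf
  · cases l with
    | nil => simp
    | cons a l => simp; omega
  · cases l with
    | nil => exact ⟨1 + 1 + t, by dsimp only; omega, .ite_false (.id _) (h _)⟩
    | cons a l => exact ⟨1 + 1 + 1, by dsimp only; omega,
        .ite_true (.id _) (by simp [enc, Val.ofList]) (.fst _)⟩

theorem foldl {l : α → List γ} {i : α → β} {f : α → β → γ → β}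
    (hl : PolyTime l) (hi : PolyTime i) (hf : PolyTime fun x : α × β × γ => f x.1 x.2.1 x.2.2)
    {S : α → ℕ} (hS : PolyBdd esize S)
    (hb : ∀ a l₁ l₂, l a = l₁ ++ l₂ → esize (l₁.foldl (f a) (i a)) ≤ S a) :
    PolyTime fun a => (l a).foldl (f a) (i a) := PolyTimeIn.foldl .self hl hi hf hS hb

theorem polyBdd_size {f : α → β} (hf : PolyTime f) : PolyBdd esize fun a => esize (f a) :=
  hf.choose_spec.choose_spec.2.1

@[fun_prop]
theorem reverse {l : α → List β} (hl : PolyTime l) : PolyTime fun a => (l a).reverse := by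
  have : (fun a => (l a).reverse) = fun a => (l a).foldl (fun b c => c :: b) [] := by
    funext a; simp
  rw [this]
  refine foldl hl (const _) (by fun_prop) hl.polyBdd_size fun a l₁ l₂ e => ?_
  have : l₁.foldl (fun b c => c :: b) [] = l₁.reverse := by simp
  rw [this, esize_reverse, e]
  exact esize_of_sublist (List.sublist_append_left _ _)

theorem foldr {l : α → List γ} {i : α → β} {f : α → γ → β → β}
    (hl : PolyTime l) (hi : PolyTime i) (hf : PolyTime fun x : α × γ × β => f x.1 x.2.1 x.2.2)
    {S : α → ℕ} (hS : PolyBdd esize S)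
    (hb : ∀ a l₁ l₂, l a = l₁ ++ l₂ → esize (l₂.foldr (f a) (i a)) ≤ S a) :
    PolyTime fun a => (l a).foldr (f a) (i a) := by
  have : (fun a => (l a).foldr (f a) (i a)) =
      fun a => (l a).reverse.foldl (fun b c => f a c b) (i a) := by
    funext a; simp
  rw [this]
  refine foldl (f := fun a b c => f a c b) hl.reverse hi
    (comp (f := fun x : α × β × γ => (x.1, x.2.2, x.2.1)) hf (by fun_prop)) hS
    fun a l₁ l₂ e => ?_
  have e' : l a = l₂.reverse ++ l₁.reverse := by
    rw [← List.reverse_append, ← e, List.reverse_reverse]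
  simpa using hb a l₂.reverse l₁.reverse e'

@[fun_prop]
theorem map {l : α → List β} {f : α → β → γ} (hl : PolyTime l)
    (hf : PolyTime fun x : α × β => f x.1 x.2) : PolyTime fun a => (l a).map (f a) := by
  have : (fun a => (l a).map (f a)) = fun a => (l a).foldr (fun x b => f a x :: b) [] := by
    funext a; simp [List.foldr_cons_eq_append]
  rw [this]
  have hf' : PolyTime fun x : α × β × List γ => f x.1 x.2.1 :: x.2.2 :=
    cons (comp (f := fun x : α × β × List γ => (x.1, x.2.1)) hf (by fun_prop)) (by fun_prop)
  obtain ⟨k, hk⟩ := hf.polyBdd_size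
  have hS : PolyBdd esize fun a => 1 + esize (l a) * (1 + (1 + esize a + esize (l a) + 2) ^ k) :=
    (PolyBdd.const 1).add (hl.polyBdd_size.mul ((PolyBdd.const 1).add (((((PolyBdd.const 1).add
      PolyBdd.self).add hl.polyBdd_size).add (.const 2)).pow k)))
  refine foldr (f := fun a x b => f a x :: b) hl (const _) hf' hS fun a l₁ l₂ e => ?_
  have : l₂.foldr (fun x b => f a x :: b) [] = l₂.map (f a) := by
    simp [List.foldr_cons_eq_append]
  rw [this]
  have hB : ∀ y ∈ l₂.map (f a), esize y ≤ (1 + esize a + esize (l a) + 2) ^ k := by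
    intro y hy
    obtain ⟨x, hx, rfl⟩ := List.mem_map.1 hy
    refine (hk (a, x)).trans (Nat.pow_le_pow_left ?_ k)
    have : esize x ≤ esize (l a) := esize_le_of_mem (by simp [e, hx])
    simp only [esize_prod]
    omega
  refine (esize_le_length_mul hB).trans (Nat.add_le_add_left (Nat.mul_le_mul_right _ ?_) _)
  have := length_lt_esize (l a)
  rw [e, List.length_append] at this
  rw [List.length_map, e]
  omega

@[fun_prop]
theorem append {f g : α → List β} (hf : PolyTime f) (hg : PolyTime g) :
    PolyTime fun a => f a ++ g a := by
  have : (fun a => f a ++ g a) = fun a => (f a).foldr (fun x b => x :: b) (g a) := by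
    funext a; simp
  rw [this]
  refine foldr hf hg (by fun_prop) (hf.polyBdd_size.add hg.polyBdd_size) fun a l₁ l₂ e => ?_
  have : l₂.foldr (fun x b => x :: b) (g a) = l₂ ++ g a := by simp
  rw [this]
  have h1 := esize_append l₂ (g a)
  have h2 : esize l₂ ≤ esize (f a) := by
    rw [e]; exact esize_of_sublist (List.sublist_append_right _ _)
  omega

@[fun_prop]
theorem flatten {f : α → List (List β)} (hf : PolyTime f) : PolyTime fun a => (f a).flatten := by
  have : (fun a => (f a).flatten) = fun a => (f a).foldr (fun x b => x ++ b) [] := by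
    funext a
    induction f a with
    | nil => rfl
    | cons x l ih => simp [ih]
  rw [this]
  refine foldr hf (const _) (by fun_prop) hf.polyBdd_size fun a l₁ l₂ e => ?_
  have h2 : esize l₂ ≤ esize (f a) := by
    rw [e]; exact esize_of_sublist (List.sublist_append_right _ _)
  refine le_trans ?_ h2
  clear e h2
  induction l₂ with
  | nil => simp
  | cons x l ih =>
    have := esize_append x (l.foldr (fun x b => x ++ b) [])
    simp only [List.foldr_cons, esize_cons]
    omega

@[fun_prop]
theorem flatMap {l : α → List β} {f : α → β → List γ} (hl : PolyTime l)
    (hf : PolyTime fun x : α × β => f x.1 x.2) : PolyTime fun a => (l a).flatMap (f a) := by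
  simp only [List.flatMap_def]
  exact (hl.map hf).flatten

@[fun_prop]
theorem filter {l : α → List β} {f : α → β → Bool} (hl : PolyTime l)
    (hf : PolyTime fun x : α × β => f x.1 x.2) : PolyTime fun a => (l a).filter (f a) := by
  have : (fun a => (l a).filter (f a)) =
      fun a => (l a).flatMap (fun x => if f a x then [x] else []) := by
    funext a
    induction l a with
    | nil => rfl
    | cons x l ih => by_cases h : f a x <;> simp [h, ih]
  rw [this]
  exact hl.flatMap (ite hf (by fun_prop) (by fun_prop))

@[fun_prop]
theorem all {l : α → List β} {f : α → β → Bool} (hl : PolyTime l)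
    (hf : PolyTime fun x : α × β => f x.1 x.2) : PolyTime fun a => (l a).all (f a) := by
  have : (fun a => (l a).all (f a)) =
      fun a => ((l a).filter (fun x => !f a x)).isEmpty := by
    funext a
    induction l a with
    | nil => rfl
    | cons x l ih => cases h : f a x <;> simp [h]; simpa using ih
  rw [this]
  exact (hl.filter hf.not).isEmpty

theorem bits_sum (l : List ℤ) : esize l.sum ≤ esize l + 1 := by
  induction l with
  | nil => decide
  | cons x l ih =>
    have := bits_add x l.sum
    simp only [List.sum_cons, esize_int, esize_cons] at *
    omega

theorem bits_prod (l : List ℤ) : esize l.prod ≤ esize l + 1 := by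
  induction l with
  | nil => decide
  | cons x l ih =>
    have := bits_mul x l.prod
    simp only [List.prod_cons, esize_int, esize_cons] at *
    omega

@[fun_prop]
theorem sum {l : α → List ℤ} (hl : PolyTime l) : PolyTime fun a => (l a).sum := by
  have : (fun a => (l a).sum) = fun a => (l a).foldr (fun x b => x + b) 0 := by
    funext a; rfl
  rw [this]
  refine foldr hl (const _) (by fun_prop) (hl.polyBdd_size.add (.const 1)) fun a l₁ l₂ e => ?_
  have h2 : esize l₂ ≤ esize (l a) := by
    rw [e]; exact esize_of_sublist (List.sublist_append_right _ _)
  exact (bits_sum l₂).trans (by omega)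

@[fun_prop]
theorem prod {l : α → List ℤ} (hl : PolyTime l) : PolyTime fun a => (l a).prod := by
  have : (fun a => (l a).prod) = fun a => (l a).foldr (fun x b => x * b) 1 := by
    funext a; rfl
  rw [this]
  refine foldr hl (const _) (by fun_prop) (hl.polyBdd_size.add (.const 1)) fun a l₁ l₂ e => ?_
  have h2 : esize l₂ ≤ esize (l a) := by
    rw [e]; exact esize_of_sublist (List.sublist_append_right _ _)
  exact (bits_prod l₂).trans (by omega)

/-- Zipping as a fold: the state holds the rest of the second list and the output in reverse order.
The default `d` never enters the output, as emptiness is tested first. -/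
theorem foldl_zip {α β : Type} (l : List α) (m : List β) (b : List (α × β)) (d : β) :
    (l.foldl (fun (s : List β × List (α × β)) x =>
      if s.1.isEmpty then s else (s.1.tail, (x, s.1.headD d) :: s.2)) (m, b)) =
      (m.drop l.length, (l.zip m).reverse ++ b) := by
  induction l generalizing m b with
  | nil => simp
  | cons x l ih =>
    cases m with
    | nil => rw [List.foldl_cons]; exact (ih [] b).trans (by simp)
    | cons y m => rw [List.foldl_cons]; exact (ih m _).trans (by simp)

@[fun_prop]
theorem zip [Inhabited γ] {l : α → List β} {m : α → List γ} (hl : PolyTime l) (hm : PolyTime m) :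
    PolyTime fun a => (l a).zip (m a) := by
  have : (fun a => (l a).zip (m a)) = fun a => ((l a).foldl (fun (s : List γ × List (β × γ)) x =>
      if s.1.isEmpty then s else (s.1.tail, (x, s.1.headD default) :: s.2)) (m a, [])).2.reverse := by
    funext a; rw [foldl_zip]; simp
  rw [this]
  refine reverse (snd (foldl hl (by fun_prop) ?_
    (S := fun a => 1 + esize (m a) + (1 + esize (l a) * (1 + (1 + esize (l a) + esize (m a)))))
    ?_ fun a l₁ l₂ e => ?_))
  · fun_prop
  · exact ((PolyBdd.const 1).add hm.polyBdd_size).add ((PolyBdd.const 1).add (hl.polyBdd_size.mul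
      ((PolyBdd.const 1).add (((PolyBdd.const 1).add hl.polyBdd_size).add hm.polyBdd_size))))
  · rw [foldl_zip, esize_prod, List.append_nil, esize_reverse]
    have h1 : esize ((m a).drop l₁.length) ≤ esize (m a) :=
      esize_of_sublist (List.drop_sublist _ _)
    have h2 : esize (l₁.zip (m a)) ≤
        1 + (l₁.zip (m a)).length * (1 + (1 + esize (l a) + esize (m a))) := by
      refine esize_le_length_mul fun x hx => ?_
      have hx1 : esize x.1 ≤ esize (l a) :=
        esize_le_of_mem (by rw [e]; exact List.mem_append_left _ (List.of_mem_zip hx).1)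
      have hx2 : esize x.2 ≤ esize (m a) := esize_le_of_mem (List.of_mem_zip hx).2
      rw [esize_prod]
      omega
    have h3 : (l₁.zip (m a)).length ≤ esize (l a) := by
      have := length_lt_esize (l a)
      rw [e, List.length_append] at this
      rw [List.length_zip, e]
      omega
    have h4 := Nat.mul_le_mul_right (1 + (1 + esize (l a) + esize (m a))) h3
    dsimp only
    omega

end PolyTime

end DistBisim

namespace DistBisim
open Enc (enc)

/-! ### The decision procedure -/

namespace Raw

/-- Inclusion of sets of clocks. -/
def subset (K L : List Bool) : Bool := (K.zip L).all fun p => !p.1 || p.2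
/-- Disjointness of sets of clocks. -/
def disjoint (K L : List Bool) : Bool := (K.zip L).all fun p => !(p.1 && p.2)
/-- The union of sets of clocks. -/
def union (K L : List Bool) : List Bool := (K.zip L).map fun p => p.1 || p.2
/-- The total rate of a set of clocks. -/
def total (K : List Bool) (r : List ℤ) : ℤ := ((K.zip r).map fun p => if p.1 then p.2 else 0).sum
/-- The number of clocks in a set. -/
def card (K : List Bool) : ℤ := (K.map fun b => if b then (1 : ℤ) else 0).sum

/-- Edges: source, action, guard, target and the clocks that the target sets. -/
abbrev Edge := ℤ × ℤ × List Bool × ℤ × List Bool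
/-- Configurations: a location and the set of running clocks. -/
abbrev Cfg := ℤ × List Bool

/-- The edges that are enabled in a configuration. -/
def enabled (E : List Edge) (s : Cfg) : List Edge :=
  E.filter fun e => decide (e.1 = s.1) && disjoint e.2.2.1 s.2

/-- Entries of the generator. -/
def gen (E : List Edge) (r : List ℤ) (s u : Cfg) : ℤ :=
  if (enabled E s).isEmpty && decide (s.1 = u.1) then
    if subset s.2 u.2 && subset u.2 s.2 then -total s.2 r
    else if subset u.2 s.2 && decide (card s.2 = card u.2 + 1) then total s.2 r - total u.2 r else 0
  else 0

/-- Entries of the matrix of an action. -/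
def jump (E : List Edge) (a : ℤ) (s u : Cfg) : ℤ :=
  if (enabled E s).isEmpty then 0
  else
    if decide (((enabled E s).headD default).2.1 = a) &&
        (decide (((enabled E s).headD default).2.2.2.1 = u.1) &&
        (subset (union s.2 ((enabled E s).headD default).2.2.2.2) u.2 &&
          subset u.2 (union s.2 ((enabled E s).headD default).2.2.2.2)))
    then 1 else 0

/-- Entries of the sum of the tensor squares of the generator and the matrices of the actions. -/
def entry (E : List Edge) (r : List ℤ) (p p' : Cfg × Cfg) : ℤ :=
  gen E r p.1 p'.1 * gen E r p.2 p'.2 +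
    (E.map fun e => jump E e.2.1 p.1 p'.1 * jump E e.2.1 p.2 p'.2).sum

/-- The dot product. -/
def dot (v w : List ℤ) : ℤ := ((v.zip w).map fun p => p.1 * p.2).sum

/-- Iterate a matrix on a vector and test whether all iterates are orthogonal to `c`. -/
def iter {δ : Type} (rows : List (List ℤ)) (c : List ℤ) (l : List δ) (z : List ℤ) :
    List ℤ × Bool :=
  l.foldl (fun s _ => (rows.map fun row => dot row s.1, s.2 && decide (dot c s.1 = 0))) (z, true)

/-- The numbers below the length of a list. -/
def indices {δ : Type} (l : List δ) : List ℤ := l.foldr (fun _ b => 0 :: b.map (· + 1)) []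

/-- The value of a finite map, given as a list of pairs. -/
def lookup (l : List (ℤ × List Bool)) (q : ℤ) : List Bool :=
  ((l.filter fun p => decide (p.1 = q)).map fun p => p.2).headD []

/-- All lists of truth values of a given length. -/
def bitLists : ℕ → List (List Bool)
  | 0 => [[]]
  | n + 1 => (bitLists n).map (false :: ·) ++ (bitLists n).map (true :: ·)

/-- The encoding of a pair of locations of an automaton. -/
abbrev Input := (ℤ × ℤ × ℤ × List (ℤ × ℤ × List Bool × ℤ × ℤ) × List (List Bool) ×
  List (ℤ × ℤ) × ℤ) × ℤ × ℤ × ℤ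

/-- The edges in the input. -/
def Input.edges (x : Input) : List (ℤ × ℤ × List Bool × ℤ × ℤ) := x.1.2.2.2.1
/-- The clocks that are set on entering the locations. -/
def Input.resets (x : Input) : List (List Bool) := x.1.2.2.2.2.1
/-- The rates in the input. -/
def Input.rates (x : Input) : List (ℤ × ℤ) := x.1.2.2.2.2.2.1

/-- The rates, multiplied by the product of the denominators. -/
def intRates (l : List (ℤ × ℤ)) : List ℤ :=
  l.map fun p => p.1 * ((l.map fun p => p.2).prod / p.2)

/-- The locations with the clocks they set. -/
def locs (l : List (List Bool)) : List (ℤ × List Bool) := (indices l).zip l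

/-- The edges with the clocks that the target sets. -/
def fullEdges (x : Input) : List Edge :=
  x.edges.map fun e => (e.1, e.2.1, e.2.2.1, e.2.2.2.1, lookup (locs x.resets) e.2.2.2.1)

/-- The configurations. -/
def cfgs (x : Input) (A : List (List Bool)) : List Cfg :=
  (indices x.resets).flatMap fun q => A.map fun K => (q, K)

/-- The pairs of configurations. -/
def pairs (x : Input) (A : List (List Bool)) : List (Cfg × Cfg) :=
  (cfgs x A).flatMap fun s => (cfgs x A).map fun u => (s, u)

/-- The difference of the point masses at two configurations. -/
def diff (s₁ s₂ s : Cfg) : ℤ :=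
  (if decide (s.1 = s₁.1) && (subset s.2 s₁.2 && subset s₁.2 s.2) then 1 else 0) -
    if decide (s.1 = s₂.1) && (subset s.2 s₂.2 && subset s₂.2 s.2) then 1 else 0

/-- The configuration in which a location is started. -/
def start (x : Input) (q : ℤ) : Cfg := (q, lookup (locs x.resets) q)

/-- The decision procedure; `A` is the list of all sets of clocks. -/
def decision (x : Input) (A : List (List Bool)) : Bool :=
  (iter ((pairs x A).map fun p => (pairs x A).map fun p' =>
      entry (fullEdges x) (intRates x.rates) p p')
    ((pairs x A).map fun p => diff (start x x.2.1) (start x x.2.2.1) p.1 *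
      diff (start x x.2.1) (start x x.2.2.1) p.2)
    (pairs x A) ((pairs x A).map fun _ => 1)).2

end Raw

/-! ### The running time of the decision procedure -/

namespace PolyTime
open Raw
variable {α β γ δ : Type} [Enc α] [Enc β] [Enc γ] [Enc δ]

@[fun_prop]
theorem raw_subset {f g : α → List Bool} (hf : PolyTime f) (hg : PolyTime g) :
    PolyTime fun a => Raw.subset (f a) (g a) := by
  unfold Raw.subset; fun_prop

@[fun_prop]
theorem raw_disjoint {f g : α → List Bool} (hf : PolyTime f) (hg : PolyTime g) :
    PolyTime fun a => Raw.disjoint (f a) (g a) := by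
  unfold Raw.disjoint; fun_prop

@[fun_prop]
theorem raw_union {f g : α → List Bool} (hf : PolyTime f) (hg : PolyTime g) :
    PolyTime fun a => Raw.union (f a) (g a) := by
  unfold Raw.union; fun_prop

@[fun_prop]
theorem raw_total {f : α → List Bool} {g : α → List ℤ} (hf : PolyTime f) (hg : PolyTime g) :
    PolyTime fun a => Raw.total (f a) (g a) := by
  unfold Raw.total; fun_prop

@[fun_prop]
theorem raw_card {f : α → List Bool} (hf : PolyTime f) : PolyTime fun a => Raw.card (f a) := by
  unfold Raw.card; fun_prop

@[fun_prop]
theorem raw_enabled {f : α → List Raw.Edge} {g : α → Cfg} (hf : PolyTime f) (hg : PolyTime g) :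
    PolyTime fun a => Raw.enabled (f a) (g a) := by
  unfold Raw.enabled; fun_prop

@[fun_prop]
theorem raw_gen {f : α → List Raw.Edge} {r : α → List ℤ} {g h : α → Cfg} (hf : PolyTime f)
    (hr : PolyTime r) (hg : PolyTime g) (hh : PolyTime h) :
    PolyTime fun a => Raw.gen (f a) (r a) (g a) (h a) := by
  unfold Raw.gen; fun_prop

@[fun_prop]
theorem raw_jump {f : α → List Raw.Edge} {b : α → ℤ} {g h : α → Cfg} (hf : PolyTime f)
    (hb : PolyTime b) (hg : PolyTime g) (hh : PolyTime h) :
    PolyTime fun a => Raw.jump (f a) (b a) (g a) (h a) := by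
  unfold Raw.jump; fun_prop

@[fun_prop]
theorem raw_entry {f : α → List Raw.Edge} {r : α → List ℤ} {g h : α → Cfg × Cfg}
    (hf : PolyTime f) (hr : PolyTime r) (hg : PolyTime g) (hh : PolyTime h) :
    PolyTime fun a => Raw.entry (f a) (r a) (g a) (h a) := by
  unfold Raw.entry; fun_prop

@[fun_prop]
theorem raw_dot {f g : α → List ℤ} (hf : PolyTime f) (hg : PolyTime g) :
    PolyTime fun a => Raw.dot (f a) (g a) := by
  unfold Raw.dot; fun_prop

@[fun_prop]
theorem raw_lookup {f : α → List (ℤ × List Bool)} {g : α → ℤ} (hf : PolyTime f)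
    (hg : PolyTime g) : PolyTime fun a => Raw.lookup (f a) (g a) := by
  unfold Raw.lookup; fun_prop

@[fun_prop]
theorem raw_intRates {f : α → List (ℤ × ℤ)} (hf : PolyTime f) :
    PolyTime fun a => Raw.intRates (f a) := by
  unfold Raw.intRates; fun_prop

end PolyTime

theorem indices_eq {δ : Type} (l : List δ) :
    Raw.indices l = (List.range l.length).map fun n : ℕ => (n : ℤ) := by
  induction l with
  | nil => rfl
  | cons x l ih =>
    have : Raw.indices (x :: l) = 0 :: (Raw.indices l).map (· + 1) := rfl
    rw [this, ih, List.length_cons, List.range_succ_eq_map]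
    simp

theorem size_add (m n : ℕ) : Nat.size (m + n) ≤ Nat.size m + Nat.size n + 1 := by
  have := bits_add (m : ℤ) n
  rw [← Nat.cast_add] at this
  exact this

theorem size_mul (m n : ℕ) : Nat.size (m * n) ≤ Nat.size m + Nat.size n := by
  have := bits_mul (m : ℤ) n
  rw [← Nat.cast_mul] at this
  exact this

theorem size_pow (m n : ℕ) : Nat.size (m ^ n) ≤ n * Nat.size m + 1 := by
  induction n with
  | zero => simp
  | succ n ih =>
    have := size_mul (m ^ n) m
    rw [pow_succ, Nat.add_mul]
    omega

theorem size_le_self (n : ℕ) : Nat.size n ≤ n := Nat.size_le.2 Nat.lt_two_pow_self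

/-- The sum of the absolute values. -/
def l1 (z : List ℤ) : ℕ := (z.map Int.natAbs).sum

theorem size_l1 (z : List ℤ) : Nat.size (l1 z) ≤ esize z := by
  induction z with
  | nil => simp [l1]
  | cons x z ih =>
    have h := size_add x.natAbs (l1 z)
    have h2 : l1 (x :: z) = x.natAbs + l1 z := rfl
    have h3 : Val.bits x = Nat.size x.natAbs := rfl
    rw [h2]
    simp only [esize_cons, esize_int]
    omega

theorem size_l1_rows (rows : List (List ℤ)) : Nat.size ((rows.map l1).sum) ≤ esize rows := by
  induction rows with
  | nil => simp
  | cons x z ih =>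
    have h := size_add (l1 x) ((z.map l1).sum)
    have h2 := size_l1 x
    simp only [esize_cons, List.map_cons, List.sum_cons]
    omega

theorem natAbs_dot_le (v w : List ℤ) : (Raw.dot v w).natAbs ≤ l1 v * l1 w := by
  induction v generalizing w with
  | nil => simp [Raw.dot]
  | cons x v ih =>
    cases w with
    | nil => simp [Raw.dot]
    | cons y w =>
      have h1 : Raw.dot (x :: v) (y :: w) = x * y + Raw.dot v w := rfl
      have h2 : l1 (x :: v) = x.natAbs + l1 v := rfl
      have h3 : l1 (y :: w) = y.natAbs + l1 w := rfl
      rw [h1, h2, h3]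
      have h4 := Int.natAbs_add_le (x * y) (Raw.dot v w)
      rw [Int.natAbs_mul] at h4
      have := ih w
      nlinarith [Nat.zero_le (x.natAbs * l1 w), Nat.zero_le (l1 v * y.natAbs)]

theorem l1_map_dot (rows : List (List ℤ)) (z : List ℤ) :
    l1 (rows.map fun row => Raw.dot row z) ≤ (rows.map l1).sum * l1 z := by
  induction rows with
  | nil => simp [l1]
  | cons x rows ih =>
    have h1 : l1 ((x :: rows).map fun row => Raw.dot row z) =
      (Raw.dot x z).natAbs + l1 (rows.map fun row => Raw.dot row z) := rfl
    rw [h1, List.map_cons, List.sum_cons, Nat.add_mul]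
    exact Nat.add_le_add (natAbs_dot_le x z) ih

theorem esize_le_l1 (z : List ℤ) : esize z ≤ 1 + z.length * (2 + Nat.size (l1 z)) := by
  refine (esize_le_length_mul (B := 1 + Nat.size (l1 z)) fun x hx => ?_).trans
    (Nat.add_le_add_left (Nat.mul_le_mul_left _ (by omega)) _)
  rw [esize_int]
  refine Nat.add_le_add_left (Nat.size_le_size ?_) 1
  exact List.single_le_sum (fun _ _ => Nat.zero_le _) _ (List.mem_map_of_mem hx)

/-- One round multiplies the sum of absolute values by at most that of the whole matrix. The bound
is exponential in the number of rounds, hence linear after passing to bit lengths. -/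
theorem iter_fst_bound {δ : Type} (rows : List (List ℤ)) (c z : List ℤ) (l : List δ) :
    l1 (Raw.iter rows c l z).1 ≤ (rows.map l1).sum ^ l.length * l1 z ∧
      (Raw.iter rows c l z).1.length ≤ rows.length + z.length := by
  induction l using List.reverseRecOn with
  | nil => simp [Raw.iter]
  | append_singleton l x ih =>
    have : Raw.iter rows c (l ++ [x]) z = ((rows.map fun row => Raw.dot row (Raw.iter rows c l z).1),
      ((Raw.iter rows c l z).2 && decide (Raw.dot c (Raw.iter rows c l z).1 = 0))) := by
      unfold Raw.iter
      rw [List.foldl_append]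
      rfl
    rw [this]
    refine ⟨(l1_map_dot _ _).trans ?_, by simp⟩
    rw [List.length_append, List.length_singleton, pow_succ, mul_comm (_ ^ _), mul_assoc]
    exact Nat.mul_le_mul_left _ ih.1

theorem esize_bitLists (n : ℕ) : esize (Raw.bitLists n) ≤ 1 + 2 ^ n * (1 + (1 + 3 * n)) := by
  have h : (Raw.bitLists n).length = 2 ^ n ∧ ∀ K ∈ Raw.bitLists n, esize K ≤ 1 + 3 * n := by
    induction n with
    | zero => simp [Raw.bitLists]
    | succ n ih =>
      refine ⟨by simp [Raw.bitLists, ih.1, pow_succ, mul_two], fun K hK => ?_⟩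
      simp only [Raw.bitLists, List.mem_append, List.mem_map] at hK
      obtain ⟨L, hL, rfl⟩ | ⟨L, hL, rfl⟩ := hK <;> have h1 := ih.2 L hL <;> rw [esize_cons]
      · have := esize_bool false; omega
      · have := esize_bool true; omega
  rw [← h.1]
  exact esize_le_length_mul h.2

theorem foldl_bitLists {δ : Type} (l : List δ) (n : ℕ) :
    l.foldl (fun b _ => b.map (false :: ·) ++ b.map (true :: ·)) (Raw.bitLists n) =
      Raw.bitLists (n + l.length) := by
  induction l generalizing n with
  | nil => rfl
  | cons x l ih =>
    rw [List.foldl_cons]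
    exact (ih (n + 1)).trans (by rw [List.length_cons]; congr 1; omega)

namespace PolyTime
open Raw
variable {α β γ δ : Type} [Enc α] [Enc β] [Enc γ] [Enc δ]

@[fun_prop]
theorem raw_indices {f : α → List δ} (hf : PolyTime f) : PolyTime fun a => Raw.indices (f a) := by
  unfold Raw.indices
  refine foldr (S := fun a => 1 + esize (f a) * (1 + (1 + esize (f a)))) hf (const _) (by fun_prop)
    ((PolyBdd.const 1).add (hf.polyBdd_size.mul ((PolyBdd.const 1).add ((PolyBdd.const 1).add
      hf.polyBdd_size)))) fun a l₁ l₂ e => ?_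
  change esize (Raw.indices l₂) ≤ _
  have h3 : l₂.length < esize (f a) := by
    have := length_lt_esize (f a)
    rw [e, List.length_append] at this
    rw [e]
    omega
  rw [indices_eq]
  refine (esize_le_length_mul (B := 1 + esize (f a)) fun x hx => ?_).trans
    (Nat.add_le_add_left (Nat.mul_le_mul_right _ (by simpa using h3.le)) _)
  obtain ⟨n, hn, rfl⟩ := List.mem_map.1 hx
  rw [List.mem_range] at hn
  have : Val.bits (n : ℤ) ≤ n := size_le_self _
  rw [esize_int]
  omega

-- By `iter_fst_bound`, every intermediate vector has at most `esize rows + esize z` entries, and no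
-- entry is longer than the binary expansion of the sum of absolute values. The size bound `S`
-- multiplies these two estimates.
@[fun_prop]
theorem raw_iter {rows : α → List (List ℤ)} {c z : α → List ℤ} {l : α → List δ}
    (hrows : PolyTime rows) (hc : PolyTime c) (hl : PolyTime l) (hz : PolyTime z) :
    PolyTime fun a => Raw.iter (rows a) (c a) (l a) (z a) := by
  unfold Raw.iter
  refine foldl (S := fun a => 3 + (1 + (esize (rows a) + esize (z a)) *
      (2 + (esize (l a) * esize (rows a) + 1 + esize (z a))))) hl (by fun_prop) ?_
    ((PolyBdd.const 3).add ((PolyBdd.const 1).add ((hrows.polyBdd_size.add hz.polyBdd_size).mul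
      ((PolyBdd.const 2).add (((hl.polyBdd_size.mul hrows.polyBdd_size).add (.const 1)).add
        hz.polyBdd_size))))) fun a l₁ l₂ e => ?_
  · have hrows' := hrows
    have h1 : PolyTime fun x : α × (List ℤ × Bool) × δ => rows x.1 := comp hrows (by fun_prop)
    have h2 : PolyTime fun x : α × (List ℤ × Bool) × δ => c x.1 := comp hc (by fun_prop)
    fun_prop
  · change esize (Raw.iter (rows a) (c a) l₁ (z a)) ≤ _
    obtain ⟨h1, h2⟩ := iter_fst_bound (rows a) (c a) (z a) l₁
    have h3 := esize_le_l1 (Raw.iter (rows a) (c a) l₁ (z a)).1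
    have h4 := esize_bool (Raw.iter (rows a) (c a) l₁ (z a)).2
    have h5 := size_mul ((((rows a).map l1).sum) ^ l₁.length) (l1 (z a))
    have h6 := size_pow (((rows a).map l1).sum) l₁.length
    have h7 := size_l1 (z a)
    have h8 := size_l1_rows (rows a)
    have h9 := Nat.size_le_size h1
    have h10 : l₁.length ≤ esize (l a) := by
      have := length_lt_esize (l a)
      rw [e, List.length_append] at this
      rw [e]
      omega
    have h11 := Nat.mul_le_mul h10 h8
    have h12 := length_lt_esize (rows a)
    have h13 := length_lt_esize (z a)
    have h14 : (Raw.iter (rows a) (c a) l₁ (z a)).1.length ≤ esize (rows a) + esize (z a) := by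
      omega
    have h15 : 2 + Nat.size (l1 (Raw.iter (rows a) (c a) l₁ (z a)).1) ≤
      2 + (esize (l a) * esize (rows a) + 1 + esize (z a)) := by omega
    have h16 := Nat.mul_le_mul h14 h15
    rw [esize_prod]
    omega

@[fun_prop]
theorem raw_locs {f : α → List (List Bool)} (hf : PolyTime f) :
    PolyTime fun a => Raw.locs (f a) := by
  unfold Raw.locs; fun_prop

@[fun_prop]
theorem input_edges {f : α → Input} (hf : PolyTime f) : PolyTime fun a => (f a).edges := by
  unfold Raw.Input.edges; fun_prop

@[fun_prop]
theorem input_resets {f : α → Input} (hf : PolyTime f) : PolyTime fun a => (f a).resets := by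
  unfold Raw.Input.resets; fun_prop

@[fun_prop]
theorem input_rates {f : α → Input} (hf : PolyTime f) : PolyTime fun a => (f a).rates := by
  unfold Raw.Input.rates; fun_prop

@[fun_prop]
theorem raw_fullEdges {f : α → Input} (hf : PolyTime f) :
    PolyTime fun a => Raw.fullEdges (f a) := by
  unfold Raw.fullEdges; fun_prop

@[fun_prop]
theorem raw_cfgs {f : α → Input} {g : α → List (List Bool)} (hf : PolyTime f) (hg : PolyTime g) :
    PolyTime fun a => Raw.cfgs (f a) (g a) := by
  unfold Raw.cfgs; fun_prop

@[fun_prop]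
theorem raw_pairs {f : α → Input} {g : α → List (List Bool)} (hf : PolyTime f) (hg : PolyTime g) :
    PolyTime fun a => Raw.pairs (f a) (g a) := by
  unfold Raw.pairs; fun_prop

@[fun_prop]
theorem raw_diff {f g h : α → Cfg} (hf : PolyTime f) (hg : PolyTime g) (hh : PolyTime h) :
    PolyTime fun a => Raw.diff (f a) (g a) (h a) := by
  unfold Raw.diff; fun_prop

@[fun_prop]
theorem raw_start {f : α → Input} {g : α → ℤ} (hf : PolyTime f) (hg : PolyTime g) :
    PolyTime fun a => Raw.start (f a) (g a) := by
  unfold Raw.start; fun_prop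

/-- With the list of all sets of clocks as part of the input, the whole procedure is polynomial; the
exponential part is confined to the construction of that list. -/
theorem raw_decision : PolyTime fun x : Input × List (List Bool) => Raw.decision x.1 x.2 := by
  unfold Raw.decision; fun_prop

end PolyTime

/-- It remains to build the list of all sets of clocks. It is doubled once for each entry of the
list of rates, which has one entry per clock, so its size is polynomial in `2 ^ x.rates.length`. -/
theorem polyTimeIn_decision : PolyTimeIn (fun x : Raw.Input => esize x + 2 ^ x.rates.length)
    fun x => Raw.decision x (Raw.bitLists x.rates.length) := by
  set σ : Raw.Input → ℕ := fun x => esize x + 2 ^ x.rates.length with hσdef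
  have hσ : PolyBdd σ esize := PolyBdd.self.mono fun a => Nat.le_add_right _ _
  have of : ∀ {β : Type} [Enc β] {f : Raw.Input → β}, PolyTime f → PolyTimeIn σ f := by
    rintro β _ f ⟨p, T, hT, hS, h⟩
    exact ⟨p, T, hT.trans hσ, hS.trans hσ, h⟩
  suffices h : PolyTimeIn σ fun x => Raw.bitLists x.rates.length from
    PolyTimeIn.comp (g := fun x : Raw.Input × List (List Bool) => Raw.decision x.1 x.2)
      (f := fun x => (x, Raw.bitLists x.rates.length)) PolyTime.raw_decision ((of .id).pair h)
  have : (fun x : Raw.Input => Raw.bitLists x.rates.length) = fun x : Raw.Input =>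
      x.rates.foldl (fun b _ => b.map (false :: ·) ++ b.map (true :: ·)) [[]] := by
    funext x
    have := foldl_bitLists x.rates 0
    rw [zero_add] at this
    exact this.symm
  rw [this]
  refine PolyTimeIn.foldl (S := fun x => 1 + σ x * (1 + (1 + 3 * σ x))) hσ (of (by fun_prop))
    (of (by fun_prop)) (by fun_prop) ((PolyBdd.const 1).add (PolyBdd.self.mul ((PolyBdd.const 1).add
      ((PolyBdd.const 1).add ((PolyBdd.const 3).mul .self))))) fun x l₁ l₂ e => ?_
  have h1 := foldl_bitLists l₁ 0
  rw [zero_add] at h1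
  have h2 : l₁.length ≤ x.rates.length := by rw [e, List.length_append]; omega
  have h3 : 2 ^ l₁.length ≤ σ x :=
    (Nat.pow_le_pow_right (by omega) h2).trans (Nat.le_add_left _ _)
  have h4 : l₁.length ≤ σ x := Nat.lt_two_pow_self.le.trans h3
  exact (congrArg esize h1).le.trans ((esize_bitLists _).trans
    (Nat.add_le_add_left (Nat.mul_le_mul h3 (by omega)) 1))

end DistBisim

/-! ### Configurations, their matrices, and the equivalence problem for weighted automata -/

namespace DistBisim
open Enc (enc)

namespace ExpAutomaton
variable (M : ExpAutomaton)

/-- Configurations: a location and the set of running clocks. -/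
abbrev Cfg := Fin M.nQ × Finset (Fin M.nC)

/-- The edges that are enabled in a configuration. -/
def enabled (s : M.Cfg) : List (Edge (Fin M.nQ) (Fin M.nC) (Fin M.nA)) :=
  M.edges.filter fun e => decide (e.src = s.1 ∧ Disjoint e.guard s.2)

/-- The configuration that is entered by an edge. -/
def next (e : Edge (Fin M.nQ) (Fin M.nC) (Fin M.nA)) (s : M.Cfg) : M.Cfg :=
  (e.tgt, s.2 ∪ M.κ e.tgt)

section Ring
variable {R : Type*} [CommRing R]

/-- The generator of the Markov process of the running clocks, stopped when an edge is enabled. -/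
def gen (r : Fin M.nC → R) : Matrix M.Cfg M.Cfg R := fun s u =>
  if M.enabled s = [] ∧ s.1 = u.1 then
    if s.2 = u.2 then -∑ c ∈ s.2, r c
    else if u.2 ⊆ s.2 ∧ s.2.card = u.2.card + 1 then ∑ c ∈ s.2, r c - ∑ c ∈ u.2, r c else 0
  else 0

variable (R) in
/-- The transition matrix of an action in the configurations with an enabled edge. -/
def jump (a : Fin M.nA) : Matrix M.Cfg M.Cfg R := fun s u =>
  match (M.enabled s).head? with
  | none => 0
  | some e => if e.act = a ∧ M.next e s = u then 1 else 0

/-- The generator and the matrices of the actions. -/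
def letter (r : Fin M.nC → R) : Option (Fin M.nA) → Matrix M.Cfg M.Cfg R
  | none => M.gen r
  | some a => M.jump R a

open Matrix in
/-- The product of the matrices of a word with the vector of ones. -/
def wordVec (r : Fin M.nC → R) (w : List (Option (Fin M.nA))) : M.Cfg → R :=
  w.foldr (fun l v => M.letter r l *ᵥ v) 1

open Matrix in
@[simp] theorem wordVec_cons (r : Fin M.nC → R) (l : Option (Fin M.nA)) (w) :
    M.wordVec r (l :: w) = M.letter r l *ᵥ M.wordVec r w := rfl

@[simp] theorem wordVec_nil (r : Fin M.nC → R) : M.wordVec r [] = 1 := rfl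

open Matrix in
theorem jump_mulVec (a : Fin M.nA) (y : M.Cfg → R) (s : M.Cfg) :
    (M.jump R a *ᵥ y) s = match (M.enabled s).head? with
      | none => 0
      | some e => if e.act = a then y (M.next e s) else 0 := by
  simp only [mulVec, dotProduct, jump]
  cases (M.enabled s).head? with
  | none => simp
  | some e => by_cases h : e.act = a <;> simp [h]

/-- The program recognises the expiry of a single clock by inclusion and cardinality; this
identifies the test with the removal of one element. -/
theorem subset_card_iff {ι : Type*} [DecidableEq ι] {K L : Finset ι} :
    (L ⊆ K ∧ K.card = L.card + 1) ↔ ∃ c ∈ K, K.erase c = L := by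
  constructor
  · rintro ⟨h, hc⟩
    obtain ⟨c, hc1⟩ := Finset.card_eq_one.1 (by
      rw [Finset.card_sdiff_of_subset h]; omega : (K \ L).card = 1)
    have hcK : c ∈ K \ L := by rw [hc1]; simp
    refine ⟨c, (Finset.mem_sdiff.1 hcK).1, ?_⟩
    rw [← Finset.sdiff_singleton_eq_erase, ← hc1]
    exact Finset.sdiff_sdiff_eq_self h
  · rintro ⟨c, hc, rfl⟩
    exact ⟨Finset.erase_subset _ _, (Finset.card_erase_add_one hc).symm⟩

-- The form of the generator that probability uses: each running clock `c` expires at rate `r c`.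
-- The matrix entry, a difference of two total rates, is the rate of the one clock that has been
-- removed.
open Matrix in
theorem gen_mulVec (r : Fin M.nC → R) (y : M.Cfg → R) (s : M.Cfg) :
    (M.gen r *ᵥ y) s = if M.enabled s = [] then
      ∑ c ∈ s.2, r c * (y (s.1, s.2.erase c) - y s) else 0 := by
  obtain ⟨q, K⟩ := s
  by_cases hs : M.enabled (q, K) = []
  swap
  · simp [mulVec, dotProduct, gen, hs]
  rw [if_pos hs]
  have h1 : (M.gen r *ᵥ y) (q, K) = ∑ L : Finset (Fin M.nC), (if K = L then -∑ c ∈ K, r c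
      else if L ⊆ K ∧ K.card = L.card + 1 then ∑ c ∈ K, r c - ∑ c ∈ L, r c else 0) * y (q, L) := by
    simp only [mulVec, dotProduct, gen, hs, true_and]
    rw [Fintype.sum_prod_type, Finset.sum_eq_single q]
    · simp
    · intro q' _ hq
      refine Finset.sum_eq_zero fun L _ => ?_
      rw [if_neg (fun h => hq h.symm), zero_mul]
    · simp
  -- The row is split into its diagonal entry and the entries at the sets `K.erase c`; `K` is not
  -- among the latter.
  have h2 : ∀ L : Finset (Fin M.nC), (if K = L then -∑ c ∈ K, r c
      else if L ⊆ K ∧ K.card = L.card + 1 then ∑ c ∈ K, r c - ∑ c ∈ L, r c else 0) * y (q, L) =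
      (if L = K then -((∑ c ∈ K, r c) * y (q, K)) else 0) +
        (if L ∈ K.image K.erase then (∑ c ∈ K, r c - ∑ c ∈ L, r c) * y (q, L) else 0) := by
    intro L
    by_cases hL : K = L
    · subst hL
      have : K ∉ K.image K.erase := by
        simp only [Finset.mem_image, not_exists, not_and]
        intro c hc h
        exact Finset.notMem_erase c K (h.symm ▸ hc)
      rw [if_pos rfl, if_pos rfl, if_neg this]
      ring
    · rw [if_neg hL, if_neg (Ne.symm hL)]
      simp only [subset_card_iff, Finset.mem_image]
      split_ifs <;> ring
  rw [h1, Finset.sum_congr rfl fun L _ => h2 L, Finset.sum_add_distrib, Finset.sum_ite_eq']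
  rw [Finset.sum_ite_mem, Finset.univ_inter, Finset.sum_image fun c hc d hd h =>
    Finset.erase_injOn K hc hd h]
  have h3 : ∀ c ∈ K, (∑ d ∈ K, r d - ∑ d ∈ K.erase c, r d) * y (q, K.erase c) =
      r c * y (q, K.erase c) := fun c hc => by
    rw [← Finset.add_sum_erase K r hc]; ring
  rw [Finset.sum_congr rfl h3, if_pos (Finset.mem_univ _), Finset.sum_mul]
  simp only [mul_sub, Finset.sum_sub_distrib]
  ring

-- The generator is homogeneous of degree one in the rates and the matrices of the actions do not
-- depend on them. Hence scaling all rates changes the value of a word by a power that depends on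
-- the word only, and integer rates suffice for the decision.
open Matrix in
theorem wordVec_smul {R S : Type*} [CommRing R] [CommRing S] (f : R →+* S) (D : S)
    (r : Fin M.nC → R) (r' : Fin M.nC → S) (h : ∀ c, f (r c) = D * r' c)
    (w : List (Option (Fin M.nA))) (s : M.Cfg) :
    f (M.wordVec r w s) = D ^ w.count none * M.wordVec r' w s := by
  induction w generalizing s with
  | nil => simp
  | cons l w ih =>
    rw [wordVec_cons, wordVec_cons]
    cases l with
    | none =>
      simp only [letter, gen_mulVec, List.count_cons_self]
      split_ifs
      · rw [map_sum, Finset.mul_sum]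
        refine Finset.sum_congr rfl fun c _ => ?_
        rw [map_mul, map_sub, ih, ih, h]
        ring
      · simp
    | some a =>
      simp only [letter, jump_mulVec]
      cases (M.enabled s).head? with
      | none => simp
      | some e =>
        by_cases ha : e.act = a <;> simp [ha, ih]

/-- The words of length `n` over a list of letters. -/
def words {α : Type*} (ls : List α) : ℕ → List (List α)
  | 0 => [[]]
  | n + 1 => ls.flatMap fun l => (words ls n).map (l :: ·)

theorem mem_words {α : Type*} {ls : List α} {w : List α} (h : ∀ l ∈ w, l ∈ ls) :
    w ∈ words ls w.length := by
  induction w with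
  | nil => simp [words]
  | cons l w ih =>
    simp only [words, List.length_cons, List.mem_flatMap, List.mem_map]
    exact ⟨l, h l List.mem_cons_self, w, ih fun l' h' => h l' (List.mem_cons_of_mem _ h'), rfl⟩

/-- The letters with an effect. -/
def letters : List (Option (Fin M.nA)) := none :: M.edges.map fun e => some e.act

/-- The sum of the tensor squares of the letters. -/
def square (r : Fin M.nC → R) : Matrix (M.Cfg × M.Cfg) (M.Cfg × M.Cfg) R := fun p p' =>
  (M.letters.map fun l => M.letter r l p.1 p'.1 * M.letter r l p.2 p'.2).sum

theorem list_sum_comm {ι α : Type*} {R : Type*} [AddCommMonoid R] [Fintype ι] (l : List α)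
    (f : ι → α → R) : ∑ i, (l.map (f i)).sum = (l.map fun x => ∑ i, f i x).sum := by
  induction l with
  | nil => simp
  | cons x l ih => simp [Finset.sum_add_distrib, ih]

-- Tensor squares multiply factor by factor, so expanding the power of the sum gives one tensor
-- square for each word of length `n`.
open Matrix in
theorem square_pow_mulVec (r : Fin M.nC → R) (n : ℕ) (p : M.Cfg × M.Cfg) :
    ((M.square r ^ n) *ᵥ 1) p =
      ((words M.letters n).map fun w => M.wordVec r w p.1 * M.wordVec r w p.2).sum := by
  induction n generalizing p with
  | zero => simp [words]
  | succ n ih =>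
    rw [pow_succ', ← mulVec_mulVec]
    simp only [mulVec, dotProduct] at ih ⊢
    rw [Finset.sum_congr rfl fun p' _ => by rw [ih p']]
    simp only [square, ← List.sum_map_mul_right]
    rw [list_sum_comm]
    simp only [words, List.map_flatMap, List.map_map]
    rw [List.flatMap_def, List.sum_flatten, List.map_map]
    refine congrArg List.sum (List.map_congr_left fun l _ => ?_)
    simp only [Function.comp_def, wordVec_cons, ← List.sum_map_mul_left]
    rw [list_sum_comm]
    refine congrArg List.sum (List.map_congr_left fun w _ => ?_)
    simp only [mulVec, dotProduct]
    rw [Finset.sum_mul_sum, Fintype.sum_prod_type]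
    refine Finset.sum_congr rfl fun u _ => Finset.sum_congr rfl fun v _ => ?_
    ring

/-- An action that labels no edge has the zero matrix. So the alphabet can be read off the list of
edges, whereas the number of actions, given in binary, may be exponential in the size of the input.
-/
theorem wordVec_eq_zero_or (r : Fin M.nC → R) (w : List (Option (Fin M.nA))) :
    (∀ l ∈ w, l ∈ M.letters) ∨ M.wordVec r w = 0 := by
  induction w with
  | nil => simp
  | cons l w ih =>
    rcases ih with ih | ih
    swap
    · right; simp [ih]
    by_cases hl : l ∈ M.letters
    · left; simpa [hl] using ih
    right
    cases l with
    | none => simp [letters] at hl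
    | some a =>
      funext s
      rw [wordVec_cons, letter, jump_mulVec]
      cases hs : (M.enabled s).head? with
      | none => rfl
      | some e =>
        have he : e ∈ M.edges := List.mem_of_mem_filter (List.mem_of_mem_head? hs)
        have : e.act ≠ a := by
          rintro rfl
          exact hl (List.mem_cons_of_mem _ (List.mem_map_of_mem he))
        simp [this]

/-- By Cayley-Hamilton, every power of `W` is a combination of the powers below the dimension. -/
theorem dotProduct_pow_eq_zero {ι : Type*} [Fintype ι] [DecidableEq ι] {R : Type*} [CommRing R]
    [Nontrivial R] (W : Matrix ι ι R) (v c : ι → R)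
    (h : ∀ n < Fintype.card ι, c ⬝ᵥ (W ^ n).mulVec v = 0) (n : ℕ) :
    c ⬝ᵥ (W ^ n).mulVec v = 0 := by
  rw [W.pow_eq_aeval_mod_charpoly n]
  set p := Polynomial.X ^ n %ₘ W.charpoly with hp
  have hdeg : p.degree < W.charpoly.degree :=
    Polynomial.degree_modByMonic_lt _ W.charpoly_monic
  rw [Matrix.charpoly_degree_eq_dim] at hdeg
  rw [Polynomial.aeval_eq_sum_range' (n := p.natDegree + 1) (by omega), Matrix.sum_mulVec,
    dotProduct_sum]
  refine Finset.sum_eq_zero fun i hi => ?_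
  by_cases h0 : p.coeff i = 0
  · simp [h0]
  · rw [Matrix.smul_mulVec, dotProduct_smul, h i, smul_zero]
    exact_mod_cast (Polynomial.le_degree_of_ne_zero h0).trans_lt hdeg

theorem list_sum_sq_eq_zero {α : Type*} {l : List α} {f : α → ℤ}
    (h : (l.map fun x => f x ^ 2).sum = 0) : ∀ x ∈ l, f x = 0 := by
  induction l with
  | nil => simp
  | cons x l ih =>
    have h1 : 0 ≤ (l.map fun x => f x ^ 2).sum :=
      List.sum_nonneg (by simp only [List.mem_map]; rintro _ ⟨y, -, rfl⟩; positivity)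
    simp only [List.map_cons, List.sum_cons] at h
    have h2 : f x ^ 2 = 0 := by nlinarith [sq_nonneg (f x)]
    intro y hy
    rcases List.mem_cons.1 hy with rfl | hy
    · exact pow_eq_zero_iff (two_ne_zero) |>.1 h2
    · exact ih (by nlinarith [sq_nonneg (f x)]) y hy

open Matrix in
/-- Two configurations are equivalent if and only if finitely many iterates of the square matrix
are orthogonal to the square of the difference of the point masses. -/
theorem wordVec_eq_iff (r : Fin M.nC → ℤ) (s₁ s₂ : M.Cfg) :
    (∀ w, M.wordVec r w s₁ = M.wordVec r w s₂) ↔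
      ∀ n < Fintype.card (M.Cfg × M.Cfg),
        (fun p : M.Cfg × M.Cfg => ((if p.1 = s₁ then (1 : ℤ) else 0) - if p.1 = s₂ then 1 else 0) *
          ((if p.2 = s₁ then 1 else 0) - if p.2 = s₂ then 1 else 0)) ⬝ᵥ
            ((M.square r ^ n) *ᵥ 1) = 0 := by
  -- The tensor squares turn the test into a sum of squares. Over the integers nothing cancels in
  -- it, so a single number checks all words of length `n` at once.
  have key : ∀ n, (fun p : M.Cfg × M.Cfg =>
        ((if p.1 = s₁ then (1 : ℤ) else 0) - if p.1 = s₂ then 1 else 0) *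
          ((if p.2 = s₁ then 1 else 0) - if p.2 = s₂ then 1 else 0)) ⬝ᵥ
            ((M.square r ^ n) *ᵥ 1) =
      ((words M.letters n).map fun w => (M.wordVec r w s₁ - M.wordVec r w s₂) ^ 2).sum := by
    intro n
    simp only [dotProduct, square_pow_mulVec, ← List.sum_map_mul_left]
    rw [list_sum_comm]
    refine congrArg List.sum (List.map_congr_left fun w _ => ?_)
    have h1 : ∑ s : M.Cfg, ((if s = s₁ then (1 : ℤ) else 0) - if s = s₂ then 1 else 0) *
        M.wordVec r w s = M.wordVec r w s₁ - M.wordVec r w s₂ := by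
      simp [sub_mul, Finset.sum_sub_distrib]
    rw [← h1, sq, Finset.sum_mul_sum, Fintype.sum_prod_type]
    refine Finset.sum_congr rfl fun u _ => Finset.sum_congr rfl fun v _ => ?_
    ring
  constructor
  · intro h n _
    rw [key]
    simp [h]
  · intro h w
    have h1 := dotProduct_pow_eq_zero _ _ _ h w.length
    rw [key] at h1
    rcases M.wordVec_eq_zero_or r w with hw | hw
    · exact sub_eq_zero.1 (list_sum_sq_eq_zero h1 w (mem_words hw))
    · simp [hw]

end Ring

end ExpAutomaton
end DistBisim

/-! ### Correctness of the program: lists of truth values against finite sets, lists against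
matrices -/

namespace DistBisim
open Enc (enc)

/-- The list of indicator values of a set. -/
def bitList {n : ℕ} (K : Finset (Fin n)) : List Bool := List.ofFn fun c => decide (c ∈ K)

theorem zip_ofFn {α β : Type*} {n : ℕ} (f : Fin n → α) (g : Fin n → β) :
    (List.ofFn f).zip (List.ofFn g) = List.ofFn fun i => (f i, g i) := by
  apply List.ext_getElem
  · simp
  · intro i h1 h2
    simp

theorem subset_bitList {n : ℕ} (K L : Finset (Fin n)) :
    Raw.subset (bitList K) (bitList L) = decide (K ⊆ L) := by
  rw [Bool.eq_iff_iff]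
  simp only [Raw.subset, bitList, zip_ofFn, List.all_eq_true, List.mem_ofFn, decide_eq_true_eq]
  constructor
  · intro h c hc
    simpa [hc] using h _ ⟨c, rfl⟩
  · rintro h _ ⟨c, rfl⟩
    by_cases hc : c ∈ K
    · simp [h hc]
    · simp [hc]

theorem disjoint_bitList {n : ℕ} (K L : Finset (Fin n)) :
    Raw.disjoint (bitList K) (bitList L) = decide (Disjoint K L) := by
  rw [Bool.eq_iff_iff]
  simp only [Raw.disjoint, bitList, zip_ofFn, List.all_eq_true, List.mem_ofFn, decide_eq_true_eq,
    Finset.disjoint_left]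
  constructor
  · intro h c hc
    simpa [hc] using h _ ⟨c, rfl⟩
  · rintro h _ ⟨c, rfl⟩
    by_cases hc : c ∈ K
    · simp [h hc]
    · simp [hc]

theorem union_bitList {n : ℕ} (K L : Finset (Fin n)) :
    Raw.union (bitList K) (bitList L) = bitList (K ∪ L) := by
  simp only [Raw.union, bitList, zip_ofFn, List.map_ofFn]
  congr 1
  funext c
  simp

theorem total_bitList {n : ℕ} (K : Finset (Fin n)) (r : Fin n → ℤ) :
    Raw.total (bitList K) (List.ofFn r) = ∑ c ∈ K, r c := by
  simp only [Raw.total, bitList, zip_ofFn, List.map_ofFn, List.sum_ofFn]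
  simp [Finset.sum_ite_mem]

theorem card_bitList {n : ℕ} (K : Finset (Fin n)) : Raw.card (bitList K) = K.card := by
  simp only [Raw.card, bitList, List.map_ofFn, List.sum_ofFn]
  simp [Finset.sum_ite_mem]

theorem eq_bitList {n : ℕ} (K L : Finset (Fin n)) :
    (Raw.subset (bitList K) (bitList L) && Raw.subset (bitList L) (bitList K)) = decide (K = L) := by
  rw [subset_bitList, subset_bitList, ← Bool.decide_and]
  exact decide_eq_decide.2 Finset.Subset.antisymm_iff.symm

theorem mem_bitLists {n : ℕ} {l : List Bool} : l ∈ Raw.bitLists n ↔ l.length = n := by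
  induction n generalizing l with
  | zero => simp [Raw.bitLists]
  | succ n ih =>
    simp only [Raw.bitLists, List.mem_append, List.mem_map, ih]
    constructor
    · rintro (⟨l, rfl, rfl⟩ | ⟨l, rfl, rfl⟩) <;> rfl
    · intro h
      cases l with
      | nil => simp at h
      | cons b l =>
        have hl : l.length = n := by simpa using h
        cases b
        · exact Or.inl ⟨l, hl, rfl⟩
        · exact Or.inr ⟨l, hl, rfl⟩

theorem nodup_bitLists (n : ℕ) : (Raw.bitLists n).Nodup := by
  induction n with
  | zero => simp [Raw.bitLists]
  | succ n ih =>
    refine List.Nodup.append (ih.map fun a b h => (List.cons.inj h).2)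
      (ih.map fun a b h => (List.cons.inj h).2) fun x h1 h2 => ?_
    obtain ⟨_, -, rfl⟩ := List.mem_map.1 h1
    obtain ⟨_, -, h⟩ := List.mem_map.1 h2
    simp at h

/-- The program enumerates the sets of clocks exactly once each. This lets its sums over lists be
read as sums over a finite type. -/
theorem exists_list_finset (n : ℕ) : ∃ l : List (Finset (Fin n)), l.Nodup ∧ (∀ K, K ∈ l) ∧
    l.map bitList = Raw.bitLists n := by
  have h1 : ∀ K : Finset (Fin n),
      (Finset.univ.filter fun c : Fin n => (bitList K)[(c : ℕ)]? = some true) = K := by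
    intro K; ext c; simp [bitList]
  have h2 : ((Raw.bitLists n).map fun l =>
      Finset.univ.filter fun c : Fin n => l[(c : ℕ)]? = some true).map bitList =
        Raw.bitLists n := by
    rw [List.map_map]
    conv_rhs => rw [← List.map_id (Raw.bitLists n)]
    refine List.map_congr_left fun l hl => ?_
    have hl' := mem_bitLists.1 hl
    apply List.ext_getElem
    · simp [bitList, hl']
    · intro i hi1 hi2
      have hi : i < l.length := hi2
      simp only [bitList, Function.comp, List.getElem_ofFn, Finset.mem_filter, Finset.mem_univ,
        true_and, List.getElem?_eq_getElem hi, Option.some.injEq, Bool.decide_eq_true]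
      rfl
  refine ⟨_, .of_map bitList ?_, fun K => ?_, h2⟩
  · rw [h2]; exact nodup_bitLists n
  · exact List.mem_map.2 ⟨bitList K, mem_bitLists.2 (by simp [bitList]), h1 K⟩

theorem iter_snd {δ : Type} (rows : List (List ℤ)) (c z : List ℤ) (l : List δ) :
    (Raw.iter rows c l z).1 = (fun z => rows.map fun row => Raw.dot row z)^[l.length] z ∧
    ((Raw.iter rows c l z).2 = true ↔ ∀ n < l.length,
      Raw.dot c ((fun z => rows.map fun row => Raw.dot row z)^[n] z) = 0) := by
  induction l using List.reverseRecOn with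
  | nil => simp [Raw.iter]
  | append_singleton l x ih =>
    have : Raw.iter rows c (l ++ [x]) z = ((rows.map fun row => Raw.dot row (Raw.iter rows c l z).1),
      ((Raw.iter rows c l z).2 && decide (Raw.dot c (Raw.iter rows c l z).1 = 0))) := by
      unfold Raw.iter
      rw [List.foldl_append]
      rfl
    rw [this, List.length_append, List.length_singleton, Function.iterate_succ_apply', ih.1]
    refine ⟨rfl, ?_⟩
    rw [Bool.and_eq_true, ih.2, decide_eq_true_eq, Nat.forall_lt_succ_right]

theorem dot_map {ι : Type*} (l : List ι) (f g : ι → ℤ) :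
    Raw.dot (l.map f) (l.map g) = (l.map fun i => f i * g i).sum := by
  simp [Raw.dot, List.zip_map', Function.comp_def]

theorem sum_map_eq {ι : Type*} [Fintype ι] [DecidableEq ι] {l : List ι} (hl : l.Nodup)
    (hl' : ∀ i, i ∈ l) (f : ι → ℤ) : (l.map f).sum = ∑ i, f i := by
  rw [← List.sum_toFinset f hl]
  congr 1
  ext i; simp [hl']

open Matrix in
theorem iterate_map_dot {ι : Type*} [Fintype ι] [DecidableEq ι] {l : List ι} (hl : l.Nodup)
    (hl' : ∀ i, i ∈ l) (W : Matrix ι ι ℤ) (n : ℕ) :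
    (fun z => (l.map fun i => l.map (W i)).map fun row => Raw.dot row z)^[n] (l.map fun _ => 1) =
      l.map ((W ^ n) *ᵥ 1) := by
  induction n with
  | zero => rw [pow_zero, one_mulVec]; rfl
  | succ n ih =>
    rw [Function.iterate_succ_apply', ih, List.map_map, pow_succ', ← mulVec_mulVec]
    refine List.map_congr_left fun i _ => ?_
    simp only [Function.comp, dot_map]
    rw [sum_map_eq hl hl']
    rfl

namespace ExpAutomaton
variable (M : ExpAutomaton)

/-- The encoding of an edge before the encoding of its components. -/
def rawEdge (e : Edge (Fin M.nQ) (Fin M.nC) (Fin M.nA)) : ℤ × ℤ × List Bool × ℤ × ℤ :=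
  (((e.src : ℕ) : ℤ), ((e.act : ℕ) : ℤ), bitList e.guard, ((e.tgt : ℕ) : ℤ), 0)

/-- The input before the encoding of its components. -/
def rawInput (q₁ q₂ : Fin M.nQ) : Raw.Input :=
  ((M.nQ, M.nC, M.nA, M.edges.map M.rawEdge, List.ofFn fun q => bitList (M.κ q),
    List.ofFn fun c => ((M.rate c).num, ((M.rate c).den : ℤ)), 0), ((q₁ : ℕ) : ℤ), ((q₂ : ℕ) : ℤ), 0)

theorem encodeClocks_eq {k : ℕ} (X : Finset (Fin k)) : encodeClocks X = enc (bitList X) := by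
  simp only [encodeClocks, enc, bitList, List.map_ofFn]
  congr 2
  funext c
  by_cases h : c ∈ X <;> simp [Val.ofProp, h]

/-- A list of fixed length is encoded as a nested pair that ends in `num 0`; this explains the
trailing zeros in `rawInput` and `rawEdge`. -/
theorem encodeInput_eq (q₁ q₂ : Fin M.nQ) : M.encodeInput q₁ q₂ = enc (M.rawInput q₁ q₂) := by
  have h1 : M.edges.map M.encodeEdge = (M.edges.map M.rawEdge).map enc := by
    rw [List.map_map]
    refine List.map_congr_left fun e _ => ?_
    simp only [encodeEdge, encodeClocks_eq, Function.comp]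
    rfl
  have h2 : (List.ofFn fun q => encodeClocks (M.κ q)) =
      (List.ofFn fun q => bitList (M.κ q)).map enc := by
    rw [List.map_ofFn]
    congr 1
    funext q
    exact encodeClocks_eq _
  have h3 : (List.ofFn fun c => encodeRat (M.rate c)) =
      (List.ofFn fun c => ((M.rate c).num, ((M.rate c).den : ℤ))).map enc := by
    rw [List.map_ofFn]
    rfl
  simp only [encodeInput, encode, h1, h2, h3]
  rfl

/-- A configuration before its encoding. -/
def rawCfg (s : M.Cfg) : Raw.Cfg := (((s.1 : ℕ) : ℤ), bitList s.2)

/-- An edge with the clocks that its target sets. -/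
def fullEdge (e : Edge (Fin M.nQ) (Fin M.nC) (Fin M.nA)) : Raw.Edge :=
  (((e.src : ℕ) : ℤ), ((e.act : ℕ) : ℤ), bitList e.guard, ((e.tgt : ℕ) : ℤ), bitList (M.κ e.tgt))

theorem lookup_locs (q : Fin M.nQ) :
    Raw.lookup (Raw.locs (List.ofFn fun q => bitList (M.κ q))) q = bitList (M.κ q) := by
  have h1 : Raw.locs (List.ofFn fun q => bitList (M.κ q)) =
      (List.finRange M.nQ).map fun q : Fin M.nQ => (((q : ℕ) : ℤ), bitList (M.κ q)) := by
    rw [Raw.locs, indices_eq, List.length_ofFn, ← List.ofFn_id, List.map_ofFn]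
    have : (List.range M.nQ).map (fun n : ℕ => (n : ℤ)) =
        List.ofFn fun q : Fin M.nQ => ((q : ℕ) : ℤ) := by
      apply List.ext_getElem <;> simp
    rw [this, zip_ofFn]
    rfl
  rw [Raw.lookup, h1, List.filter_map, List.map_map]
  have h2 : (List.finRange M.nQ).filter ((fun p : ℤ × List Bool => decide (p.1 = ((q : ℕ) : ℤ))) ∘
      fun q : Fin M.nQ => (((q : ℕ) : ℤ), bitList (M.κ q))) = [q] := by
    have : ((fun p : ℤ × List Bool => decide (p.1 = ((q : ℕ) : ℤ))) ∘
      fun q : Fin M.nQ => (((q : ℕ) : ℤ), bitList (M.κ q))) = fun q' => q' == q := by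
      funext q'
      simp [Fin.ext_iff, beq_eq_decide]
    rw [this, List.filter_beq]
    have : List.count q (List.finRange M.nQ) = 1 :=
      List.count_eq_one_of_mem (List.nodup_finRange _) (List.mem_finRange q)
    rw [this, List.replicate_one]
  rw [h2]
  rfl

theorem fullEdges_eq (q₁ q₂ : Fin M.nQ) :
    Raw.fullEdges (M.rawInput q₁ q₂) = M.edges.map M.fullEdge := by
  rw [Raw.fullEdges]
  change (M.edges.map M.rawEdge).map _ = _
  rw [List.map_map]
  refine List.map_congr_left fun e _ => ?_
  have := M.lookup_locs e.tgt
  simp only [Function.comp, rawEdge, fullEdge]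
  rw [← this]
  rfl

theorem enabled_eq (s : M.Cfg) :
    Raw.enabled (M.edges.map M.fullEdge) (M.rawCfg s) = (M.enabled s).map M.fullEdge := by
  rw [Raw.enabled, List.filter_map, enabled]
  congr 1
  refine List.filter_congr fun e _ => ?_
  simp only [Function.comp, fullEdge, rawCfg, disjoint_bitList, Bool.decide_and]
  congr 1
  simp [Fin.ext_iff]

theorem gen_eq (r : Fin M.nC → ℤ) (s u : M.Cfg) :
    Raw.gen (M.edges.map M.fullEdge) (List.ofFn r) (M.rawCfg s) (M.rawCfg u) = M.gen r s u := by
  rw [Raw.gen, enabled_eq, gen]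
  have h1 : (((M.enabled s).map M.fullEdge).isEmpty && decide ((M.rawCfg s).1 = (M.rawCfg u).1)) =
      decide (M.enabled s = [] ∧ s.1 = u.1) := by
    rw [Bool.decide_and]
    congr 1
    · cases M.enabled s <;> simp
    · simp [rawCfg, Fin.ext_iff]
  rw [h1]
  simp only [rawCfg, decide_eq_true_eq, total_bitList, card_bitList, subset_bitList,
    Bool.and_eq_true, ← Finset.Subset.antisymm_iff]
  norm_cast

theorem jump_eq (a : Fin M.nA) (s u : M.Cfg) :
    Raw.jump (M.edges.map M.fullEdge) ((a : ℕ) : ℤ) (M.rawCfg s) (M.rawCfg u) = M.jump ℤ a s u := by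
  rw [Raw.jump, enabled_eq, jump]
  cases M.enabled s with
  | nil => rfl
  | cons e l =>
    simp only [List.map_cons, List.isEmpty_cons, List.headD_cons, List.head?_cons, fullEdge, rawCfg,
      union_bitList, eq_bitList]
    rw [if_neg (by simp)]
    congr 1
    simp only [Bool.and_eq_true, decide_eq_true_eq, next, Prod.ext_iff, Fin.ext_iff,
      Nat.cast_inj]

theorem entry_eq (r : Fin M.nC → ℤ) (p p' : M.Cfg × M.Cfg) :
    Raw.entry (M.edges.map M.fullEdge) (List.ofFn r) (M.rawCfg p.1, M.rawCfg p.2)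
      (M.rawCfg p'.1, M.rawCfg p'.2) = M.square r p p' := by
  simp only [Raw.entry, square, letters, List.map_cons, List.map_map, List.sum_cons, gen_eq, letter]
  congr 2
  refine List.map_congr_left fun e _ => ?_
  simp only [Function.comp]
  rw [← jump_eq, ← jump_eq]
  rfl

/-- The rates, multiplied by the product of the denominators. -/
def intRate (c : Fin M.nC) : ℤ :=
  (M.rate c).num * ((∏ d, ((M.rate d).den : ℤ)) / (M.rate c).den)

theorem intRates_eq (q₁ q₂ : Fin M.nQ) :
    Raw.intRates (M.rawInput q₁ q₂).rates = List.ofFn M.intRate := by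
  change Raw.intRates (List.ofFn fun c => ((M.rate c).num, ((M.rate c).den : ℤ))) = _
  rw [Raw.intRates, List.map_ofFn, List.map_ofFn, List.prod_ofFn]
  rfl

theorem intRate_cast (c : Fin M.nC) :
    ((M.intRate c : ℤ) : ℝ) = (∏ d, ((M.rate d).den : ℝ)) * (M.rate c : ℝ) := by
  -- The integer division in `intRate` is exact.
  have h1 : ((M.rate c).den : ℤ) ∣ ∏ d, ((M.rate d).den : ℤ) :=
    Finset.dvd_prod_of_mem _ (Finset.mem_univ c)
  have h2 : ((M.rate c).den : ℝ) ≠ 0 := by exact_mod_cast (M.rate c).den_nz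
  rw [intRate, Int.cast_mul, Int.cast_div h1 (by exact_mod_cast h2), Rat.cast_def]
  push_cast
  field_simp

theorem diff_eq (s₁ s₂ s : M.Cfg) : Raw.diff (M.rawCfg s₁) (M.rawCfg s₂) (M.rawCfg s) =
    (if s = s₁ then 1 else 0) - if s = s₂ then 1 else 0 := by
  simp only [Raw.diff, rawCfg, eq_bitList, Prod.ext_iff, Fin.ext_iff, Bool.and_eq_true,
    decide_eq_true_eq, Nat.cast_inj]

/-- The configuration in which a location is started. -/
def start (q : Fin M.nQ) : M.Cfg := (q, M.κ q)

theorem start_eq (q₁ q₂ q : Fin M.nQ) : Raw.start (M.rawInput q₁ q₂) q = M.rawCfg (M.start q) := by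
  have := M.lookup_locs q
  simp only [Raw.start, rawCfg, start]
  rw [← this]
  rfl

theorem exists_cfgs (q₁ q₂ : Fin M.nQ) : ∃ l : List M.Cfg, l.Nodup ∧ (∀ s, s ∈ l) ∧
    Raw.cfgs (M.rawInput q₁ q₂) (Raw.bitLists M.nC) = l.map M.rawCfg := by
  obtain ⟨L, hL1, hL2, hL3⟩ := exists_list_finset M.nC
  refine ⟨(List.finRange M.nQ).product L, (List.nodup_finRange _).product hL1,
    fun s => List.mem_product.2 ⟨List.mem_finRange _, hL2 _⟩, ?_⟩
  have h1 : Raw.indices (M.rawInput q₁ q₂).resets =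
      (List.finRange M.nQ).map fun q : Fin M.nQ => ((q : ℕ) : ℤ) := by
    change Raw.indices (List.ofFn fun q => bitList (M.κ q)) = _
    rw [indices_eq, List.length_ofFn]
    apply List.ext_getElem <;> simp
  rw [Raw.cfgs, h1, ← hL3]
  simp only [List.product, List.map_flatMap, List.flatMap_map, List.map_map]
  rfl

/-- Real and integral rates give equivalent conditions, since the scaling factors of `wordVec_smul`
do not vanish. For integral rates the program evaluates the finite criterion of `wordVec_eq_iff`. -/
theorem decision_iff (q₁ q₂ : Fin M.nQ) :
    Raw.decision (M.rawInput q₁ q₂) (Raw.bitLists (M.rawInput q₁ q₂).rates.length) = true ↔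
      ∀ w, M.wordVec (fun c => (M.rate c : ℝ)) w (M.start q₁) =
        M.wordVec (fun c => (M.rate c : ℝ)) w (M.start q₂) := by
  have hlen : (M.rawInput q₁ q₂).rates.length = M.nC := by
    change (List.ofFn fun c => ((M.rate c).num, ((M.rate c).den : ℤ))).length = _
    simp
  obtain ⟨L, hL1, hL2, hL3⟩ := M.exists_cfgs q₁ q₂
  have hP1 : (L.product L).Nodup := hL1.product hL1
  have hP2 : ∀ p : M.Cfg × M.Cfg, p ∈ L.product L := fun p => List.mem_product.2 ⟨hL2 _, hL2 _⟩
  have hP3 : Raw.pairs (M.rawInput q₁ q₂) (Raw.bitLists M.nC) =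
      (L.product L).map fun p => (M.rawCfg p.1, M.rawCfg p.2) := by
    rw [Raw.pairs, hL3]
    simp only [List.product, List.map_flatMap, List.flatMap_map, List.map_map]
    rfl
  have hint : (∀ w, M.wordVec (fun c => (M.rate c : ℝ)) w (M.start q₁) =
        M.wordVec (fun c => (M.rate c : ℝ)) w (M.start q₂)) ↔
      ∀ w, M.wordVec M.intRate w (M.start q₁) = M.wordVec M.intRate w (M.start q₂) := by
    refine forall_congr' fun w => ?_
    have h := M.wordVec_smul (Int.castRingHom ℝ) (∏ d, ((M.rate d).den : ℝ)) M.intRate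
      (fun c => (M.rate c : ℝ)) M.intRate_cast w
    have hD : (∏ d, ((M.rate d).den : ℝ)) ^ w.count none ≠ 0 :=
      pow_ne_zero _ (Finset.prod_ne_zero_iff.2 fun d _ => by exact_mod_cast (M.rate d).den_nz)
    rw [← mul_right_inj' hD, ← h, ← h]
    simp
  -- The program makes one round for each entry of its list of pairs, so it tests exactly the
  -- exponents below the dimension that Cayley-Hamilton requires.
  have hcard : (L.product L).length = Fintype.card (M.Cfg × M.Cfg) := by
    rw [← List.toFinset_card_of_nodup hP1, ← Finset.card_univ]
    congr 1
    ext p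
    exact iff_of_true (List.mem_toFinset.2 (hP2 p)) (Finset.mem_univ p)
  rw [hint, wordVec_eq_iff, hlen, Raw.decision, hP3, (iter_snd _ _ _ _).2, List.length_map, hcard]
  refine forall_congr' fun n => forall_congr' fun _ => ?_
  rw [fullEdges_eq, intRates_eq]
  change Raw.dot (((L.product L).map _).map fun p : Raw.Cfg × Raw.Cfg =>
    Raw.diff (Raw.start (M.rawInput q₁ q₂) ((q₁ : ℕ) : ℤ))
      (Raw.start (M.rawInput q₁ q₂) ((q₂ : ℕ) : ℤ)) p.1 *
    Raw.diff (Raw.start (M.rawInput q₁ q₂) ((q₁ : ℕ) : ℤ))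
      (Raw.start (M.rawInput q₁ q₂) ((q₂ : ℕ) : ℤ)) p.2) _ = 0 ↔ _
  rw [start_eq, start_eq]
  simp only [List.map_map, Function.comp_def, diff_eq, entry_eq]
  have h := iterate_map_dot hP1 hP2 (M.square M.intRate) n
  simp only [List.map_map, Function.comp_def] at h
  change Raw.dot _ ((fun z => (L.product L).map fun x =>
    Raw.dot ((L.product L).map (M.square M.intRate x)) z)^[n] ((L.product L).map fun _ => 1)) = 0 ↔ _
  rw [h, dot_map, sum_map_eq hP1 hP2]
  rfl

/-- The term `3 * s` comes from `size_encodeInput_le`. Since `3 * s + 2 ^ n + 2 ≤ (3 * s + 3) * 2 ^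
n`, the polynomial and the exponential factor separate. -/
theorem exists_polynomial_bound (k : ℕ) : ∃ b : Polynomial ℕ, ∀ s n : ℕ,
    (3 * s + 2 ^ n + 2) ^ k ≤ b.eval s * 2 ^ (k * n) := by
  refine ⟨(3 * Polynomial.X + 3) ^ k, fun s n => ?_⟩
  rw [mul_comm k n, pow_mul, Polynomial.eval_pow, ← mul_pow]
  refine Nat.pow_le_pow_left ?_ k
  simp only [Polynomial.eval_add, Polynomial.eval_mul, Polynomial.eval_X, Polynomial.eval_ofNat]
  have : 1 ≤ 2 ^ n := Nat.one_le_two_pow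
  nlinarith

theorem bits_le_size (q : Fin M.nQ) : 1 + Val.bits ((q : ℕ) : ℤ) + 3 ≤ M.size := by
  have h : Val.bits ((q : ℕ) : ℤ) ≤ Val.bits (M.nQ : ℤ) := by
    simp only [Val.bits, Int.natAbs_natCast]
    exact Nat.size_le_size q.2.le
  simp only [size, encode, Val.ofList, Val.size, Val.ofNat]
  omega

theorem size_encodeInput_le (q₁ q₂ : Fin M.nQ) : (M.encodeInput q₁ q₂).size ≤ 3 * M.size := by
  have h1 := M.bits_le_size q₁
  have h2 := M.bits_le_size q₂
  rw [size] at h1 h2 ⊢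
  simp only [encodeInput, Val.ofList, Val.size, Val.ofNat]
  have : Val.bits 0 = 0 := rfl
  omega

theorem length_rates_rawInput (q₁ q₂ : Fin M.nQ) : (M.rawInput q₁ q₂).rates.length = M.nC := by
  change (List.ofFn fun c => ((M.rate c).num, ((M.rate c).den : ℤ))).length = _
  simp

end ExpAutomaton
end DistBisim

namespace DistBisim

/-! ### Exponential distributions -/

theorem expMeasure_eq (r : ℝ) : expMeasure r = volume.withDensity (exponentialPDF r) := rfl

theorem measurable_exponentialPDF (r : ℝ) : Measurable (exponentialPDF r) :=
  (measurable_exponentialPDFReal r).ennreal_ofReal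

theorem expMeasure_singleton (r x : ℝ) : expMeasure r {x} = 0 := by
  rw [expMeasure_eq]
  exact (withDensity_absolutelyContinuous _ _) (by simp)

theorem expMeasure_ae_pos (r : ℝ) : ∀ᵐ x ∂expMeasure r, 0 < x := by
  have h1 : expMeasure r (Set.Iio 0) = 0 := by
    rw [expMeasure_eq, withDensity_apply _ measurableSet_Iio]
    exact lintegral_exponentialPDF_of_nonpos le_rfl
  have h2 := measure_union_null h1 (expMeasure_singleton r 0)
  rw [ae_iff]
  refine measure_mono_null (fun x hx => ?_) h2
  simpa [le_iff_lt_or_eq] using hx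

/-- The exponential distribution has no memory. -/
theorem expMeasure_restrict_Ici (r : ℝ) {t : ℝ} (ht : 0 ≤ t) :
    (expMeasure r).restrict (Set.Ici t) =
      ENNReal.ofReal (Real.exp (-(r * t))) • (expMeasure r).map (· + t) := by
  ext X hX
  have hm : Measurable fun x : ℝ => x + t := measurable_add_const t
  rw [Measure.restrict_apply hX, Measure.smul_apply, Measure.map_apply hm hX, expMeasure_eq,
    withDensity_apply _ (hX.inter measurableSet_Ici), withDensity_apply _ (hm hX),
    ← lintegral_indicator (hX.inter measurableSet_Ici), ← lintegral_indicator (hm hX),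
    ← lintegral_add_right_eq_self _ t, smul_eq_mul,
    ← lintegral_const_mul _ ((measurable_exponentialPDF r).indicator (hm hX))]
  refine lintegral_congr fun x => ?_
  by_cases hx : x + t ∈ X
  swap
  · rw [Set.indicator_of_notMem (by simp [hx]), Set.indicator_of_notMem (by simpa using hx),
      mul_zero]
  rw [Set.indicator_of_mem (s := (· + t) ⁻¹' X) hx]
  by_cases h0 : 0 ≤ x
  · rw [Set.indicator_of_mem (show x + t ∈ X ∩ Set.Ici t from ⟨hx, by simpa using h0⟩), exponentialPDF_of_nonneg (by linarith),
      exponentialPDF_of_nonneg h0, ← ENNReal.ofReal_mul (Real.exp_pos _).le]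
    congr 1
    rw [mul_left_comm, ← Real.exp_add]
    ring_nf
  · rw [Set.indicator_of_notMem (fun h => h0 (by simpa using h.2)),
      exponentialPDF_of_neg (not_le.1 h0), mul_zero]

theorem expMeasure_restrict_Ioi (r : ℝ) {t : ℝ} (ht : 0 ≤ t) :
    (expMeasure r).restrict (Set.Ioi t) =
      ENNReal.ofReal (Real.exp (-(r * t))) • (expMeasure r).map (· + t) := by
  rw [← expMeasure_restrict_Ici r ht]
  refine Measure.restrict_congr_set ?_
  refine Filter.EventuallyLE.antisymm (Set.Ioi_subset_Ici_self.eventuallyLE) ?_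
  have : ∀ᵐ x ∂expMeasure r, x ≠ t := by
    rw [ae_iff]; simpa using expMeasure_singleton r t
  filter_upwards [this] with x hx hx'
  exact lt_of_le_of_ne hx' (Ne.symm hx)

/-- The Laplace transform `r / (r + w)`, multiplied out: up to this factor, the discounted density
of rate `r` is the density of rate `r + w`. -/
theorem lintegral_exp_expMeasure {r w : ℝ} (hr : 0 < r) (hw : 0 ≤ w) :
    ENNReal.ofReal (r + w) * ∫⁻ t, ENNReal.ofReal (Real.exp (-(w * t))) ∂expMeasure r =
      ENNReal.ofReal r := by
  have hm : Measurable fun t : ℝ => ENNReal.ofReal (Real.exp (-(w * t))) := by fun_prop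
  rw [expMeasure_eq, lintegral_withDensity_eq_lintegral_mul _ (measurable_exponentialPDF r) hm,
    ← lintegral_const_mul _ ((measurable_exponentialPDF r).mul hm)]
  have h : ∀ t, ENNReal.ofReal (r + w) * (exponentialPDF r *
      fun t : ℝ => ENNReal.ofReal (Real.exp (-(w * t)))) t =
      ENNReal.ofReal r * exponentialPDF (r + w) t := by
    intro t
    rw [Pi.mul_apply]
    rcases le_or_gt 0 t with ht | ht
    · rw [exponentialPDF_of_nonneg ht, exponentialPDF_of_nonneg ht,
        ← ENNReal.ofReal_mul (by positivity), ← ENNReal.ofReal_mul (by positivity),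
        ← ENNReal.ofReal_mul hr.le]
      congr 1
      rw [show -((r + w) * t) = -(r * t) + -(w * t) by ring, Real.exp_add]
      ring
    · rw [exponentialPDF_of_neg ht, exponentialPDF_of_neg ht, zero_mul, mul_zero, mul_zero]
  rw [lintegral_congr h, lintegral_const_mul _ (measurable_exponentialPDF _),
    lintegral_exponentialPDF_eq_one (by linarith), mul_one]

/-! ### Products of exponential distributions -/

section Pi
variable {ι : Type*} [DecidableEq ι]

theorem measurable_piecewise_prod (K : Finset ι) :
    Measurable fun p : (ι → ℝ) × (ι → ℝ) => K.piecewise p.1 p.2 := by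
  refine measurable_pi_lambda _ fun c => ?_
  by_cases h : c ∈ K
  · simp only [Finset.piecewise, h, if_true]; fun_prop
  · simp only [Finset.piecewise, h, if_false]; fun_prop

/-- Independence of the coordinates: those in `K` may be taken from one sample and the others from a
second, independent one. -/
theorem map_piecewise_pi [Fintype ι] (ν : ι → Measure ℝ) [∀ c, IsProbabilityMeasure (ν c)] (K : Finset ι) :
    ((Measure.pi ν).prod (Measure.pi ν)).map (fun p => K.piecewise p.1 p.2) = Measure.pi ν := by
  refine (Measure.pi_eq fun B hB => ?_).symm
  rw [Measure.map_apply (measurable_piecewise_prod K) (.univ_pi hB)]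
  have : (fun p : (ι → ℝ) × (ι → ℝ) => K.piecewise p.1 p.2) ⁻¹' (Set.univ.pi B) =
      (Set.univ.pi fun c => if c ∈ K then B c else Set.univ) ×ˢ
        (Set.univ.pi fun c => if c ∈ K then Set.univ else B c) := by
    ext p
    simp only [Set.mem_preimage, Set.mem_pi, Set.mem_univ, true_implies, Set.mem_prod]
    rw [← forall_and]
    refine forall_congr' fun c => ?_
    by_cases h : c ∈ K <;> simp [h]
  rw [this, Measure.prod_prod, Measure.pi_pi, Measure.pi_pi, ← Finset.prod_mul_distrib]
  refine Finset.prod_congr rfl fun c _ => ?_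
  by_cases h : c ∈ K <;> simp [h]

theorem lintegral_piecewise_pi [Fintype ι] (ν : ι → Measure ℝ) [∀ c, IsProbabilityMeasure (ν c)]
    (K : Finset ι) {g : (ι → ℝ) → ℝ≥0∞} (hg : Measurable g) :
    ∫⁻ ζ, g ζ ∂Measure.pi ν =
      ∫⁻ ζ', ∫⁻ ζ, g (K.piecewise ζ' ζ) ∂Measure.pi ν ∂Measure.pi ν := by
  conv_lhs => rw [← map_piecewise_pi ν K]
  rw [lintegral_map hg (measurable_piecewise_prod K),
    lintegral_prod (fun p : (ι → ℝ) × (ι → ℝ) => g (K.piecewise p.1 p.2))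
      (hg.comp (measurable_piecewise_prod K)).aemeasurable]

theorem measurable_update_prod (c : ι) :
    Measurable fun p : ℝ × (ι → ℝ) => Function.update p.2 c p.1 := by
  refine measurable_pi_lambda _ fun d => ?_
  by_cases h : d = c
  · subst h; simpa using measurable_fst
  · simp only [Function.update_of_ne h]; fun_prop

theorem lintegral_update_pi [Fintype ι] (ν : ι → Measure ℝ) [∀ c, IsProbabilityMeasure (ν c)]
    (c : ι) {g : (ι → ℝ) → ℝ≥0∞} (hg : Measurable g) :
    ∫⁻ ζ, g ζ ∂Measure.pi ν =
      ∫⁻ t, ∫⁻ ζ, g (Function.update ζ c t) ∂Measure.pi ν ∂ν c := by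
  rw [lintegral_piecewise_pi ν {c} hg]
  have h1 : (Measure.pi ν).map (Function.eval c) = ν c := by
    rw [Measure.pi_map_eval, Finset.prod_eq_one (fun i _ => measure_univ), one_smul]
  have h2 : Measurable fun t : ℝ => ∫⁻ ζ, g (Function.update ζ c t) ∂Measure.pi ν :=
    (hg.comp (measurable_update_prod c)).lintegral_prod_right'
  conv_rhs => rw [← h1]
  rw [lintegral_map h2 (measurable_pi_apply c)]
  refine lintegral_congr fun ζ' => lintegral_congr fun ζ => ?_
  congr 1
  funext d
  by_cases h : d = c
  · subst h; simp
  · simp [h]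

/-- Let time `t` pass for the clocks in `J`. -/
def shift (J : Finset ι) (t : ℝ) (ζ : ι → ℝ) : ι → ℝ := fun c => if c ∈ J then ζ c + t else ζ c

theorem measurable_shift (J : Finset ι) :
    Measurable fun p : ℝ × (ι → ℝ) => shift J p.1 p.2 := by
  refine measurable_pi_lambda _ fun c => ?_
  by_cases h : c ∈ J
  · simp only [shift, h, if_true]; fun_prop
  · simp only [shift, h, if_false]; fun_prop

theorem measurable_shift_right (J : Finset ι) (t : ℝ) : Measurable (shift J t) :=
  (measurable_shift J).comp (measurable_const.prodMk measurable_id)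

/-- Absence of memory in each coordinate of `J`. Open and closed half-lines are both admitted
because the rule that breaks ties in a race produces both. -/
theorem pi_restrict_shift [Fintype ι] {r : ι → ℝ} (hr : ∀ c, 0 < r c) (J : Finset ι) {t : ℝ} (ht : 0 ≤ t)
    (I : ι → Set ℝ) (hI : ∀ c, I c = Set.Ici t ∨ I c = Set.Ioi t) :
    (Measure.pi fun c => expMeasure (r c)).restrict
        (Set.univ.pi fun c => if c ∈ J then I c else Set.univ) =
      ENNReal.ofReal (Real.exp (-((∑ c ∈ J, r c) * t))) •
        (Measure.pi fun c => expMeasure (r c)).map (shift J t) := by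
  have hp : ∀ c, IsProbabilityMeasure (expMeasure (r c)) := fun c =>
    isProbabilityMeasure_expMeasure (hr c)
  rw [Measure.restrict_pi_pi]
  refine Measure.pi_eq fun B hB => ?_
  have hpre : shift J t ⁻¹' (Set.univ.pi B) =
      Set.univ.pi fun c => if c ∈ J then (· + t) ⁻¹' B c else B c := by
    ext ζ
    simp only [Set.mem_preimage, Set.mem_pi, Set.mem_univ, true_implies, shift]
    refine forall_congr' fun c => ?_
    by_cases h : c ∈ J <;> simp [h]
  have hexp : ENNReal.ofReal (Real.exp (-((∑ c ∈ J, r c) * t))) =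
      ∏ c, if c ∈ J then ENNReal.ofReal (Real.exp (-(r c * t))) else 1 := by
    rw [Finset.prod_ite_mem, Finset.univ_inter, ← ENNReal.ofReal_prod_of_nonneg
      fun c _ => (Real.exp_pos _).le, ← Real.exp_sum, Finset.sum_mul, Finset.sum_neg_distrib]
  rw [Measure.smul_apply, Measure.map_apply (measurable_shift_right J t) (.univ_pi hB), hpre,
    Measure.pi_pi, smul_eq_mul, hexp, ← Finset.prod_mul_distrib]
  refine Finset.prod_congr rfl fun c _ => ?_
  by_cases h : c ∈ J
  · simp only [h, if_true]
    have : (expMeasure (r c)).restrict (I c) =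
        ENNReal.ofReal (Real.exp (-(r c * t))) • (expMeasure (r c)).map (· + t) := by
      rcases hI c with h | h <;> rw [h]
      · exact expMeasure_restrict_Ici _ ht
      · exact expMeasure_restrict_Ioi _ ht
    rw [this, Measure.smul_apply, Measure.map_apply (measurable_add_const t) (hB c), smul_eq_mul]
  · simp [h]

end Pi

/-! ### The race of exponential clocks -/

section FirstStep
variable {n : ℕ}

/-- The values for which the clock `c` is the first of the clocks in `K` to expire; ties are broken
by the numbers of the clocks. -/
def isFirst (K : Finset (Fin n)) (c : Fin n) : Set (Fin n → ℝ) :=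
  {ζ | ∀ d ∈ K.erase c, if d < c then ζ c < ζ d else ζ c ≤ ζ d}

theorem measurableSet_isFirst (K : Finset (Fin n)) (c : Fin n) : MeasurableSet (isFirst K c) := by
  have : isFirst K c = ⋂ d ∈ K.erase c, {ζ | if d < c then ζ c < ζ d else ζ c ≤ ζ d} := by
    ext ζ; simp only [isFirst, Set.mem_iInter]; rfl
  rw [this]
  refine Finset.measurableSet_biInter _ fun d _ => ?_
  by_cases h : d < c
  · simpa [h] using measurableSet_lt (measurable_pi_apply c) (measurable_pi_apply d)
  · simpa [h] using measurableSet_le (measurable_pi_apply c) (measurable_pi_apply d)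

/-- The events `isFirst K c`, for `c ∈ K`, partition the space: exactly one clock minimises the pair
of value and number lexicographically. -/
theorem sum_indicator_isFirst {K : Finset (Fin n)} (hK : K.Nonempty) (g : (Fin n → ℝ) → ℝ≥0∞)
    (ζ : Fin n → ℝ) : ∑ c ∈ K, (isFirst K c).indicator g ζ = g ζ := by
  classical
  obtain ⟨c, hc, hmin⟩ := K.exists_min_image (fun c => toLex (ζ c, c)) hK
  have h1 : ζ ∈ isFirst K c := by
    intro d hd
    have h := hmin d (Finset.mem_of_mem_erase hd)
    have hne := Finset.ne_of_mem_erase hd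
    rw [Prod.Lex.toLex_le_toLex] at h
    rcases h with h | ⟨h, h'⟩
    · split_ifs
      · exact h
      · exact h.le
    · rw [if_neg (not_lt.2 h')]
      exact h.le
  rw [Finset.sum_eq_single_of_mem c hc, Set.indicator_of_mem h1]
  intro d hd hne
  refine Set.indicator_of_notMem (fun h2 => ?_) _
  have h3 := h1 d (Finset.mem_erase.2 ⟨hne, hd⟩)
  have h4 := h2 c (Finset.mem_erase.2 ⟨hne.symm, hc⟩)
  rcases lt_or_gt_of_ne hne with h | h
  · rw [if_pos h] at h3
    rw [if_neg h.le.not_gt] at h4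
    linarith
  · rw [if_neg h.le.not_gt] at h3
    rw [if_pos h] at h4
    linarith

/-- The race of independent exponentially distributed clocks: when the first clock expires, the
remaining times of the others are again independent and exponentially distributed. -/
theorem lintegral_race {r : Fin n → ℝ} (hr : ∀ c, 0 < r c) {K : Finset (Fin n)} (hK : K.Nonempty)
    {g : (Fin n → ℝ) → ℝ≥0∞} (hg : Measurable g) :
    ∫⁻ ζ, g ζ ∂(Measure.pi fun c => expMeasure (r c)) =
      ∑ c ∈ K, ∫⁻ t, ENNReal.ofReal (Real.exp (-((∑ d ∈ K.erase c, r d) * t))) *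
        ∫⁻ ζ, g (Function.update (shift (K.erase c) t ζ) c t)
          ∂(Measure.pi fun c => expMeasure (r c)) ∂expMeasure (r c) := by
  have hp : ∀ c, IsProbabilityMeasure (expMeasure (r c)) := fun c =>
    isProbabilityMeasure_expMeasure (hr c)
  rw [← lintegral_congr (sum_indicator_isFirst hK g),
    lintegral_finsetSum _ fun c _ => hg.indicator (measurableSet_isFirst K c)]
  refine Finset.sum_congr rfl fun c hc => ?_
  -- Fix the value `t` of `c`. The event then says that the other clocks of `K` lie beyond `t`, and
  -- `pi_restrict_shift` trades this restriction for a shift by `t` and an exponential factor.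
  rw [lintegral_update_pi _ c (hg.indicator (measurableSet_isFirst K c))]
  refine lintegral_congr_ae ?_
  filter_upwards [expMeasure_ae_pos (r c)] with t ht
  have h1 := pi_restrict_shift hr (K.erase c) ht.le
    (fun d => if d < c then Set.Ioi t else Set.Ici t) (fun d => by split_ifs <;> simp)
  have hgt : Measurable fun ζ : Fin n → ℝ => g (Function.update ζ c t) :=
    hg.comp ((measurable_update_prod c).comp (measurable_const.prodMk measurable_id))
  rw [← lintegral_map (f := fun ζ => g (Function.update ζ c t)) hgt
    (measurable_shift_right (K.erase c) t), ← smul_eq_mul, ← lintegral_smul_measure, ← h1,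
    ← lintegral_indicator]
  · refine lintegral_congr fun ζ => ?_
    by_cases h : Function.update ζ c t ∈ isFirst K c
    · rw [Set.indicator_of_mem h, Set.indicator_of_mem]
      intro d _
      by_cases hd : d ∈ K.erase c
      · have hne := Finset.ne_of_mem_erase hd
        have := h d hd
        simp only [hd, if_true]
        split_ifs at this ⊢ <;> simpa [hne] using this
      · simp [hd]
    · rw [Set.indicator_of_notMem h, Set.indicator_of_notMem]
      refine fun h' => h fun d hd => ?_
      have hne := Finset.ne_of_mem_erase hd
      have := h' d (Set.mem_univ d)
      simp only [hd, if_true] at this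
      split_ifs at this ⊢ <;> simpa [hne] using this
  · refine MeasurableSet.univ_pi fun d => ?_
    split_ifs
    · exact measurableSet_Ioi
    · exact measurableSet_Ici
    · exact MeasurableSet.univ

end FirstStep

end DistBisim

/-! ### Expectations in configurations and first-step analysis -/

noncomputable section

namespace DistBisim
open StochAutomaton

theorem find?_congr_mem {α : Type*} {p q : α → Bool} {l : List α} (h : ∀ a ∈ l, p a = q a) :
    l.find? p = l.find? q := by
  induction l with
  | nil => rfl
  | cons a l ih =>
    rw [List.find?_cons, List.find?_cons, h a List.mem_cons_self,
      ih fun b hb => h b (List.mem_cons_of_mem _ hb)]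

-- A choice of the first suitable element of a finite list is measurable piece by piece. This
-- replaces a measurable selection theorem, both for the edge that fires and for the choice of a
-- lifted transition.
open Classical in
theorem measurable_find?_elim {α β S : Type*} [MeasurableSpace S] [MeasurableSpace β] (l : List α)
    (p : α → S → Prop) (hp : ∀ a, MeasurableSet {s | p a s}) {d : S → β} (hd : Measurable d)
    {f : α → S → β} (hf : ∀ a, Measurable (f a)) :
    Measurable fun s => (l.find? fun a => decide (p a s)).elim (d s) fun a => f a s := by
  induction l with
  | nil => simpa using hd
  | cons a l ih =>
    have : (fun s => ((a :: l).find? fun a => decide (p a s)).elim (d s) fun a => f a s) =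
        fun s => if p a s then f a s
          else (l.find? fun a => decide (p a s)).elim (d s) fun a => f a s := by
      funext s
      by_cases h : p a s <;> simp [h]
    rw [this]
    exact Measurable.ite (hp a) (hf a) ih

theorem toNNReal_sub_coe (x : ℝ) (t : ℝ≥0) : (x - t).toNNReal = x.toNNReal - t := by
  rcases le_total 0 x with hx | hx
  · lift x to ℝ≥0 using hx
    rw [← NNReal.sub_def, Real.toNNReal_coe]
  · rw [Real.toNNReal_of_nonpos hx, Real.toNNReal_of_nonpos (by linarith [t.coe_nonneg]), zero_tsub]

theorem enablingTime_congr {C : Type*} (X : Finset C) {ξ ξ' : C → ℝ}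
    (h : ∀ c, (ξ c).toNNReal = (ξ' c).toNNReal) : enablingTime X ξ = enablingTime X ξ' := by
  simp only [enablingTime, h]

theorem enablingTime_eq_zero_iff {C : Type*} [DecidableEq C] {X K : Finset C} {ζ : C → ℝ}
    (hζ : ∀ c, 0 < ζ c) : enablingTime X (K.piecewise ζ 0) = 0 ↔ Disjoint X K := by
  rw [enablingTime, ← le_zero_iff, Finset.sup_le_iff, Finset.disjoint_left]
  refine forall₂_congr fun c _ => ?_
  by_cases h : c ∈ K
  · simp [h, hζ c]
  · simp [h]

/-- The enabling time is a maximum. Expired clocks contribute `0` to it, and some running clock of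
the guard contributes at least `t` after the shift, so the running clocks decide. -/
theorem enablingTime_shift {C : Type*} [DecidableEq C] {X K : Finset C} (hXK : ¬Disjoint X K)
    {ξ : C → ℝ} (hξ : ∀ c, 0 ≤ ξ c) (hξK : ∀ c ∉ K, ξ c = 0) (t : ℝ≥0) :
    enablingTime X (shift K t ξ) = enablingTime X ξ + t := by
  have h1 : ∀ c ∈ K, (shift K t ξ c).toNNReal = (ξ c).toNNReal + t := fun c hc => by
    rw [shift, if_pos hc, Real.toNNReal_add (hξ c) t.coe_nonneg, Real.toNNReal_coe]
  have h2 : ∀ c ∉ K, (shift K t ξ c).toNNReal = 0 := fun c hc => by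
    rw [shift, if_neg hc, hξK c hc, Real.toNNReal_zero]
  have h3 : ∀ c ∈ X, (shift K t ξ c).toNNReal ≤ enablingTime X (shift K t ξ) := fun c hc =>
    Finset.le_sup (f := fun c => (shift K t ξ c).toNNReal) hc
  refine le_antisymm (Finset.sup_le fun c hc => ?_) ?_
  · by_cases hK : c ∈ K
    · rw [h1 c hK]
      exact add_le_add_left (Finset.le_sup (f := fun c => (ξ c).toNNReal) hc) t
    · rw [h2 c hK]
      exact zero_le
  · obtain ⟨c₀, hc₀, hc₀'⟩ := Finset.not_disjoint_iff.1 hXK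
    have ht : t ≤ enablingTime X (shift K t ξ) := by
      refine le_trans ?_ (h3 c₀ hc₀)
      rw [h1 c₀ hc₀']
      exact le_add_self
    rw [← le_tsub_iff_right ht]
    refine Finset.sup_le fun c hc => ?_
    by_cases hK : c ∈ K
    · rw [le_tsub_iff_right ht, ← h1 c hK]
      exact h3 c hc
    · rw [hξK c hK, Real.toNNReal_zero]
      exact zero_le

namespace ExpAutomaton
variable (M : ExpAutomaton)

/-- The edges of the automaton. -/
abbrev Edges := Edge (Fin M.nQ) (Fin M.nC) (Fin M.nA)
/-- The states of the automaton. -/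
abbrev State := Fin M.nQ × (Fin M.nC → ℝ)
/-- The labels of the automaton. -/
abbrev Label := Fin M.nA × ℝ≥0

/-- The edge `e` is among the first to become enabled. -/
def Fire (e : M.Edges) (s : M.State) : Prop :=
  M.toStochAutomaton.Fires e s (enablingTime e.guard s.2)

/-- The label under which `e` is taken. -/
def label (e : M.Edges) (s : M.State) : M.Label := (e.act, enablingTime e.guard s.2)

/-- The distribution after taking `e`. -/
def after (e : M.Edges) (s : M.State) : ProbabilityMeasure M.State :=
  M.toStochAutomaton.enter e.tgt fun c => s.2 c - enablingTime e.guard s.2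

theorem fire_iff (e : M.Edges) (s : M.State) : M.Fire e s ↔ e ∈ M.edges ∧ e.src = s.1 ∧
    ∀ e' ∈ M.edges, e'.src = s.1 → enablingTime e.guard s.2 ≤ enablingTime e'.guard s.2 := by
  simp [Fire, Fires, toStochAutomaton]

theorem measurable_enabling (X : Finset (Fin M.nC)) :
    Measurable fun s : M.State => enablingTime X s.2 :=
  (measurable_enablingTime X).comp measurable_snd

theorem measurableSet_fire (e : M.Edges) : MeasurableSet {s | M.Fire e s} := by
  have : {s | M.Fire e s} = {s | e ∈ M.edges} ∩ ({s | e.src = s.1} ∩ ⋂ e' : M.Edges,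
      {s | e' ∈ M.edges}ᶜ ∪ ({s | e'.src = s.1}ᶜ ∪
        {s | enablingTime e.guard s.2 ≤ enablingTime e'.guard s.2})) := by
    ext s
    simp only [fire_iff, Set.mem_ofPred_eq, Set.mem_inter_iff, Set.mem_iInter, Set.mem_union,
      Set.mem_compl_iff]
    refine and_congr_right fun _ => and_congr_right fun _ => forall_congr' fun e' => ?_
    tauto
  have hsrc : ∀ q : Fin M.nQ, MeasurableSet {s : M.State | q = s.1} := fun q =>
    measurableSet_eq_fun measurable_const measurable_fst
  rw [this]
  exact (MeasurableSet.const _).inter ((hsrc _).inter (.iInter fun e' => (MeasurableSet.const _).compl.union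
    ((hsrc _).compl.union (measurableSet_le (M.measurable_enabling _) (M.measurable_enabling _)))))

theorem measurable_label (e : M.Edges) : Measurable (M.label e) :=
  measurable_const.prodMk (M.measurable_enabling _)

theorem measurable_after (e : M.Edges) : Measurable (M.after e) := by
  refine (M.toStochAutomaton.measurable_enter e.tgt).comp (measurable_pi_lambda _ fun c => ?_)
  exact ((measurable_pi_apply c).comp measurable_snd).sub
    (measurable_coe_nnreal_real.comp (M.measurable_enabling _))

open Classical in
/-- The first edge of the list that is taken in a state. -/
def firing (s : M.State) : Option M.Edges := M.edges.find? fun e => decide (M.Fire e s)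

/-- The expectation of `φ` after the next transition, weighted by a function of its label. -/
def weighted (g : M.Label → ℝ≥0∞) (φ : M.State → ℝ≥0∞) (s : M.State) : ℝ≥0∞ :=
  (M.firing s).elim 0 fun e => g (M.label e s) * ∫⁻ x, φ x ∂(M.after e s : Measure M.State)

theorem measurable_lintegral_after (e : M.Edges) {φ : M.State → ℝ≥0∞} (hφ : Measurable φ) :
    Measurable fun s => ∫⁻ x, φ x ∂(M.after e s : Measure M.State) :=
  (Measure.measurable_lintegral hφ).comp (measurable_subtype_coe.comp (M.measurable_after e))

theorem measurable_weighted {g : M.Label → ℝ≥0∞} {φ : M.State → ℝ≥0∞} (hg : Measurable g)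
    (hφ : Measurable φ) : Measurable (M.weighted g φ) :=
  measurable_find?_elim M.edges M.Fire M.measurableSet_fire measurable_const fun e =>
    (hg.comp (M.measurable_label e)).mul (M.measurable_lintegral_after e hφ)

theorem weighted_le_one {g : M.Label → ℝ≥0∞} {φ : M.State → ℝ≥0∞} (hg : ∀ l, g l ≤ 1)
    (hφ : ∀ s, φ s ≤ 1) (s : M.State) : M.weighted g φ s ≤ 1 := by
  rw [weighted]
  cases M.firing s with
  | none => simp
  | some e =>
    refine mul_le_one' (hg _) ?_
    refine (lintegral_mono hφ).trans ?_
    simp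

/-- The function `φ` does not depend on how long ago a clock has expired. -/
def IgnoresExpired (φ : M.State → ℝ≥0∞) : Prop :=
  ∀ q ξ ξ', (∀ c, (ξ c).toNNReal = (ξ' c).toNNReal) → φ (q, ξ) = φ (q, ξ')

/-- The joint distribution of the clocks. -/
def clockDist : Measure (Fin M.nC → ℝ) := Measure.pi fun c => expMeasure (M.rate c : ℝ)

instance isProbabilityMeasure_rate (c : Fin M.nC) :
    IsProbabilityMeasure (expMeasure (M.rate c : ℝ)) :=
  isProbabilityMeasure_expMeasure (by exact_mod_cast M.rate_pos c)

instance : IsProbabilityMeasure M.clockDist := by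
  unfold clockDist; infer_instance

theorem ae_clockDist_pos : ∀ᵐ ζ ∂M.clockDist, ∀ c, 0 < ζ c := by
  rw [ae_all_iff]
  exact fun c => (Measure.tendsto_eval_ae_ae (i := c)).eventually (expMeasure_ae_pos _)

theorem measurable_piecewise_right {ι : Type*} [DecidableEq ι] (K : Finset ι) (ξ : ι → ℝ) :
    Measurable fun ζ : ι → ℝ => K.piecewise ζ ξ :=
  (measurable_piecewise_prod K).comp (measurable_id.prodMk measurable_const)

/-- Entering a location is realised by one draw of all clocks, of which only those in `M.κ q` are
used. All expectations thus refer to the single measure `clockDist`. -/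
theorem lintegral_enter (q : Fin M.nQ) (ξ : Fin M.nC → ℝ) {φ : M.State → ℝ≥0∞}
    (hφ : Measurable φ) :
    ∫⁻ x, φ x ∂(M.toStochAutomaton.enter q ξ : Measure M.State) =
      ∫⁻ ζ, φ (q, (M.κ q).piecewise ζ ξ) ∂M.clockDist := by
  classical
  have h1 : (Measure.pi fun c => if c ∈ M.κ q then expMeasure (M.rate c : ℝ)
      else Measure.dirac (ξ c)) = M.clockDist.map fun ζ => (M.κ q).piecewise ζ ξ := by
    have hs : ∀ c, SigmaFinite (if c ∈ M.κ q then expMeasure (M.rate c : ℝ)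
      else Measure.dirac (ξ c)) := fun c => by split_ifs <;> infer_instance
    refine Measure.pi_eq fun B hB => ?_
    rw [Measure.map_apply (measurable_piecewise_right _ _) (.univ_pi hB)]
    have : (fun ζ => (M.κ q).piecewise ζ ξ) ⁻¹' (Set.univ.pi B) =
        Set.univ.pi fun c => if c ∈ M.κ q then B c else {_x | ξ c ∈ B c} := by
      ext ζ
      simp only [Set.mem_preimage, Set.mem_pi, Set.mem_univ, true_implies]
      refine forall_congr' fun c => ?_
      by_cases h : c ∈ M.κ q <;> simp [h]
    rw [this, clockDist, Measure.pi_pi]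
    refine Finset.prod_congr rfl fun c _ => ?_
    by_cases h : c ∈ M.κ q
    · simp [h]
    · by_cases h' : ξ c ∈ B c <;> simp [h, h', hB c]
  have h2 : (M.toStochAutomaton.enter q ξ : Measure M.State) = (Measure.dirac q).prod
      (Measure.pi fun c => if c ∈ M.κ q then expMeasure (M.rate c : ℝ)
        else Measure.dirac (ξ c)) := by
    simp only [StochAutomaton.enter, toStochAutomaton, ProbabilityMeasure.coe_mk]
    refine congrArg (fun f => (Measure.dirac q).prod (Measure.pi f)) (funext fun c => ?_)
    by_cases hc : c ∈ M.κ q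
    · exact (if_pos hc).trans (if_pos hc).symm
    · exact (if_neg hc).trans (if_neg hc).symm
  rw [h2, h1]
  have : IsProbabilityMeasure (M.clockDist.map fun ζ => (M.κ q).piecewise ζ ξ) :=
    Measure.isProbabilityMeasure_map (measurable_piecewise_right _ _).aemeasurable
  rw [lintegral_prod _ hφ.aemeasurable, lintegral_dirac' _ hφ.lintegral_prod_right',
    lintegral_map (f := fun ζ => φ (q, ζ)) (hφ.comp measurable_prodMk_left) (measurable_piecewise_right _ _)]

/-- The expectation of `φ` in a configuration. -/
def expect (φ : M.State → ℝ≥0∞) (s : M.Cfg) : ℝ≥0∞ :=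
  ∫⁻ ζ, φ (s.1, s.2.piecewise ζ 0) ∂M.clockDist

theorem lintegral_initial (q : Fin M.nQ) {φ : M.State → ℝ≥0∞} (hφ : Measurable φ) :
    ∫⁻ x, φ x ∂(M.toStochAutomaton.initial q : Measure M.State) = M.expect φ (M.start q) :=
  M.lintegral_enter q 0 hφ

theorem expect_le_one {φ : M.State → ℝ≥0∞} (hφ : ∀ s, φ s ≤ 1) (s : M.Cfg) :
    M.expect φ s ≤ 1 := by
  refine (lintegral_mono fun ζ => hφ _).trans ?_
  simp

/-- A clock that was running and is set again has the same distribution as one that keeps running,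
so configurations are closed under entering a location. -/
theorem lintegral_enter_expect (q : Fin M.nQ) (K : Finset (Fin M.nC)) {φ : M.State → ℝ≥0∞}
    (hφ : Measurable φ) :
    ∫⁻ ζ, ∫⁻ x, φ x ∂(M.toStochAutomaton.enter q (K.piecewise ζ 0) : Measure M.State)
      ∂M.clockDist = M.expect φ (q, K ∪ M.κ q) := by
  have hm : Measurable fun ζ : Fin M.nC → ℝ => φ (q, (K ∪ M.κ q).piecewise ζ 0) :=
    hφ.comp (measurable_const.prodMk (measurable_piecewise_right _ _))
  rw [expect, clockDist, lintegral_piecewise_pi _ (M.κ q) hm, lintegral_lintegral_swap]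
  · refine lintegral_congr fun ζ => ?_
    rw [lintegral_enter _ _ _ hφ]
    refine lintegral_congr fun ζ' => ?_
    congr 2
    funext c
    by_cases h : c ∈ M.κ q <;> by_cases h' : c ∈ K <;> simp [h, h']
  · exact (hm.comp (measurable_piecewise_prod _)).aemeasurable

theorem weighted_congr {g : M.Label → ℝ≥0∞} {φ : M.State → ℝ≥0∞} {s s' : M.State} {a : ℝ≥0∞}
    (hf : ∀ e ∈ M.edges, (M.Fire e s ↔ M.Fire e s'))
    (h : ∀ e, M.Fire e s → M.Fire e s' →
      g (M.label e s) * ∫⁻ x, φ x ∂(M.after e s : Measure M.State) =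
      a * (g (M.label e s') * ∫⁻ x, φ x ∂(M.after e s' : Measure M.State))) :
    M.weighted g φ s = a * M.weighted g φ s' := by
  have h1 : M.firing s = M.firing s' :=
    find?_congr_mem fun e he => decide_eq_decide.2 (hf e he)
  rw [weighted, weighted, h1]
  cases hs : M.firing s' with
  | none => simp
  | some e =>
    have h2 : M.Fire e s' := by simpa using List.find?_some hs
    have h3 : e ∈ M.edges := List.mem_of_find?_eq_some hs
    exact h e ((hf e h3).2 h2) h2

/-- Enabling times see only the positive parts of the clocks, and idling acts on positive parts by
truncated subtraction. -/
theorem ignoresExpired_weighted (g : M.Label → ℝ≥0∞) {φ : M.State → ℝ≥0∞} (hφ : Measurable φ)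
    (h : M.IgnoresExpired φ) : M.IgnoresExpired (M.weighted g φ) := by
  intro q ξ ξ' hξ
  rw [← one_mul (M.weighted g φ (q, ξ'))]
  refine M.weighted_congr (fun e he => ?_) fun e _ _ => ?_
  · simp only [fire_iff, enablingTime_congr _ hξ]
  · rw [one_mul, label, label, after, after, lintegral_enter _ _ _ hφ, lintegral_enter _ _ _ hφ]
    simp only [enablingTime_congr _ hξ]
    congr 1
    refine lintegral_congr fun ζ => h _ _ _ fun c => ?_
    by_cases hc : c ∈ M.κ e.tgt
    · simp [hc]
    · simp only [hc, not_false_eq_true, Finset.piecewise_eq_of_notMem]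
      rw [toNNReal_sub_coe, toNNReal_sub_coe, hξ]

/-- Running clocks are almost surely positive, so the idling time is zero and the edges that fire
are those whose guards avoid `K`. Both `firing` and `head?` pick the first of them in the list. -/
theorem expect_weighted_of_enabled {g : M.Label → ℝ≥0∞} {φ : M.State → ℝ≥0∞} (hφ : Measurable φ)
    {s : M.Cfg} {e : M.Edges} (he : (M.enabled s).head? = some e) :
    M.expect (M.weighted g φ) s = g (e.act, 0) * M.expect φ (M.next e s) := by
  obtain ⟨q, K⟩ := s
  have hmem : e ∈ M.edges ∧ e.src = q ∧ Disjoint e.guard K := by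
    have h := List.mem_of_mem_head? he
    simpa [enabled] using h
  have h1 : ∀ᵐ ζ ∂M.clockDist, M.weighted g φ (q, K.piecewise ζ 0) = g (e.act, 0) *
      ∫⁻ x, φ x ∂(M.toStochAutomaton.enter e.tgt (K.piecewise ζ 0) : Measure M.State) := by
    filter_upwards [M.ae_clockDist_pos] with ζ hζ
    have h2 : M.firing (q, K.piecewise ζ 0) = some e := by
      rw [← he, enabled, List.head?_filter]
      refine find?_congr_mem fun e' he' => decide_eq_decide.2 ?_
      rw [fire_iff]
      constructor
      · rintro ⟨-, h3, h4⟩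
        refine ⟨h3, (enablingTime_eq_zero_iff hζ).1 (le_antisymm ?_ zero_le)⟩
        have h5 := h4 e hmem.1 hmem.2.1
        rwa [(enablingTime_eq_zero_iff hζ).2 hmem.2.2] at h5
      · rintro ⟨h3, h4⟩
        refine ⟨he', h3, fun e'' _ _ => ?_⟩
        rw [(enablingTime_eq_zero_iff hζ).2 h4]
        exact zero_le
    have h3 := (enablingTime_eq_zero_iff hζ).2 hmem.2.2
    rw [weighted, h2, Option.elim_some, label, after]
    simp only [h3, NNReal.coe_zero, sub_zero]
  rw [expect, lintegral_congr_ae h1, lintegral_const_mul, M.lintegral_enter_expect e.tgt K hφ]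
  · rfl
  · exact (Measure.measurable_lintegral hφ).comp (measurable_subtype_coe.comp
      ((M.toStochAutomaton.measurable_enter e.tgt).comp (measurable_piecewise_right K 0)))

open Classical in
/-- The discount `exp (-z t)` for the action `a`. -/
def discount (z : ℝ) (a : Fin M.nA) (l : M.Label) : ℝ≥0∞ :=
  if l.1 = a then ENNReal.ofReal (Real.exp (-(z * l.2))) else 0

theorem discount_mk (z : ℝ) (a b : Fin M.nA) (t : ℝ≥0) :
    M.discount z a (b, t) = if b = a then ENNReal.ofReal (Real.exp (-(z * t))) else 0 := by
  by_cases h : b = a <;> simp [discount, h]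

theorem measurable_discount (z : ℝ) (a : Fin M.nA) : Measurable (M.discount z a) := by
  refine Measurable.ite (measurable_fst (measurableSet_singleton a)) ?_ measurable_const
  fun_prop

theorem discount_le_one {z : ℝ} (hz : 0 ≤ z) (a : Fin M.nA) (l : M.Label) :
    M.discount z a l ≤ 1 := by
  unfold discount
  split_ifs
  · rw [← ENNReal.ofReal_one]
    refine ENNReal.ofReal_le_ofReal (Real.exp_le_one_iff.2 ?_)
    have := mul_nonneg hz l.2.coe_nonneg
    linarith
  · exact zero_le

/-- Every guard at `q` contains a running clock, so adding `t` to the running clocks delays all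
edges by `t`. The same edges fire, and afterwards the clocks that are not set differ only in how
long ago the expired ones ran out, which `φ` ignores. What remains is the discount for the delay. -/
theorem weighted_shift {z : ℝ} (a : Fin M.nA) {φ : M.State → ℝ≥0∞}
    (hφ : Measurable φ) (hφ' : M.IgnoresExpired φ) {q : Fin M.nQ} {K : Finset (Fin M.nC)}
    (hs : M.enabled (q, K) = []) {ξ : Fin M.nC → ℝ} (hξ : ∀ c, 0 ≤ ξ c) (hξK : ∀ c ∉ K, ξ c = 0)
    (t : ℝ≥0) :
    M.weighted (M.discount z a) φ (q, shift K t ξ) =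
      ENNReal.ofReal (Real.exp (-(z * t))) * M.weighted (M.discount z a) φ (q, ξ) := by
  have hdis : ∀ e ∈ M.edges, e.src = q → ¬Disjoint e.guard K := by
    intro e he hq hd
    have : e ∈ M.enabled (q, K) := by simp [enabled, he, hq, hd]
    simp [hs] at this
  have ht : ∀ e ∈ M.edges, e.src = q →
      enablingTime e.guard (shift K t ξ) = enablingTime e.guard ξ + t := fun e he hq =>
    enablingTime_shift (hdis e he hq) hξ hξK t
  refine M.weighted_congr (fun e he => ?_) fun e h _ => ?_
  · rw [fire_iff, fire_iff]
    refine and_congr_right fun _ => and_congr_right fun hq => ?_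
    refine forall₃_congr fun e' he' hq' => ?_
    rw [ht e he hq, ht e' he' hq', add_le_add_iff_right]
  · obtain ⟨he, hq, -⟩ := (M.fire_iff e _).1 h
    have h1 := ht e he hq
    rw [← mul_assoc]
    congr 1
    · simp only [label, discount_mk, h1]
      by_cases ha : e.act = a
      · rw [if_pos ha, if_pos ha, ← ENNReal.ofReal_mul (Real.exp_pos _).le, ← Real.exp_add]
        congr 2
        push_cast
        ring
      · rw [if_neg ha, if_neg ha, mul_zero]
    · simp only [after, h1]
      rw [lintegral_enter _ _ _ hφ, lintegral_enter _ _ _ hφ]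
      refine lintegral_congr fun ζ => hφ' _ _ _ fun c => ?_
      by_cases hc : c ∈ M.κ e.tgt
      · simp [hc]
      · simp only [hc, not_false_eq_true, Finset.piecewise_eq_of_notMem]
        by_cases hK : c ∈ K
        · rw [shift, if_pos hK]
          congr 1
          push_cast
          ring
        · rw [shift, if_neg hK, hξK c hK, Real.toNNReal_of_nonpos, Real.toNNReal_of_nonpos]
          · have := (enablingTime e.guard ξ).coe_nonneg
            linarith
          · have := (enablingTime e.guard ξ + t).coe_nonneg
            linarith

/-- First-step analysis. If `c` wins the race at time `t`, the other running clocks are as new and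
the rest of the run is delayed by `t`, so it starts from `K.erase c` with the factor `exp (-z t)`.
Integration over `t` gives the rate of `c` divided by `z` plus the total rate of `K`. -/
theorem expect_weighted_of_not_enabled {z : ℝ} (hz : 0 ≤ z) (a : Fin M.nA) {φ : M.State → ℝ≥0∞}
    (hφ : Measurable φ) (hφ' : M.IgnoresExpired φ) {q : Fin M.nQ} {K : Finset (Fin M.nC)}
    (hs : M.enabled (q, K) = []) :
    ENNReal.ofReal (z + ∑ c ∈ K, (M.rate c : ℝ)) * M.expect (M.weighted (M.discount z a) φ) (q, K) =
      ∑ c ∈ K, ENNReal.ofReal (M.rate c) *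
        M.expect (M.weighted (M.discount z a) φ) (q, K.erase c) := by
  have hr : ∀ c, (0 : ℝ) < M.rate c := fun c => by exact_mod_cast M.rate_pos c
  have hw := M.measurable_weighted (M.measurable_discount z a) hφ
  -- Without running clocks every edge at `q` would be enabled. So none leaves `q`, the automaton
  -- halts, and both sides vanish.
  rcases K.eq_empty_or_nonempty with rfl | hK
  · have h0 : ∀ ξ, M.weighted (M.discount z a) φ (q, ξ) = 0 := by
      intro ξ
      have : M.firing (q, ξ) = none := by
        rw [firing, List.find?_eq_none]
        intro e he h
        have h1 := ((M.fire_iff e _).1 (by simpa using h)).2.1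
        have : e ∈ M.enabled (q, ∅) := by simp [enabled, he, h1]
        simp [hs] at this
      rw [weighted, this, Option.elim_none]
    simp [expect, h0]
  have hm : Measurable fun ζ : Fin M.nC → ℝ =>
      M.weighted (M.discount z a) φ (q, K.piecewise ζ 0) :=
    hw.comp (measurable_const.prodMk (measurable_piecewise_right _ _))
  rw [expect, clockDist, lintegral_race hr hK hm, Finset.mul_sum]
  refine Finset.sum_congr rfl fun c hc => ?_
  set y := M.expect (M.weighted (M.discount z a) φ) (q, K.erase c) with hy
  set Λ := ∑ d ∈ K.erase c, (M.rate d : ℝ) with hΛ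
  have hΛ0 : 0 ≤ Λ := Finset.sum_nonneg fun d _ => (hr d).le
  have hΛK : ∑ d ∈ K, (M.rate d : ℝ) = M.rate c + Λ := (Finset.add_sum_erase K _ hc).symm
  have h1 : ∀ᵐ t ∂expMeasure (M.rate c : ℝ), ENNReal.ofReal (Real.exp (-(Λ * t))) *
      ∫⁻ ζ, M.weighted (M.discount z a) φ
        (q, K.piecewise (Function.update (shift (K.erase c) t ζ) c t) 0)
          ∂(Measure.pi fun c => expMeasure (M.rate c : ℝ)) =
      ENNReal.ofReal (Real.exp (-((Λ + z) * t))) * y := by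
    filter_upwards [expMeasure_ae_pos (M.rate c : ℝ)] with t ht
    have h2 : ∀ᵐ ζ ∂M.clockDist, M.weighted (M.discount z a) φ
        (q, K.piecewise (Function.update (shift (K.erase c) t ζ) c t) 0) =
        ENNReal.ofReal (Real.exp (-(z * t))) *
          M.weighted (M.discount z a) φ (q, (K.erase c).piecewise ζ 0) := by
      filter_upwards [M.ae_clockDist_pos] with ζ hζ
      have h3 := M.weighted_shift (z := z) a hφ hφ' hs (ξ := (K.erase c).piecewise ζ 0)
        (fun d => ?_) (fun d hd => ?_) ⟨t, ht.le⟩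
      -- The winner `c` counts as expired with value `0`; letting `t` be added to all of `K` gives
      -- it exactly the value `t`.
      · have h4 : K.piecewise (Function.update (shift (K.erase c) t ζ) c t) 0 =
            shift K t ((K.erase c).piecewise ζ 0) := by
          funext d
          by_cases hd : d ∈ K
          · by_cases hdc : d = c
            · subst hdc
              simp [shift, hd]
            · simp [shift, hd, hdc]
          · simp [shift, hd]
        rw [h4]
        exact h3
      · by_cases hd : d ∈ K.erase c
        · rw [Finset.piecewise_eq_of_mem _ _ _ hd]; exact (hζ d).le
        · rw [Finset.piecewise_eq_of_notMem _ _ _ hd]; exact le_rfl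
      · rw [Finset.piecewise_eq_of_notMem _ _ _ fun h => hd (Finset.mem_of_mem_erase h)]; rfl
    change _ * ∫⁻ ζ, _ ∂M.clockDist = _
    rw [lintegral_congr_ae h2, lintegral_const_mul, ← mul_assoc,
      ← ENNReal.ofReal_mul (Real.exp_pos _).le, ← Real.exp_add, hy]
    · congr 3
      ring
    · exact hw.comp (measurable_const.prodMk (measurable_piecewise_right _ _))
  rw [lintegral_congr_ae h1, lintegral_mul_const _ (by fun_prop), ← mul_assoc, hΛK,
    show z + (M.rate c + Λ) = (M.rate c : ℝ) + (Λ + z) by ring,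
    lintegral_exp_expMeasure (hr c) (by positivity)]

end ExpAutomaton
end DistBisim

end

noncomputable section

namespace DistBisim
open StochAutomaton

/-! ### Laplace transforms -/

open BoundedContinuousFunction in
/-- The function `exp (-t)`. -/
def expNeg : ℝ≥0 →ᵇ ℝ :=
  BoundedContinuousFunction.ofNormedAddCommGroup (fun t : ℝ≥0 => Real.exp (-(t : ℝ)))
    (by fun_prop) 1 fun t => by
      rw [Real.norm_of_nonneg (Real.exp_pos _).le]
      exact Real.exp_le_one_iff.2 (by simp)

open BoundedContinuousFunction in
/-- The polynomials in `exp (-t)`. -/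
def expPoly : StarSubalgebra ℝ (ℝ≥0 →ᵇ ℝ) where
  toSubalgebra := (Polynomial.aeval expNeg).range
  star_mem' := by
    rintro f hf
    have : star f = f := by ext t; simp
    rwa [this]

theorem measurable_exp_neg (z : ℝ) :
    Measurable fun t : ℝ≥0 => ENNReal.ofReal (Real.exp (-(z * t))) := by fun_prop

/-- The polynomials in `exp (-t)` form an algebra of bounded continuous functions, and `exp (-t)`
alone separates points. Such an algebra determines a finite measure. -/
theorem ext_of_exp_neg_pow {μ ν : Measure ℝ≥0} [IsFiniteMeasure μ] [IsFiniteMeasure ν]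
    (h : ∀ n : ℕ, ∫⁻ t, ENNReal.ofReal (Real.exp (-(n * t))) ∂μ =
      ∫⁻ t, ENNReal.ofReal (Real.exp (-(n * t))) ∂ν) : μ = ν := by
  refine ext_of_forall_mem_subalgebra_integral_eq_of_pseudoEMetric_complete_countable
    (𝕜 := ℝ) (A := expPoly) ?_ ?_
  · intro s t hst
    refine ⟨expNeg, ⟨expNeg.toContinuousMap, ⟨expNeg, ⟨Polynomial.X, by simp⟩, rfl⟩, rfl⟩, ?_⟩
    intro h
    have h1 : Real.exp (-(s : ℝ)) = Real.exp (-(t : ℝ)) := h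
    exact hst (NNReal.coe_injective (neg_injective (Real.exp_injective h1)))
  · rintro _ ⟨p, rfl⟩
    have hpow : ∀ (n : ℕ) (t : ℝ≥0), (expNeg ^ n) t = Real.exp (-(n * (t : ℝ))) := fun n t => by
      change (Real.exp (-(t : ℝ))) ^ n = _
      rw [← Real.exp_nat_mul]
      ring_nf
    have h1 : ∀ n : ℕ, ∫ t, (expNeg ^ n) t ∂μ = ∫ t, (expNeg ^ n) t ∂ν := fun n => by
      simp only [hpow]
      rw [integral_eq_lintegral_of_nonneg_ae (.of_forall fun _ => (Real.exp_pos _).le)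
        (by fun_prop), integral_eq_lintegral_of_nonneg_ae (.of_forall fun _ => (Real.exp_pos _).le)
        (by fun_prop), h]
    change ∫ t, (Polynomial.aeval expNeg p) t ∂μ = ∫ t, (Polynomial.aeval expNeg p) t ∂ν
    induction p using Polynomial.induction_on' with
    | add p q hp hq =>
      simp only [map_add, BoundedContinuousFunction.coe_add, Pi.add_apply]
      rw [integral_add (BoundedContinuousFunction.integrable _ _)
        (BoundedContinuousFunction.integrable _ _),
        integral_add (BoundedContinuousFunction.integrable _ _)
        (BoundedContinuousFunction.integrable _ _), hp, hq]
    | monomial n a =>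
      rw [Polynomial.aeval_monomial, ← Algebra.smul_def]
      simp only [BoundedContinuousFunction.coe_smul]
      rw [integral_smul, integral_smul, h1]

/-- A finite measure on the nonnegative numbers is determined by its Laplace transform at large
natural numbers. -/
theorem ext_of_laplace {μ ν : Measure ℝ≥0} [IsFiniteMeasure μ] [IsFiniteMeasure ν] (N : ℕ)
    (h : ∀ n : ℕ, N ≤ n → ∫⁻ t, ENNReal.ofReal (Real.exp (-(n * t))) ∂μ =
      ∫⁻ t, ENNReal.ofReal (Real.exp (-(n * t))) ∂ν) : μ = ν := by
  have hm := measurable_exp_neg N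
  have hfin : ∀ ρ : Measure ℝ≥0, IsFiniteMeasure ρ → IsFiniteMeasure
      (ρ.withDensity fun t : ℝ≥0 => ENNReal.ofReal (Real.exp (-(N * t)))) := fun ρ _ => by
    refine isFiniteMeasure_withDensity_ofReal ?_
    refine Integrable.hasFiniteIntegral (Integrable.of_bound (C := 1) (by fun_prop)
      (.of_forall fun t => ?_))
    rw [Real.norm_of_nonneg (Real.exp_pos _).le]
    exact Real.exp_le_one_iff.2 (by have := t.coe_nonneg; simp; positivity)
  have := hfin μ inferInstance
  have := hfin ν inferInstance
  -- Tilting by `exp (-N t)` turns the transforms from `N` on into all transforms of the tilted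
  -- measures. The density is positive and finite, so the tilt can be undone.
  have h1 : (μ.withDensity fun t : ℝ≥0 => ENNReal.ofReal (Real.exp (-(N * t)))) =
      ν.withDensity fun t : ℝ≥0 => ENNReal.ofReal (Real.exp (-(N * t))) := by
    refine ext_of_exp_neg_pow fun n => ?_
    rw [lintegral_withDensity_eq_lintegral_mul _ hm (measurable_exp_neg n),
      lintegral_withDensity_eq_lintegral_mul _ hm (measurable_exp_neg n)]
    have h2 : ((fun t : ℝ≥0 => ENNReal.ofReal (Real.exp (-(N * t)))) *
        fun t : ℝ≥0 => ENNReal.ofReal (Real.exp (-(n * t)))) =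
        fun t : ℝ≥0 => ENNReal.ofReal (Real.exp (-((N + n : ℕ) * t))) := by
      funext t
      rw [Pi.mul_apply, ← ENNReal.ofReal_mul (Real.exp_pos _).le, ← Real.exp_add]
      congr 2
      push_cast
      ring
    rw [h2]
    exact h _ (Nat.le_add_right _ _)
  have h3 : ∀ ρ : Measure ℝ≥0, (ρ.withDensity fun t : ℝ≥0 =>
      ENNReal.ofReal (Real.exp (-(N * t)))).withDensity
        (fun t : ℝ≥0 => (ENNReal.ofReal (Real.exp (-(N * t))))⁻¹) = ρ := fun ρ =>
    withDensity_inv_same hm (.of_forall fun t => by simp [Real.exp_pos])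
      (.of_forall fun t => ENNReal.ofReal_ne_top)
  rw [← h3 μ, h1, h3 ν]

theorem lintegral_ne_top_of_le_one {ι T : Type*} [MeasurableSpace T] (N : ι → Measure T)
    [∀ s, IsFiniteMeasure (N s)] {f : T → ℝ≥0∞} (hf : ∀ t, f t ≤ 1) (s : ι) :
    ∫⁻ t, f t ∂N s ≠ ∞ :=
  ((lintegral_mono hf).trans_lt (by simp)).ne

section Signed
variable {ι T : Type*} [Fintype ι] [MeasurableSpace T] (N : ι → Measure T) (x : ι → ℝ)

/-- The positive part of the coefficients of a linear combination of measures. -/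
def posComb : Measure T := ∑ s, ENNReal.ofReal (x s) • N s

instance [∀ s, IsFiniteMeasure (N s)] : IsFiniteMeasure (posComb N x) := by
  refine ⟨?_⟩
  rw [posComb, Measure.coe_finsetSum, Finset.sum_apply]
  refine ENNReal.sum_lt_top.2 fun s _ => ?_
  rw [Measure.smul_apply, smul_eq_mul]
  exact ENNReal.mul_lt_top ENNReal.ofReal_lt_top (measure_lt_top _ _)

/-- A signed combination vanishes on `f` if and only if its positive and negative parts agree there.
This makes the uniqueness theorems for finite measures applicable to linear functionals. -/
theorem sum_eq_posComb_sub {f : T → ℝ≥0∞} (hf : ∀ s, ∫⁻ t, f t ∂N s ≠ ∞) :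
    ∑ s, x s * (∫⁻ t, f t ∂N s).toReal =
      (∫⁻ t, f t ∂posComb N x).toReal - (∫⁻ t, f t ∂posComb N (-x)).toReal := by
  have h : ∀ y : ι → ℝ, (∫⁻ t, f t ∂posComb N y).toReal =
      ∑ s, max (y s) 0 * (∫⁻ t, f t ∂N s).toReal := fun y => by
    rw [posComb, lintegral_finsetSum_measure, ENNReal.toReal_sum]
    · refine Finset.sum_congr rfl fun s _ => ?_
      rw [lintegral_smul_measure, smul_eq_mul, ENNReal.toReal_mul, ENNReal.toReal_ofReal']
    · intro s _
      rw [lintegral_smul_measure, smul_eq_mul]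
      exact ENNReal.mul_ne_top ENNReal.ofReal_ne_top (hf s)
  rw [h, h, ← Finset.sum_sub_distrib]
  refine Finset.sum_congr rfl fun s _ => ?_
  rw [← sub_mul, Pi.neg_apply]
  congr 1
  rcases le_total (x s) 0 with h | h
  · rw [max_eq_right h, max_eq_left (by linarith)]; ring
  · rw [max_eq_left h, max_eq_right (by linarith)]; ring

theorem sum_lintegral_eq_zero_of_sets [∀ s, IsFiniteMeasure (N s)]
    (h : ∀ B, MeasurableSet B → ∑ s, x s * (N s B).toReal = 0) {f : T → ℝ≥0∞}
    (hf : ∀ t, f t ≤ 1) : ∑ s, x s * (∫⁻ t, f t ∂N s).toReal = 0 := by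
  rw [sum_eq_posComb_sub N x (lintegral_ne_top_of_le_one N hf), sub_eq_zero]
  have : posComb N x = posComb N (-x) := by
    ext B hB
    have h1 := sum_eq_posComb_sub N x (f := B.indicator 1) (lintegral_ne_top_of_le_one N fun t =>
      Set.indicator_apply_le' (fun _ => le_rfl) fun _ => zero_le)
    simp only [lintegral_indicator_one hB] at h1
    rw [h B hB, eq_comm, sub_eq_zero] at h1
    exact (ENNReal.toReal_eq_toReal_iff' (measure_ne_top _ _) (measure_ne_top _ _)).1 h1
  rw [this]

theorem sum_sets_eq_zero_of_laplace (N : ι → Measure ℝ≥0) (x : ι → ℝ) [∀ s, IsFiniteMeasure (N s)]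
    (n₀ : ℕ) (h : ∀ n : ℕ, n₀ ≤ n →
      ∑ s, x s * (∫⁻ t, ENNReal.ofReal (Real.exp (-(n * t))) ∂N s).toReal = 0)
    {B : Set ℝ≥0} (hB : MeasurableSet B) : ∑ s, x s * (N s B).toReal = 0 := by
  have hle : ∀ (n : ℕ) (t : ℝ≥0), ENNReal.ofReal (Real.exp (-(n * t))) ≤ 1 := fun n t => by
    rw [← ENNReal.ofReal_one]
    refine ENNReal.ofReal_le_ofReal (Real.exp_le_one_iff.2 ?_)
    have := t.coe_nonneg
    simp; positivity
  have h1 : posComb N x = posComb N (-x) := by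
    refine ext_of_laplace n₀ fun n hn => ?_
    have h2 := sum_eq_posComb_sub N x (lintegral_ne_top_of_le_one N (hle n))
    rw [h n hn, eq_comm, sub_eq_zero] at h2
    have hfin : ∀ y, ∫⁻ t, ENNReal.ofReal (Real.exp (-(n * t))) ∂posComb N y ≠ ∞ := fun y =>
      ((lintegral_mono (hle n)).trans_lt (by simp)).ne
    exact (ENNReal.toReal_eq_toReal_iff' (hfin _) (hfin _)).1 h2
  have h2 := sum_eq_posComb_sub N x (f := B.indicator 1) (lintegral_ne_top_of_le_one N fun t =>
    Set.indicator_apply_le' (fun _ => le_rfl) fun _ => zero_le)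
  simp only [lintegral_indicator_one hB] at h2
  rw [h2, h1, sub_self]

end Signed

namespace ExpAutomaton
variable (M : ExpAutomaton)

/-! ### Words of sets of labels and words of matrices -/

/-- The probability that the labels of the next transitions are in the given sets. -/
def wordProb (w : List (Set M.Label)) : M.State → ℝ≥0∞ :=
  w.foldr (fun B φ => M.weighted (B.indicator 1) φ) 1

theorem wordProb_cons (B : Set M.Label) (w : List (Set M.Label)) :
    M.wordProb (B :: w) = M.weighted (B.indicator 1) (M.wordProb w) := rfl

theorem indicator_one_le_one {α : Type*} (B : Set α) (l : α) :
    B.indicator (1 : α → ℝ≥0∞) l ≤ 1 :=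
  Set.indicator_apply_le' (fun _ => le_rfl) fun _ => zero_le

theorem measurable_wordProb {w : List (Set M.Label)} (hw : ∀ B ∈ w, MeasurableSet B) :
    Measurable (M.wordProb w) := by
  induction w with
  | nil => exact measurable_const
  | cons B w ih =>
    exact M.measurable_weighted (measurable_one.indicator (hw B List.mem_cons_self))
      (ih fun B' h => hw B' (List.mem_cons_of_mem _ h))

theorem wordProb_le_one (w : List (Set M.Label)) (s : M.State) : M.wordProb w s ≤ 1 := by
  induction w generalizing s with
  | nil => exact le_rfl
  | cons B w ih => exact M.weighted_le_one (indicator_one_le_one B) ih s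

theorem ignoresExpired_wordProb {w : List (Set M.Label)} (hw : ∀ B ∈ w, MeasurableSet B) :
    M.IgnoresExpired (M.wordProb w) := by
  induction w with
  | nil => exact fun _ _ _ _ => rfl
  | cons B w ih =>
    have hw' : ∀ B ∈ w, MeasurableSet B := fun B' h => hw B' (List.mem_cons_of_mem _ h)
    exact M.ignoresExpired_weighted _ (M.measurable_wordProb hw') (ih hw')

/-- The time of the next transition. -/
def fireTime (s : M.State) : ℝ≥0 := (M.firing s).elim 0 fun e => enablingTime e.guard s.2

theorem measurable_fireTime : Measurable M.fireTime :=
  measurable_find?_elim M.edges M.Fire M.measurableSet_fire measurable_const fun e =>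
    M.measurable_enabling e.guard

theorem weighted_mul_time (f : ℝ≥0 → ℝ≥0∞) (g : M.Label → ℝ≥0∞) (φ : M.State → ℝ≥0∞)
    (s : M.State) : M.weighted (fun l => f l.2 * g l) φ s = f (M.fireTime s) * M.weighted g φ s := by
  rw [weighted, weighted, fireTime]
  cases M.firing s with
  | none => simp
  | some e => simp [label, mul_assoc]

/-- The labels with action `a`. -/
def actSet (a : Fin M.nA) : Set M.Label := {l | l.1 = a}

theorem measurableSet_actSet (a : Fin M.nA) : MeasurableSet (M.actSet a) :=
  measurable_fst (measurableSet_singleton a)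

/-- The distribution of the time of the next transition from a configuration, restricted to the
transitions with action `a` and weighted by the expectation of `φ` after the transition. -/
def timeDist (a : Fin M.nA) (φ : M.State → ℝ≥0∞) (s : M.Cfg) : Measure ℝ≥0 :=
  (M.clockDist.withDensity fun ζ =>
    M.weighted ((M.actSet a).indicator 1) φ (s.1, s.2.piecewise ζ 0)).map
      fun ζ => M.fireTime (s.1, s.2.piecewise ζ 0)

theorem measurable_cfg (s : M.Cfg) :
    Measurable fun ζ : Fin M.nC → ℝ => ((s.1, s.2.piecewise ζ 0) : M.State) :=
  measurable_const.prodMk (measurable_piecewise_right _ _)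

theorem lintegral_timeDist (a : Fin M.nA) {φ : M.State → ℝ≥0∞} (hφ : Measurable φ) (s : M.Cfg)
    {f : ℝ≥0 → ℝ≥0∞} (hf : Measurable f) :
    ∫⁻ t, f t ∂M.timeDist a φ s =
      M.expect (M.weighted (fun l => f l.2 * (M.actSet a).indicator 1 l) φ) s := by
  have h1 : Measurable fun ζ : Fin M.nC → ℝ => M.fireTime (s.1, s.2.piecewise ζ 0) :=
    M.measurable_fireTime.comp (M.measurable_cfg s)
  have h2 : Measurable fun ζ : Fin M.nC → ℝ =>
      M.weighted ((M.actSet a).indicator 1) φ (s.1, s.2.piecewise ζ 0) :=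
    (M.measurable_weighted (measurable_one.indicator (M.measurableSet_actSet a)) hφ).comp
      (M.measurable_cfg s)
  rw [timeDist, lintegral_map hf h1, expect]
  refine (lintegral_withDensity_eq_lintegral_mul _ h2 (hf.comp h1)).trans ?_
  refine lintegral_congr fun ζ => ?_
  rw [weighted_mul_time, mul_comm]
  rfl

theorem isFiniteMeasure_timeDist (a : Fin M.nA) {φ : M.State → ℝ≥0∞} (hφ : Measurable φ)
    (hφ1 : ∀ s, φ s ≤ 1) (s : M.Cfg) : IsFiniteMeasure (M.timeDist a φ s) := by
  refine ⟨?_⟩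
  rw [← lintegral_one, M.lintegral_timeDist a hφ s measurable_const]
  exact (M.expect_le_one (M.weighted_le_one (fun l => by
    rw [one_mul]; exact indicator_one_le_one _ l) hφ1) s).trans_lt ENNReal.one_lt_top

/-- The discounted expectation after the next transition. -/
def laplace (z : ℝ) (a : Fin M.nA) (φ : M.State → ℝ≥0∞) (s : M.Cfg) : ℝ :=
  (M.expect (M.weighted (M.discount z a) φ) s).toReal

/-- The expectation as a vector. -/
def expectVec (φ : M.State → ℝ≥0∞) (s : M.Cfg) : ℝ := (M.expect φ s).toReal

theorem laplace_eq (z : ℝ) (a : Fin M.nA) {φ : M.State → ℝ≥0∞} (hφ : Measurable φ) (s : M.Cfg) :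
    M.laplace z a φ s =
      (∫⁻ t, ENNReal.ofReal (Real.exp (-(z * t))) ∂M.timeDist a φ s).toReal := by
  rw [M.lintegral_timeDist a hφ s (measurable_exp_neg z), laplace]
  congr 3
  funext l
  by_cases h : l.1 = a
  · simp [discount, actSet, h]
  · simp [discount, actSet, h]

/-- A set of labels is the disjoint union of its sections at the finitely many actions, so measures
on the time axis suffice to describe a transition. -/
theorem expectVec_cons (B : Set M.Label) {φ : M.State → ℝ≥0∞} (hB : MeasurableSet B)
    (hφ : Measurable φ) (hφ1 : ∀ s, φ s ≤ 1) (s : M.Cfg) :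
    M.expectVec (M.weighted (B.indicator 1) φ) s =
      ∑ a, (M.timeDist a φ s {t | (a, t) ∈ B}).toReal := by
  have hBa : ∀ a, MeasurableSet {t : ℝ≥0 | (a, t) ∈ B} := fun a => measurable_prodMk_left hB
  have h1 : ∀ x, M.weighted (B.indicator 1) φ x = ∑ a, M.weighted (fun l =>
      {t : ℝ≥0 | (a, t) ∈ B}.indicator 1 l.2 * (M.actSet a).indicator 1 l) φ x := by
    intro x
    simp only [weighted]
    cases M.firing x with
    | none => simp
    | some e =>
      simp only [Option.elim_some]
      rw [← Finset.sum_mul]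
      congr 1
      rw [Finset.sum_eq_single e.act]
      · by_cases h : M.label e x ∈ B
        · rw [Set.indicator_of_mem h, Set.indicator_of_mem (by exact h),
            Set.indicator_of_mem (by rfl)]
          simp
        · rw [Set.indicator_of_notMem h, Set.indicator_of_notMem (by exact h), zero_mul]
      · intro a _ ha
        rw [Set.indicator_of_notMem (s := M.actSet a) (fun h => ha h.symm), mul_zero]
      · simp
  rw [expectVec, expect, lintegral_congr fun ζ => h1 _, lintegral_finsetSum, ENNReal.toReal_sum]
  · refine Finset.sum_congr rfl fun a _ => ?_
    rw [← lintegral_indicator_one (hBa a), M.lintegral_timeDist a hφ s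
      (measurable_one.indicator (hBa a))]
    rfl
  · intro a _
    refine ((M.expect_le_one (M.weighted_le_one (fun l => ?_) hφ1) s).trans_lt
      ENNReal.one_lt_top).ne
    exact mul_le_one' (indicator_one_le_one _ _) (indicator_one_le_one _ _)
  · intro a _
    exact (M.measurable_weighted (((measurable_one.indicator (hBa a)).comp measurable_snd).mul
      (measurable_one.indicator (M.measurableSet_actSet a))) hφ).comp (M.measurable_cfg s)

theorem abs_laplace_le {z : ℝ} (hz : 0 ≤ z) (a : Fin M.nA) {φ : M.State → ℝ≥0∞}
    (hφ1 : ∀ s, φ s ≤ 1) (s : M.Cfg) : |M.laplace z a φ s| ≤ 1 := by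
  rw [laplace, abs_of_nonneg ENNReal.toReal_nonneg]
  exact ENNReal.toReal_le_of_le_ofReal zero_le_one (by
    rw [ENNReal.ofReal_one]
    exact M.expect_le_one (M.weighted_le_one (M.discount_le_one hz a) hφ1) s)

/-- The generator with the rates of the automaton. -/
abbrev realGen : Matrix M.Cfg M.Cfg ℝ := M.gen fun c => (M.rate c : ℝ)

open Matrix in
/-- The resolvent equation. -/
theorem laplace_resolvent {z : ℝ} (hz : 0 ≤ z) (a : Fin M.nA) {φ : M.State → ℝ≥0∞}
    (hφ : Measurable φ) (hφ1 : ∀ s, φ s ≤ 1) (hφ' : M.IgnoresExpired φ) :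
    z • M.laplace z a φ =
      M.realGen *ᵥ M.laplace z a φ + z • (M.jump ℝ a *ᵥ M.expectVec φ) := by
  have hfin : ∀ s, M.expect (M.weighted (M.discount z a) φ) s ≠ ∞ := fun s =>
    ((M.expect_le_one (M.weighted_le_one (M.discount_le_one hz a) hφ1) s).trans_lt
      ENNReal.one_lt_top).ne
  have hr : ∀ c, (0 : ℝ) < M.rate c := fun c => by exact_mod_cast M.rate_pos c
  funext s
  rw [Pi.add_apply, Pi.smul_apply, Pi.smul_apply, gen_mulVec, jump_mulVec]
  -- Where no edge is enabled, the matrix of the action has a zero row and the first-step equation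
  -- remains. Where one is, the generator has a zero row and the transition happens at time zero,
  -- undiscounted.
  cases hs : M.enabled s with
  | nil =>
    obtain ⟨q, K⟩ := s
    have h1 := congrArg ENNReal.toReal (M.expect_weighted_of_not_enabled hz a hφ hφ' hs)
    rw [ENNReal.toReal_mul, ENNReal.toReal_ofReal
      (add_nonneg hz (Finset.sum_nonneg fun c _ => (hr c).le)), ENNReal.toReal_sum fun c _ =>
      ENNReal.mul_ne_top ENNReal.ofReal_ne_top (hfin _)] at h1
    simp only [ENNReal.toReal_mul, ENNReal.toReal_ofReal (hr _).le] at h1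
    simp only [List.head?_nil, if_true, smul_eq_mul, laplace, mul_sub,
      Finset.sum_sub_distrib, ← Finset.sum_mul]
    linarith
  | cons e l =>
    have he : (M.enabled s).head? = some e := by rw [hs]; rfl
    have h1 := M.expect_weighted_of_enabled (g := M.discount z a) hφ he
    rw [discount_mk] at h1
    simp only [List.head?_cons, laplace, h1, expectVec]
    by_cases ha : e.act = a <;> simp [ha]

/-- A bound for the generator. -/
def genBound : ℝ := ∑ s, ∑ u, |M.realGen s u|

theorem genBound_nonneg : 0 ≤ M.genBound :=
  Finset.sum_nonneg fun _ _ => Finset.sum_nonneg fun _ _ => abs_nonneg _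

open Matrix in
theorem abs_gen_pow_mulVec_le {y : M.Cfg → ℝ} (hy : ∀ s, |y s| ≤ 1) (k : ℕ) (s : M.Cfg) :
    |(M.realGen ^ k *ᵥ y) s| ≤ M.genBound ^ k := by
  induction k generalizing s with
  | zero => simpa using hy s
  | succ k ih =>
    rw [pow_succ', ← mulVec_mulVec, pow_succ']
    simp only [mulVec, dotProduct] at ih ⊢
    refine (Finset.abs_sum_le_sum_abs _ _).trans ?_
    have h1 : ∀ u, |M.realGen s u * ∑ i, (M.realGen ^ k) u i * y i| ≤
        |M.realGen s u| * M.genBound ^ k := fun u => by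
      rw [abs_mul]
      exact mul_le_mul_of_nonneg_left (ih u) (abs_nonneg _)
    refine (Finset.sum_le_sum fun u _ => h1 u).trans ?_
    rw [← Finset.sum_mul]
    refine mul_le_mul_of_nonneg_right ?_ (pow_nonneg M.genBound_nonneg k)
    exact Finset.single_le_sum (f := fun s => ∑ u, |M.realGen s u|)
      (fun s _ => Finset.sum_nonneg fun _ _ => abs_nonneg _) (Finset.mem_univ s)

theorem abs_dotProduct_le {ι : Type*} [Fintype ι] (x y : ι → ℝ) {C : ℝ} (hy : ∀ s, |y s| ≤ C) :
    |x ⬝ᵥ y| ≤ (∑ s, |x s|) * C := by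
  rw [Finset.sum_mul]
  refine (Finset.abs_sum_le_sum_abs _ _).trans (Finset.sum_le_sum fun s _ => ?_)
  rw [abs_mul]
  exact mul_le_mul_of_nonneg_left (hy s) (abs_nonneg _)

open Matrix in
theorem dot_gen_pow_succ {z : ℝ} (hz : 0 ≤ z) (a : Fin M.nA) {φ : M.State → ℝ≥0∞}
    (hφ : Measurable φ) (hφ1 : ∀ s, φ s ≤ 1) (hφ' : M.IgnoresExpired φ) (x : M.Cfg → ℝ) (k : ℕ) :
    x ⬝ᵥ (M.realGen ^ (k + 1) *ᵥ M.laplace z a φ) =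
      z * (x ⬝ᵥ (M.realGen ^ k *ᵥ M.laplace z a φ)) -
        z * (x ⬝ᵥ (M.realGen ^ k *ᵥ (M.jump ℝ a *ᵥ M.expectVec φ))) := by
  have h := M.laplace_resolvent hz a hφ hφ1 hφ'
  have h1 := congrArg (fun v => x ⬝ᵥ (M.realGen ^ k *ᵥ v)) h
  simp only [mulVec_smul, mulVec_add, dotProduct_smul, dotProduct_add, smul_eq_mul] at h1
  rw [pow_succ, ← mulVec_mulVec]
  linarith

-- The resolvent equation then gives `x G^k L = z^k (x L)` for all `k`. The left side grows at most
-- like `genBound ^ k`, so `x L = 0` as soon as `z` exceeds `genBound`.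
open Matrix in
theorem dot_laplace_eq_zero (a : Fin M.nA) {φ : M.State → ℝ≥0∞}
    (hφ : Measurable φ) (hφ1 : ∀ s, φ s ≤ 1) (hφ' : M.IgnoresExpired φ) (x : M.Cfg → ℝ)
    (h : ∀ k, x ⬝ᵥ (M.realGen ^ k *ᵥ (M.jump ℝ a *ᵥ M.expectVec φ)) = 0) {z : ℝ}
    (hz : M.genBound < z) : x ⬝ᵥ M.laplace z a φ = 0 := by
  have hz0 : 0 < z := M.genBound_nonneg.trans_lt hz
  have h1 : ∀ k, x ⬝ᵥ (M.realGen ^ k *ᵥ M.laplace z a φ) = z ^ k * (x ⬝ᵥ M.laplace z a φ) := by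
    intro k
    induction k with
    | zero => simp
    | succ k ih => rw [M.dot_gen_pow_succ hz0.le a hφ hφ1 hφ', h, ih]; ring
  have h2 : ∀ k : ℕ, |x ⬝ᵥ M.laplace z a φ| ≤ (∑ s, |x s|) * (M.genBound / z) ^ k := by
    intro k
    have h3 := abs_dotProduct_le x _
      (M.abs_gen_pow_mulVec_le (M.abs_laplace_le hz0.le a hφ1) k)
    rw [h1, abs_mul, abs_of_pos (pow_pos hz0 k)] at h3
    rw [div_pow, ← mul_div_assoc, le_div_iff₀ (pow_pos hz0 k)]
    linarith
  have h3 : Filter.Tendsto (fun k : ℕ => (∑ s, |x s|) * (M.genBound / z) ^ k) Filter.atTop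
      (nhds ((∑ s, |x s|) * 0)) :=
    (tendsto_pow_atTop_nhds_zero_of_lt_one (div_nonneg M.genBound_nonneg hz0.le)
      ((div_lt_one hz0).2 hz)).const_mul _
  rw [mul_zero] at h3
  exact abs_eq_zero.1 (le_antisymm (ge_of_tendsto' h3 h2) (abs_nonneg _))

-- The coefficients of the expansion in `1 / z` are extracted one by one. If `x G^k L` vanishes for
-- all `z`, the resolvent equation shows that `z * |x G^k J_a φ|` equals `|x G^(k+1) L|`, which is
-- bounded uniformly in `z`; so the coefficient is zero and `x G^(k+1) L` vanishes too.
open Matrix in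
theorem dot_gen_pow_eq_zero (a : Fin M.nA) {φ : M.State → ℝ≥0∞}
    (hφ : Measurable φ) (hφ1 : ∀ s, φ s ≤ 1) (hφ' : M.IgnoresExpired φ) (x : M.Cfg → ℝ)
    (h : ∀ z : ℝ, 0 ≤ z → x ⬝ᵥ M.laplace z a φ = 0) (k : ℕ) :
    x ⬝ᵥ (M.realGen ^ k *ᵥ (M.jump ℝ a *ᵥ M.expectVec φ)) = 0 := by
  suffices H : ∀ k, (∀ z : ℝ, 0 ≤ z → x ⬝ᵥ (M.realGen ^ k *ᵥ M.laplace z a φ) = 0) ∧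
      x ⬝ᵥ (M.realGen ^ k *ᵥ (M.jump ℝ a *ᵥ M.expectVec φ)) = 0 from (H k).2
  have H1 : ∀ k, (∀ z : ℝ, 0 ≤ z → x ⬝ᵥ (M.realGen ^ k *ᵥ M.laplace z a φ) = 0) →
      x ⬝ᵥ (M.realGen ^ k *ᵥ (M.jump ℝ a *ᵥ M.expectVec φ)) = 0 := by
    intro k hk
    set v := x ⬝ᵥ (M.realGen ^ k *ᵥ (M.jump ℝ a *ᵥ M.expectVec φ)) with hv
    set C := (∑ s, |x s|) * M.genBound ^ (k + 1) with hC
    have h1 : ∀ z : ℝ, 0 ≤ z → z * |v| ≤ C := by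
      intro z hz
      have h2 := abs_dotProduct_le x _
        (M.abs_gen_pow_mulVec_le (M.abs_laplace_le hz a hφ1) (k + 1))
      rw [M.dot_gen_pow_succ hz a hφ hφ1 hφ', hk z hz, mul_zero, zero_sub, abs_neg, abs_mul,
        abs_of_nonneg hz] at h2
      exact h2
    by_contra hne
    have hpos : 0 < |v| := abs_pos.2 hne
    have hC0 : 0 ≤ C := by simpa using h1 0 le_rfl
    have h3 := h1 ((C + 1) / |v|) (by positivity)
    rw [div_mul_cancel₀ _ hpos.ne'] at h3
    linarith
  intro k
  induction k with
  | zero =>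
    have : ∀ z : ℝ, 0 ≤ z → x ⬝ᵥ (M.realGen ^ 0 *ᵥ M.laplace z a φ) = 0 := by simpa using h
    exact ⟨this, H1 0 this⟩
  | succ k ih =>
    have : ∀ z : ℝ, 0 ≤ z → x ⬝ᵥ (M.realGen ^ (k + 1) *ᵥ M.laplace z a φ) = 0 := fun z hz => by
      rw [M.dot_gen_pow_succ hz a hφ hφ1 hφ', ih.1 z hz, ih.2]; ring
    exact ⟨this, H1 _ this⟩

-- Induction on `w` for all row vectors `x` at once. Orthogonality to the words that begin with `k`
-- generators and the action `a` says that `x G^k J_a` satisfies the same hypothesis, and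
-- `dot_laplace_eq_zero` assembles these coefficients into Laplace transforms.
open Matrix in
theorem dot_expectVec_eq_zero (w : List (Set M.Label)) (hw : ∀ B ∈ w, MeasurableSet B)
    (x : M.Cfg → ℝ) (hx : ∀ m, x ⬝ᵥ M.wordVec (fun c => (M.rate c : ℝ)) m = 0) :
    x ⬝ᵥ M.expectVec (M.wordProb w) = 0 := by
  induction w generalizing x with
  | nil =>
    have : M.expectVec (M.wordProb []) = 1 := by
      funext s
      simp [expectVec, expect, wordProb]
    rw [this]
    exact hx []
  | cons B w ih =>
    have hw' : ∀ B ∈ w, MeasurableSet B := fun B' h => hw B' (List.mem_cons_of_mem _ h)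
    have hφ := M.measurable_wordProb hw'
    have hφ1 := M.wordProb_le_one w
    have hφ' := M.ignoresExpired_wordProb hw'
    have hB := hw B List.mem_cons_self
    have hrep : ∀ (k : ℕ) m, M.wordVec (fun c => (M.rate c : ℝ)) (List.replicate k none ++ m) =
        M.realGen ^ k *ᵥ M.wordVec (fun c => (M.rate c : ℝ)) m := by
      intro k m
      induction k with
      | zero => simp
      | succ k ih =>
        rw [List.replicate_succ, List.cons_append, wordVec_cons, ih, pow_succ', ← mulVec_mulVec]
        rfl
    have h1 : ∀ a, ∀ k, x ⬝ᵥ (M.realGen ^ k *ᵥ (M.jump ℝ a *ᵥ M.expectVec (M.wordProb w))) = 0 := by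
      intro a k
      rw [mulVec_mulVec, dotProduct_mulVec]
      refine ih hw' _ fun m => ?_
      rw [← dotProduct_mulVec, ← mulVec_mulVec]
      have := hx (List.replicate k none ++ some a :: m)
      rw [hrep] at this
      exact this
    have h2 : ∀ a, ∑ s, x s * (M.timeDist a (M.wordProb w) s {t | (a, t) ∈ B}).toReal = 0 := by
      intro a
      have := M.isFiniteMeasure_timeDist a hφ hφ1
      obtain ⟨n₀, hn₀⟩ := exists_nat_gt M.genBound
      refine sum_sets_eq_zero_of_laplace _ x n₀ (fun n hn => ?_) (measurable_prodMk_left hB)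
      have h3 := M.dot_laplace_eq_zero a hφ hφ1 hφ' x (h1 a) (z := n)
        (hn₀.trans_le (by exact_mod_cast hn))
      simp only [dotProduct, M.laplace_eq n a hφ] at h3
      exact h3
    rw [wordProb_cons]
    simp only [dotProduct, M.expectVec_cons B hB hφ hφ1, Finset.mul_sum]
    rw [Finset.sum_comm]
    exact Finset.sum_eq_zero fun a _ => h2 a

-- A generator letter has no counterpart among sets of labels. Leading generators are therefore
-- collected in the exponent `k` until the next action, where `dot_gen_pow_eq_zero` deals with them
-- all and the row vector is replaced.
open Matrix in
theorem dot_wordVec_eq_zero (m : List (Option (Fin M.nA))) (x : M.Cfg → ℝ) (k : ℕ)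
    (hx : ∀ w : List (Set M.Label), (∀ B ∈ w, MeasurableSet B) →
      x ⬝ᵥ M.expectVec (M.wordProb w) = 0) :
    x ⬝ᵥ (M.realGen ^ k *ᵥ M.wordVec (fun c => (M.rate c : ℝ)) m) = 0 := by
  induction m generalizing x k with
  | nil =>
    rw [wordVec_nil]
    cases k with
    | zero =>
      have : M.expectVec (M.wordProb []) = 1 := by
        funext s
        simp [expectVec, expect, wordProb]
      have h := hx [] (by simp)
      rw [this] at h
      simpa using h
    | succ k =>
      -- The rows of a generator sum to zero, so a word that ends in a generator has value zero.
      have : M.realGen *ᵥ 1 = 0 := by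
        funext s
        rw [gen_mulVec]
        simp
      rw [pow_succ, ← mulVec_mulVec, this]
      simp
  | cons l m ih =>
    rw [wordVec_cons]
    cases l with
    | none =>
      rw [mulVec_mulVec, letter, ← pow_succ]
      exact ih x (k + 1) hx
    | some a =>
      rw [letter, mulVec_mulVec, dotProduct_mulVec]
      have := ih (x ᵥ* (M.realGen ^ k * M.jump ℝ a)) 0 fun w hw => ?_
      · simpa using this
      rw [← dotProduct_mulVec, ← mulVec_mulVec]
      have hφ := M.measurable_wordProb hw
      have hφ1 := M.wordProb_le_one w
      refine M.dot_gen_pow_eq_zero a hφ hφ1 (M.ignoresExpired_wordProb hw) x (fun z hz => ?_) k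
      have hfin := M.isFiniteMeasure_timeDist a hφ hφ1
      simp only [dotProduct, M.laplace_eq z a hφ]
      refine sum_lintegral_eq_zero_of_sets _ x (fun B hB => ?_) fun t => ?_
      -- The label set `{a} ×ˢ B` isolates the time distribution of the single action `a`.
      · have hB' : MeasurableSet ({a} ×ˢ B : Set M.Label) := (measurableSet_singleton a).prod hB
        have h1 := hx (({a} ×ˢ B) :: w) (by
          intro B' h
          rcases List.mem_cons.1 h with rfl | h
          · exact hB'
          · exact hw B' h)
        rw [wordProb_cons] at h1
        simp only [dotProduct, M.expectVec_cons _ hB' hφ hφ1] at h1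
        rw [← h1]
        refine Finset.sum_congr rfl fun s _ => ?_
        rw [Finset.sum_eq_single a]
        · simp
        · intro b _ hb
          simp [hb]
        · simp
      · rw [← ENNReal.ofReal_one]
        refine ENNReal.ofReal_le_ofReal (Real.exp_le_one_iff.2 ?_)
        have := mul_nonneg hz t.coe_nonneg
        linarith

open Matrix in
theorem expect_wordProb_eq_iff (s₁ s₂ : M.Cfg) :
    (∀ w : List (Set M.Label), (∀ B ∈ w, MeasurableSet B) →
      M.expect (M.wordProb w) s₁ = M.expect (M.wordProb w) s₂) ↔
    ∀ m, M.wordVec (fun c => (M.rate c : ℝ)) m s₁ = M.wordVec (fun c => (M.rate c : ℝ)) m s₂ := by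
  have h0 : ∀ y : M.Cfg → ℝ, (Pi.single s₁ 1 - Pi.single s₂ 1) ⬝ᵥ y = y s₁ - y s₂ := fun y => by
    rw [sub_dotProduct, single_one_dotProduct, single_one_dotProduct]
  have h1 : ∀ w, M.expect (M.wordProb w) s₁ = M.expect (M.wordProb w) s₂ ↔
      (Pi.single s₁ 1 - Pi.single s₂ 1) ⬝ᵥ M.expectVec (M.wordProb w) = 0 := fun w => by
    have hfin : ∀ s, M.expect (M.wordProb w) s ≠ ∞ := fun s =>
      ((M.expect_le_one (M.wordProb_le_one w) s).trans_lt ENNReal.one_lt_top).ne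
    rw [h0, sub_eq_zero, expectVec, expectVec, ENNReal.toReal_eq_toReal_iff' (hfin _) (hfin _)]
  have h2 : ∀ m, M.wordVec (fun c => (M.rate c : ℝ)) m s₁ =
      M.wordVec (fun c => (M.rate c : ℝ)) m s₂ ↔
      (Pi.single s₁ 1 - Pi.single s₂ 1) ⬝ᵥ M.wordVec (fun c => (M.rate c : ℝ)) m = 0 := fun m => by
    rw [h0, sub_eq_zero]
  simp only [h1, h2]
  constructor
  · intro h m
    simpa using M.dot_wordVec_eq_zero m _ 0 h
  · intro h w hw
    exact M.dot_expectVec_eq_zero w hw _ h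

end ExpAutomaton
end DistBisim

end

noncomputable section

namespace DistBisim
open StochAutomaton

/-! ### Convex combinations -/

section Convex
variable {S : Type*} [MeasurableSpace S]

theorem IsConvexComb.nonempty {Y : Set (ProbabilityMeasure S)} {μ : ProbabilityMeasure S}
    (h : IsConvexComb Y μ) : Y.Nonempty := by
  obtain ⟨ν, hν, -⟩ := h
  rw [Set.nonempty_iff_ne_empty]
  rintro rfl
  simp at hν

theorem isConvexComb_of_mem {Y : Set (ProbabilityMeasure S)} (hY : MeasurableSet Y)
    {μ : ProbabilityMeasure S} (h : μ ∈ Y) : IsConvexComb Y μ := by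
  refine ⟨Measure.dirac μ, by rw [Measure.dirac_apply' _ hY]; simp [h], fun X hX => ?_⟩
  exact (lintegral_dirac' μ ((Measure.measurable_coe hX).comp measurable_subtype_coe)).symm

/-- The mixing measure is concentrated at `m`. Countable generation makes `{m}` measurable, so full
mass of this set is an almost-everywhere statement. -/
theorem IsConvexComb.eq_of_singleton [MeasurableSpace.CountablyGenerated S]
    {μ m : ProbabilityMeasure S} (h : IsConvexComb {m} μ) : μ = m := by
  obtain ⟨ν, hν, hμ⟩ := h
  have h1 : ν Set.univ = 1 := by simpa using (hμ Set.univ .univ).symm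
  have hp : IsProbabilityMeasure ν := ⟨h1⟩
  have h2 : ∀ᵐ m' ∂ν, m' = m := (prob_compl_eq_zero_iff (measurableSet_singleton m)).2 hν
  refine Subtype.ext (Measure.ext fun X hX => ?_)
  have h3 : ∀ᵐ m' : ProbabilityMeasure S ∂ν, (m' : Measure S) X = (m : Measure S) X :=
    h2.mono fun m' h => by rw [h]
  exact (hμ X hX).trans ((lintegral_congr_ae h3).trans (by simp))

end Convex

theorem NLMP.Reachable.trans {S L : Type*} [MeasurableSpace S] [MeasurableSpace L] {P : NLMP S L}
    {μ ν ρ : ProbabilityMeasure S} (h : P.Reachable μ ν) (h' : P.Reachable ν ρ) :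
    P.Reachable μ ρ := by
  induction h' with
  | init => exact h
  | step A hA _ h2 ih => exact ih.step A hA h2

/-! ### Bisimilarity of deterministic automata as equality of word probabilities -/

namespace ExpAutomaton
variable (M : ExpAutomaton)

/-- The semantics of the automaton. -/
abbrev proc : NLMP M.State M.Label := M.toStochAutomaton.nlmp

theorem fires_iff (e : M.Edges) (s : M.State) (t : ℝ≥0) :
    M.toStochAutomaton.Fires e s t ↔ M.Fire e s ∧ enablingTime e.guard s.2 = t := by
  constructor
  · intro h
    have h1 := h.2.2.1
    subst h1
    exact ⟨h, rfl⟩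
  · rintro ⟨h, rfl⟩
    exact h

theorem mem_proc_τ (l : M.Label) (s : M.State) (μ : ProbabilityMeasure M.State) :
    μ ∈ M.proc.τ l s ↔ ∃ e, M.Fire e s ∧ M.label e s = l ∧ μ = M.after e s := by
  change (∃ e : M.Edges, e.act = l.1 ∧ M.toStochAutomaton.Fires e s l.2 ∧ _) ↔ _
  refine exists_congr fun e => ?_
  rw [fires_iff]
  constructor
  · rintro ⟨h1, ⟨h2, h3⟩, h4⟩
    refine ⟨h2, Prod.ext h1 h3, ?_⟩
    rw [h4, ← h3]
    rfl
  · rintro ⟨h1, rfl, h3⟩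
    exact ⟨rfl, ⟨h1, rfl⟩, h3⟩

theorem trans_after {B : Set M.Label} {e : M.Edges} {s : M.State} (h : M.Fire e s)
    (hB : M.label e s ∈ B) : M.proc.Trans B s (M.after e s) :=
  ⟨_, hB, isConvexComb_of_mem (M.proc.measurableSet_τ _ _) ((M.mem_proc_τ _ _ _).2 ⟨e, h, rfl, rfl⟩)⟩

theorem mem_live (B : Set M.Label) (s : M.State) :
    s ∈ M.proc.live B ↔ ∃ e, M.Fire e s ∧ M.label e s ∈ B := by
  constructor
  · rintro ⟨μ, l, hl, h⟩
    obtain ⟨μ', hμ'⟩ := h.nonempty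
    obtain ⟨e, he, rfl, -⟩ := (M.mem_proc_τ _ _ _).1 hμ'
    exact ⟨e, he, hl⟩
  · rintro ⟨e, he, hB⟩
    exact ⟨_, M.trans_after he hB⟩

theorem measurableSet_live {B : Set M.Label} (hB : MeasurableSet B) :
    MeasurableSet (M.proc.live B) := by
  have : M.proc.live B = ⋃ e, {s | M.Fire e s} ∩ M.label e ⁻¹' B := by
    ext s
    simp [mem_live]
  rw [this]
  exact .iUnion fun e => (M.measurableSet_fire e).inter (M.measurable_label e hB)

/-- At most one edge can be taken. -/
def UniqueFire (s : M.State) : Prop := ∀ e e', M.Fire e s → M.Fire e' s → e = e'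

theorem firing_eq_some {s : M.State} (hs : M.UniqueFire s) {e : M.Edges} (he : M.Fire e s) :
    M.firing s = some e := by
  have hmem := ((M.fire_iff e s).1 he).1
  obtain ⟨e', he'⟩ : ∃ e', M.firing s = some e' :=
    Option.isSome_iff_exists.1 (List.find?_isSome.2 ⟨e, hmem, by simpa using he⟩)
  rw [he', hs e' e (by simpa using List.find?_some he') he]

theorem exists_of_weighted_ne_zero {B : Set M.Label} {φ : M.State → ℝ≥0∞} {s : M.State}
    (h : M.weighted (B.indicator 1) φ s ≠ 0) : s ∈ M.proc.live B := by
  rw [weighted] at h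
  cases hs : M.firing s with
  | none => simp [hs] at h
  | some e =>
    refine (M.mem_live B s).2 ⟨e, by simpa using List.find?_some hs, ?_⟩
    by_contra hB
    simp [hs, hB] at h

/-- If only one edge can be taken, it fixes the label and the set of available distributions is a
singleton, so no freedom is left in the transition. -/
theorem weighted_of_trans {B : Set M.Label} (φ : M.State → ℝ≥0∞) {s : M.State}
    (hs : M.UniqueFire s) {μ : ProbabilityMeasure M.State} (h : M.proc.Trans B s μ) :
    M.weighted (B.indicator 1) φ s = ∫⁻ x, φ x ∂(μ : Measure M.State) := by
  obtain ⟨l, hl, h⟩ := h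
  obtain ⟨μ', hμ'⟩ := h.nonempty
  obtain ⟨e, he, rfl, -⟩ := (M.mem_proc_τ _ _ _).1 hμ'
  have h1 : M.proc.τ (M.label e s) s = {M.after e s} := by
    ext m
    rw [mem_proc_τ, Set.mem_singleton_iff]
    constructor
    · rintro ⟨e', he', -, rfl⟩
      rw [hs e' e he' he]
    · rintro rfl
      exact ⟨e, he, rfl, rfl⟩
  rw [h1] at h
  rw [h.eq_of_singleton, weighted, M.firing_eq_some hs he, Option.elim_some,
    Set.indicator_of_mem hl, Pi.one_apply, one_mul]

theorem weighted_eq_indicator {B : Set M.Label} (φ : M.State → ℝ≥0∞) {s : M.State}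
    (hs : M.UniqueFire s) {f : M.State → ProbabilityMeasure M.State}
    (hf : ∀ s ∈ M.proc.live B, M.proc.Trans B s (f s)) :
    M.weighted (B.indicator 1) φ s =
      (M.proc.live B).indicator (fun s => ∫⁻ x, φ x ∂(f s : Measure M.State)) s := by
  by_cases h : s ∈ M.proc.live B
  · rw [Set.indicator_of_mem h, M.weighted_of_trans φ hs (hf s h)]
  · rw [Set.indicator_of_notMem h]
    by_contra h'
    exact h (M.exists_of_weighted_ne_zero h')

theorem lintegral_weighted_one {B : Set M.Label} (hB : MeasurableSet B)
    {μ : ProbabilityMeasure M.State} (hμ : ∀ᵐ s ∂(μ : Measure M.State), M.UniqueFire s) :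
    ∫⁻ s, M.weighted (B.indicator 1) 1 s ∂(μ : Measure M.State) =
      (μ : Measure M.State) (M.proc.live B) := by
  rw [← lintegral_indicator_one (M.measurableSet_live hB)]
  refine lintegral_congr_ae (hμ.mono fun s hs => ?_)
  by_cases h : s ∈ M.proc.live B
  · obtain ⟨ν, hν⟩ := id h
    simp only [M.weighted_of_trans 1 hs hν, Set.indicator_of_mem h]
    simp
  · rw [Set.indicator_of_notMem h]
    by_contra h'
    exact h (M.exists_of_weighted_ne_zero h')

theorem lintegral_weighted_eq_zero {B : Set M.Label} {μ : ProbabilityMeasure M.State}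
    (h : (μ : Measure M.State) (M.proc.live B) = 0) (φ : M.State → ℝ≥0∞) :
    ∫⁻ s, M.weighted (B.indicator 1) φ s ∂(μ : Measure M.State) = 0 := by
  have h1 : ∀ᵐ s ∂(μ : Measure M.State), M.weighted (B.indicator 1) φ s = 0 :=
    measure_mono_null (fun s hs => M.exists_of_weighted_ne_zero hs) h
  rw [lintegral_congr_ae h1, lintegral_zero]

/-- The right side does not mention the measurable choice in the lifted transition: almost surely it
is forced, so the integrals after the step depend only on `μ` and `B`. -/
theorem lintegral_of_liftTrans {B : Set M.Label} (hB : MeasurableSet B)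
    {μ ν : ProbabilityMeasure M.State} (hμ : ∀ᵐ s ∂(μ : Measure M.State), M.UniqueFire s)
    (h : M.proc.LiftTrans B μ ν) {φ : M.State → ℝ≥0∞} (hφ : Measurable φ) :
    ∫⁻ s, φ s ∂(ν : Measure M.State) = ((μ : Measure M.State) (M.proc.live B))⁻¹ *
      ∫⁻ s, M.weighted (B.indicator 1) φ s ∂(μ : Measure M.State) := by
  obtain ⟨-, f, hf, hf', hν⟩ := h
  have hf1 : Measurable fun s => (f s : Measure M.State) := measurable_subtype_coe.comp hf
  have h1 : (ν : Measure M.State) = ((μ : Measure M.State) (M.proc.live B))⁻¹ •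
      ((μ : Measure M.State).restrict (M.proc.live B)).bind fun s => (f s : Measure M.State) := by
    ext X hX
    rw [hν X hX, Measure.smul_apply, Measure.bind_apply hX hf1.aemeasurable, smul_eq_mul]
  rw [h1, lintegral_smul_measure, Measure.lintegral_bind hf1.aemeasurable hφ.aemeasurable,
    smul_eq_mul, ← lintegral_indicator (M.measurableSet_live hB)]
  congr 1
  exact lintegral_congr_ae (hμ.mono fun s hs => (M.weighted_eq_indicator φ hs hf').symm)

open Classical in
theorem exists_liftTrans {B : Set M.Label} (hB : MeasurableSet B) {μ : ProbabilityMeasure M.State}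
    (h : (μ : Measure M.State) (M.proc.live B) ≠ 0) : ∃ ν, M.proc.LiftTrans B μ ν := by
  obtain ⟨p, hp⟩ : ∃ p : M.Edges → M.State → Prop, ∀ e s, p e s ↔ M.Fire e s ∧ M.label e s ∈ B :=
    ⟨_, fun _ _ => Iff.rfl⟩
  have hpm : ∀ e, MeasurableSet {s | p e s} := fun e => by
    simp only [hp]
    exact (M.measurableSet_fire e).inter (M.measurable_label e hB)
  -- Take the first edge of the list that fires with a label in `B`. The default `μ` is used outside
  -- the live states only, where it does not count.
  let f : M.State → ProbabilityMeasure M.State := fun s =>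
    (M.edges.find? fun e => decide (p e s)).elim μ fun e => M.after e s
  have hf : Measurable f :=
    measurable_find?_elim M.edges p hpm measurable_const M.measurable_after
  have hf' : ∀ s ∈ M.proc.live B, M.proc.Trans B s (f s) := by
    intro s hs
    obtain ⟨e, he⟩ := (M.mem_live B s).1 hs
    obtain ⟨e', he'⟩ := Option.isSome_iff_exists.1 (List.find?_isSome (p := fun e => decide (p e s)).2
      ⟨e, ((M.fire_iff e s).1 he.1).1, decide_eq_true ((hp e s).2 he)⟩)
    have h1 := (hp e' s).1 (by simpa using List.find?_some he')
    have h2 : f s = M.after e' s := by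
      simp only [f, he', Option.elim_some]
    rw [h2]
    exact M.trans_after h1.1 h1.2
  have hf1 : Measurable fun s => (f s : Measure M.State) := measurable_subtype_coe.comp hf
  let ν : Measure M.State := ((μ : Measure M.State) (M.proc.live B))⁻¹ •
      ((μ : Measure M.State).restrict (M.proc.live B)).bind fun s => (f s : Measure M.State)
  have hν : ∀ X, MeasurableSet X → ν X = ((μ : Measure M.State) (M.proc.live B))⁻¹ *
      ∫⁻ s in M.proc.live B, (f s : Measure M.State) X ∂(μ : Measure M.State) := fun X hX => by
    rw [Measure.smul_apply, Measure.bind_apply hX hf1.aemeasurable, smul_eq_mul]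
  have hν1 : IsProbabilityMeasure ν := by
    refine ⟨?_⟩
    rw [hν _ .univ]
    simp [ENNReal.inv_mul_cancel h (measure_ne_top _ _)]
  exact ⟨⟨ν, hν1⟩, h, f, hf, hf', hν⟩

/-- In all distributions that can be reached, almost surely no two edges are enabled. -/
def AlwaysUnique (μ : ProbabilityMeasure M.State) : Prop :=
  ∀ ν, M.proc.Reachable μ ν → ∀ᵐ s ∂(ν : Measure M.State), M.UniqueFire s

theorem AlwaysUnique.step {M : ExpAutomaton} {μ ν : ProbabilityMeasure M.State}
    (h : M.AlwaysUnique μ) {B : Set M.Label} (hB : MeasurableSet B)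
    (hν : M.proc.LiftTrans B μ ν) : M.AlwaysUnique ν := fun ρ hρ =>
  h ρ ((NLMP.Reachable.init.step B hB hν).trans hρ)

theorem AlwaysUnique.ae {M : ExpAutomaton} {μ : ProbabilityMeasure M.State}
    (h : M.AlwaysUnique μ) : ∀ᵐ s ∂(μ : Measure M.State), M.UniqueFire s := h μ .init

/-- Two edges that fire both have the least enabling time, so they become enabled simultaneously;
determinism makes this a null event unless they coincide. -/
theorem alwaysUnique_initial (h : M.toStochAutomaton.Deterministic) (q : Fin M.nQ) :
    M.AlwaysUnique (M.toStochAutomaton.initial q) := by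
  intro ν hν
  refine measure_mono_null (fun s hs => ?_) (h q ν hν)
  by_contra h'
  refine hs fun e e' he he' => ?_
  by_contra hne
  refine h' ⟨e, e', hne, enablingTime e.guard s.2, he, (M.fires_iff _ _ _).2 ⟨he', ?_⟩⟩
  have h1 := (M.fire_iff e s).1 he
  have h2 := (M.fire_iff e' s).1 he'
  exact le_antisymm (h2.2.2 e h1.1 h1.2.1) (h1.2.2 e' h2.1 h2.2.1)

/-- Related distributions have equal live mass. If it is zero, both integrals vanish; otherwise
related successors exist, the induction hypothesis equates their integrals, and multiplying by the
mass undoes the conditioning. -/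
theorem lintegral_wordProb_eq_of_bisimulation
    {R : ProbabilityMeasure M.State → ProbabilityMeasure M.State → Prop}
    (hR : M.proc.IsBisimulation R) {w : List (Set M.Label)} (hw : ∀ B ∈ w, MeasurableSet B)
    {μ ν : ProbabilityMeasure M.State} (hμ : M.AlwaysUnique μ) (hν : M.AlwaysUnique ν)
    (h : R μ ν) :
    ∫⁻ s, M.wordProb w s ∂(μ : Measure M.State) = ∫⁻ s, M.wordProb w s ∂(ν : Measure M.State) := by
  induction w generalizing μ ν with
  | nil => simp [wordProb]
  | cons B w ih =>
    have hB := hw B List.mem_cons_self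
    have hw' : ∀ B ∈ w, MeasurableSet B := fun B' h => hw B' (List.mem_cons_of_mem _ h)
    have hmass := hR.mass μ ν h B hB
    simp only [wordProb_cons]
    by_cases h0 : (μ : Measure M.State) (M.proc.live B) = 0
    · rw [M.lintegral_weighted_eq_zero h0, M.lintegral_weighted_eq_zero (hmass ▸ h0)]
    · obtain ⟨μ', hμ'⟩ := M.exists_liftTrans hB h0
      obtain ⟨ν', hν', h'⟩ := hR.step μ ν h B hB μ' hμ'
      have h1 := ih hw' (hμ.step hB hμ') (hν.step hB hν') h'
      rw [M.lintegral_of_liftTrans hB hμ.ae hμ' (M.measurable_wordProb hw'),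
        M.lintegral_of_liftTrans hB hν.ae hν' (M.measurable_wordProb hw'), ← hmass] at h1
      exact (ENNReal.mul_right_inj (ENNReal.inv_ne_zero.2 (measure_ne_top _ _))
        (ENNReal.inv_ne_top.2 h0)).1 h1

/-- One-letter words determine the live masses. The word `B :: w` determines the integral of `w`
after any transition under `B`, so every successor of `ν` is a valid answer. Almost sure uniqueness
is part of the relation and passes to successors. -/
theorem isBisimulation_wordProb : M.proc.IsBisimulation fun μ ν =>
    M.AlwaysUnique μ ∧ M.AlwaysUnique ν ∧
      ∀ w : List (Set M.Label), (∀ B ∈ w, MeasurableSet B) →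
        ∫⁻ s, M.wordProb w s ∂(μ : Measure M.State) =
          ∫⁻ s, M.wordProb w s ∂(ν : Measure M.State) := by
  have hmass : ∀ μ ν : ProbabilityMeasure M.State, (M.AlwaysUnique μ ∧ M.AlwaysUnique ν ∧
      ∀ w : List (Set M.Label), (∀ B ∈ w, MeasurableSet B) →
        ∫⁻ s, M.wordProb w s ∂(μ : Measure M.State) =
          ∫⁻ s, M.wordProb w s ∂(ν : Measure M.State)) → ∀ B : Set M.Label, MeasurableSet B →
      (μ : Measure M.State) (M.proc.live B) = (ν : Measure M.State) (M.proc.live B) := by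
    rintro μ ν ⟨hμ, hν, h⟩ B hB
    rw [← M.lintegral_weighted_one hB hμ.ae, ← M.lintegral_weighted_one hB hν.ae]
    exact h [B] (by simpa using hB)
  refine ⟨fun μ ν h => ⟨h.2.1, h.1, fun w hw => (h.2.2 w hw).symm⟩, hmass, ?_⟩
  intro μ ν h B hB μ' hμ'
  have hm := hmass μ ν h B hB
  obtain ⟨ν', hν'⟩ := M.exists_liftTrans (μ := ν) hB (hm ▸ hμ'.1)
  refine ⟨ν', hν', h.1.step hB hμ', h.2.1.step hB hν', fun w hw => ?_⟩
  rw [M.lintegral_of_liftTrans hB h.1.ae hμ' (M.measurable_wordProb hw),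
    M.lintegral_of_liftTrans hB h.2.1.ae hν' (M.measurable_wordProb hw), hm]
  congr 1
  exact h.2.2 (B :: w) (List.forall_mem_cons.2 ⟨hB, hw⟩)

theorem bisimilarLoc_iff (h : M.toStochAutomaton.Deterministic) (q₁ q₂ : Fin M.nQ) :
    M.toStochAutomaton.BisimilarLoc q₁ q₂ ↔
      ∀ w : List (Set M.Label), (∀ B ∈ w, MeasurableSet B) →
        M.expect (M.wordProb w) (M.start q₁) = M.expect (M.wordProb w) (M.start q₂) := by
  have h1 : ∀ w : List (Set M.Label), (∀ B ∈ w, MeasurableSet B) → ∀ q,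
      M.expect (M.wordProb w) (M.start q) =
        ∫⁻ s, M.wordProb w s ∂(M.toStochAutomaton.initial q : Measure M.State) := fun w hw q =>
    (M.lintegral_initial q (M.measurable_wordProb hw)).symm
  constructor
  · rintro ⟨R, hR, h2⟩ w hw
    rw [h1 w hw, h1 w hw]
    exact M.lintegral_wordProb_eq_of_bisimulation hR hw (M.alwaysUnique_initial h q₁)
      (M.alwaysUnique_initial h q₂) h2
  · intro h2
    refine ⟨_, M.isBisimulation_wordProb, M.alwaysUnique_initial h q₁,
      M.alwaysUnique_initial h q₂, fun w hw => ?_⟩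
    rw [← h1 w hw, ← h1 w hw]
    exact h2 w hw

end ExpAutomaton
end DistBisim
end

/-! ### The decision theorem -/

theorem mainTheorem2 :
    ∃ (p : DistBisim.Prog) (b : Polynomial ℕ) (k : ℕ),
      ∀ M : DistBisim.ExpAutomaton, M.toStochAutomaton.Deterministic →
        ∀ q₁ q₂ : Fin M.nQ, ∃ t : ℕ, t ≤ b.eval M.size * 2 ^ (k * M.nC) ∧
          p.Runs (M.encodeInput q₁ q₂)
            (DistBisim.Val.ofProp (M.toStochAutomaton.BisimilarLoc q₁ q₂)) t := by
  obtain ⟨p, T, ⟨k, hT⟩, -, hp⟩ := DistBisim.polyTimeIn_decision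
  obtain ⟨b, hb⟩ := DistBisim.ExpAutomaton.exists_polynomial_bound k
  refine ⟨p, b, k, fun M hM q₁ q₂ => ?_⟩
  obtain ⟨t, ht, hr⟩ := hp (M.rawInput q₁ q₂)
  refine ⟨t, ht.trans ((hT _).trans (le_trans ?_ (hb M.size M.nC))), ?_⟩
  · have h := M.size_encodeInput_le q₁ q₂
    rw [M.encodeInput_eq] at h
    beta_reduce
    rw [M.length_rates_rawInput]
    exact Nat.pow_le_pow_left (Nat.add_le_add_right (Nat.add_le_add_right h _) _) k
  · have h := (M.bisimilarLoc_iff hM q₁ q₂).trans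
      ((M.expect_wordProb_eq_iff (M.start q₁) (M.start q₂)).trans (M.decision_iff q₁ q₂).symm)
    have h2 : DistBisim.Val.ofProp (M.toStochAutomaton.BisimilarLoc q₁ q₂) =
        DistBisim.Enc.enc (DistBisim.Raw.decision (M.rawInput q₁ q₂)
          (DistBisim.Raw.bitLists (M.rawInput q₁ q₂).rates.length)) := by
      rw [DistBisim.Val.ofProp]
      by_cases hB : M.toStochAutomaton.BisimilarLoc q₁ q₂
      · rw [if_pos hB, h.1 hB]
        rfl
      · rw [if_neg hB, Bool.eq_false_iff.2 fun h' => hB (h.2 h')]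
        rfl
    rw [h2, M.encodeInput_eq]
    exact hr
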